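/- **Setting.** Let $n\ge 1$, and consider the $n$-qubit stoquastic XY Hamiltonian $$H=\sum_{1\le i<j\le n}(-a_{ij}X_iX_j+b_{ij}Y_iY_j)+\sum_{i=1}^n d_iZ_i,\qquad |b_{ij}|\le a_{ij}\le \tfrac12,\quad |d_i|\le 1,$$ an inverse temperature $\beta\ge 1$, a precision $0<\varepsilon\le 1$ and a number $L\in\mathbb N$ of Trotter steps. Put $\delta=\beta/(2L)$, $$C=\prod_{i<j}\bigl(I+\delta(a_{ij}X_iX_j-b_{ij}Y_iY_j)\bigr)\prod_i(I-\delta d_iZ_i)\quad(\text{pairs in lexicographic order}),\qquad (CC^\dagger)^L=O_1O_2\cdots O_M,$$ where $O_1,\dots,O_M$ are the one- and two-qubit factors, $M_1$ of them acting on one qubit and $M_2$ on two. Draw $O_1,\dots,O_M$ as boxes, periodically in imaginary time; a box has an upper and a lower leg on each qubit on which it acts, and the lower leg of a box on a qubit is joined by a line to the upper leg, on the same qubit, of the next box acting on that qubit. A *configuration* assigns a bit to every leg. A line whose two ends carry different bits carries a *worm head* (an inserted Pauli $X$, whose place on the line is immaterial). The weight $W$ of a configuration is the product over the boxes of the matrix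 elements $\langle\text{upper bits}|O_m|\text{lower bits}\rangle$. Let $\mathcal C_0$ and $\mathcal C_2$ be the sets of configurations with $W\ne0$ and with no, respectively exactly two, worm heads; the elements of $\mathcal C_0$ are the strings of basis states $(\sigma_1,\dots,\sigma_M)$ of nonzero weight $\prod_m\langle\sigma_m|O_m|\sigma_{m+1}\rangle$, $\sigma_{M+1}=\sigma_1$. Let $\pi$ be the probability distribution on $\mathcal C_0\cup\mathcal C_2$ proportional to $W$ on $\mathcal C_0$ and to $\frac{2}{M_1+2M_2}W$ on $\mathcal C_2$. **Operator-loop chain $\mathcal M$ on $\mathcal C_0\cup\mathcal C_2$.** From a configuration in $\mathcal C_0$ choose one of the $2M_1+4M_2$ legs of the boxes uniformly at random; from a configuration in $\mathcal C_2$ choose uniformly one of the four legs at the ends of the two lines that carry worm heads. Let $k$ be the chosen leg and $O_m$ its box. Choose a leg $k'$ of $O_m$ (possibly $k'=k$) with probability proportional to the weight that $O_m$ has after flipping the bits on $k$ and then on $k'$, and perform these two flips (nothing changes if $k'=k$). This creates two worm heads, moves one, or annihilates both. **Constants.** Let $c_{\min}$ be the least nonzero number among $a_{ij}-b_{ij}$,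 $a_{ij}+b_{ij}$, $i<j$ (and $c_{\min}=1$ if there is none). For $0<\eta<1$ let $t_{\rm mix}(x,\eta)=\min\{t\ge0:\|P^t(x,\cdot)-\pi\|_{TV}\le\eta\}$, where $P$ is the transition matrix of $\mathcal M$. **Theorem.** For every $K>0$ there are $C_K>0$ and $p\in\mathbb N$ such that for all $n,H,\beta,\varepsilon$ as above and every number of Trotter steps $L$ with $$L\ge\beta,\qquad n^2\beta^2\le K L,\qquad L\le K\,n^2\beta^2\varepsilon^{-1}$$ (in particular for $L$ of the order $n^2\beta^2\varepsilon^{-1}$), the all-zero configuration $x=(|0\rangle^{\otimes n},\dots,|0\rangle^{\otimes n})$ belongs to $\mathcal C_0$ and, for all $0<\eta<1$, $t_{\rm mix}(x,\eta)$ exists and satisfies $$t_{\rm mix}(x,\eta)\le C_K\,c_{\min}^{-1}\,n^{16}\beta^{8}\varepsilon^{-4}\,\Bigl(1+\ln\frac{n\beta}{\varepsilon}\Bigr)^{p}\Bigl(1+\ln\frac1\eta\Bigr),$$ that is, the mixing time is $c_{\min}^{-1}\,\tilde{\mathcal O}(n^{16}\beta^8\varepsilon^{-4})$. -/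

import Mathlib

open scoped Kronecker

noncomputable section

namespace XYWorm

/-- The coefficients of the `n`-qubit Hamiltonian
`H = ∑_{i<j} (-a i j X_i X_j + b i j Y_i Y_j) + ∑_i d i Z_i`.
Only the entries `a i j`, `b i j` with `i < j` are ever used. -/
structure Coeffs (n : ℕ) where
  a : Fin n → Fin n → ℝ
  b : Fin n → Fin n → ℝ
  d : Fin n → ℝ

/-- The family of stoquastic XY Hamiltonians: `|b i j| ≤ a i j ≤ 1/2` and `|d i| ≤ 1`. -/
def Coeffs.IsStoquastic {n : ℕ} (H : Coeffs n) : Prop :=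
  (∀ i j, i < j → |H.b i j| ≤ H.a i j ∧ H.a i j ≤ 1 / 2) ∧ ∀ i, |H.d i| ≤ 1

/-- The finite set of the nonzero numbers among `a i j - b i j`, `a i j + b i j`, `i < j`. -/
def Coeffs.amplitudes {n : ℕ} (H : Coeffs n) : Finset ℝ :=
  (((Finset.univ.filter fun p : Fin n × Fin n => p.1 < p.2).image
      fun p => H.a p.1 p.2 - H.b p.1 p.2) ∪
    ((Finset.univ.filter fun p : Fin n × Fin n => p.1 < p.2).image
      fun p => H.a p.1 p.2 + H.b p.1 p.2)).filter fun c => c ≠ 0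

/-- `c_min`: the least nonzero amplitude `a i j ± b i j`, `i < j`.  All amplitudes of a stoquastic
Hamiltonian are at most `1`, so inserting `1` only fixes the value `1` when there is none. -/
def Coeffs.cMin {n : ℕ} (H : Coeffs n) : ℝ :=
  (insert 1 H.amplitudes).min' (Finset.insert_nonempty _ _)

/-! ### Operators -/

def pauliX : Matrix (Fin 2) (Fin 2) ℂ := !![0, 1; 1, 0]

def pauliY : Matrix (Fin 2) (Fin 2) ℂ := !![0, -Complex.I; Complex.I, 0]

def pauliZ : Matrix (Fin 2) (Fin 2) ℂ := !![1, 0; 0, -1]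

/-- The one-qubit operator `I - δ d Z`. -/
def oneQubitOp (δ d : ℝ) : Matrix (Fin 2) (Fin 2) ℂ :=
  1 - ((δ * d : ℝ) : ℂ) • pauliZ

/-- The two-qubit operator `I + δ (a X ⊗ X - b Y ⊗ Y)`. -/
def twoQubitOp (δ a b : ℝ) : Matrix (Fin 2 × Fin 2) (Fin 2 × Fin 2) ℂ :=
  1 + (δ : ℂ) • ((a : ℂ) • (pauliX ⊗ₖ pauliX) - (b : ℂ) • (pauliY ⊗ₖ pauliY))

/-- The label of an operator in the Trotter product: a field operator on the qubit `i`, or an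
interaction operator on the qubits `i` and `j`. -/
inductive Gate (n : ℕ) where
  | one (i : Fin n) : Gate n
  | two (i j : Fin n) : Gate n

/-- The qubits on which an operator acts. -/
def Gate.support {n : ℕ} : Gate n → Finset (Fin n)
  | .one i => {i}
  | .two i j => {i, j}

def Gate.isTwoQubit {n : ℕ} : Gate n → Bool
  | .one _ => false
  | .two _ _ => true

/-- The legs of a box.  The leg `(q, false)` is the upper one on the qubit `q` (it carries the bit
of the bra) and `(q, true)` is the lower one (it carries the bit of the ket). -/
abbrev Gate.Leg {n : ℕ} (g : Gate n) : Type := g.support × Bool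

/-- The weight `⟨s_upper| O |s_lower⟩` of a box whose legs carry the bits `s`.  (All the matrix
entries are real.) -/
def Gate.weight {n : ℕ} (H : Coeffs n) (δ : ℝ) : (g : Gate n) → (g.Leg → Fin 2) → ℝ
  | .one i, s =>
      (oneQubitOp δ (H.d i)
        (s (⟨i, by simp [Gate.support]⟩, false)) (s (⟨i, by simp [Gate.support]⟩, true))).re
  | .two i j, s =>
      (twoQubitOp δ (H.a i j) (H.b i j)
        (s (⟨i, by simp [Gate.support]⟩, false), s (⟨j, by simp [Gate.support]⟩, false))
        (s (⟨i, by simp [Gate.support]⟩, true), s (⟨j, by simp [Gate.support]⟩, true))).re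

/-- The factors of
`C = ∏_{i<j} (I + δ (a i j X_i X_j - b i j Y_i Y_j)) * ∏_i (I - δ d i Z_i)`, from left to right
(the pairs in lexicographic order). -/
def stepGates (n : ℕ) : List (Gate n) :=
  ((List.finRange n).flatMap fun i =>
      ((List.finRange n).filter fun j => i < j).map fun j => Gate.two i j) ++
    (List.finRange n).map Gate.one

/-- The factors `O_1, ..., O_M` of `(C C†)^L`, from left to right.  As every factor is Hermitian,
`C†` is the product of the factors of `C` in the reverse order. -/
def gates (n L : ℕ) : List (Gate n) :=
  (List.replicate L (stepGates n ++ (stepGates n).reverse)).flatten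

/-- The total number `M` of operators. -/
abbrev numOps (n L : ℕ) : ℕ := (gates n L).length

/-- The operator `O_m`. -/
abbrev op {n L : ℕ} (m : Fin (numOps n L)) : Gate n := (gates n L).get m

/-- The number `M₁` of one-qubit operators. -/
def numOne (n L : ℕ) : ℕ := (gates n L).countP fun g => !g.isTwoQubit

/-- The number `M₂` of two-qubit operators. -/
def numTwo (n L : ℕ) : ℕ := (gates n L).countP fun g => g.isTwoQubit

/-! ### Diagrams -/

/-- A leg of the diagram: a box together with one of its legs. -/
abbrev Leg (n L : ℕ) : Type := Σ m : Fin (numOps n L), (op m).Leg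

/-- `Joined k l`: the lower leg `k` is joined by a vertical line to the upper leg `l`.  That is,
`l` belongs to the first operator on the same qubit that comes after the operator of `k` in the
(periodic) imaginary time direction. -/
def Joined {n L : ℕ} (k l : Leg n L) : Prop :=
  k.2.2 = true ∧ l.2.2 = false ∧ (k.2.1 : Fin n) = (l.2.1 : Fin n) ∧
    ∃ r : ℕ, 0 < r ∧ (l.1 : ℕ) = ((k.1 : ℕ) + r) % numOps n L ∧
      ∀ s : ℕ, 0 < s → s < r → ∀ m : Fin (numOps n L),
        (m : ℕ) = ((k.1 : ℕ) + s) % numOps n L → (k.2.1 : Fin n) ∉ (op m).support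

/-- An assignment of bits to all legs of the diagram.  A Pauli-`X` operator (worm head) sits on a
vertical line exactly if the bits at the two ends of the line differ; where on the line it sits
does not matter, which is the identification of diagrams under sliding worm heads along lines. -/
abbrev Config (n L : ℕ) : Type := Leg n L → Fin 2

/-- The configuration without worm heads given by a string `σ_1, ..., σ_M` of computational basis
states, with `σ_{M+1} = σ_1`: the operator `O_m` sits between `σ_m` and `σ_{m+1}`. -/
def ofStates {n L : ℕ} (σ : Fin (numOps n L) → Fin n → Fin 2) : Config n L :=
  fun k => if k.2.2 then σ (finRotate _ k.1) k.2.1 else σ k.1 k.2.1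

/-- The weight of a box in a configuration. -/
def boxWeight {n L : ℕ} (H : Coeffs n) (δ : ℝ) (f : Config n L) (m : Fin (numOps n L)) : ℝ :=
  (op m).weight H δ fun k => f ⟨m, k⟩

/-- The weight `W` of a configuration: the product of the weights of all boxes. -/
def weight {n L : ℕ} (H : Coeffs n) (δ : ℝ) (f : Config n L) : ℝ :=
  ∏ m, boxWeight H δ f m

open Classical in
/-- The worm heads, each represented by the leg at the upper end of its line. -/
def heads {n L : ℕ} (f : Config n L) : Finset (Leg n L) :=
  Finset.univ.filter fun k => ∃ l, Joined k l ∧ f k ≠ f l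

open Classical in
/-- The legs of boxes that are met when a worm head is moved in one of its two directions. -/
def headLegs {n L : ℕ} (f : Config n L) : Finset (Leg n L) :=
  Finset.univ.filter fun k => ∃ l, (Joined k l ∨ Joined l k) ∧ f k ≠ f l

/-- The state space `𝒞₀ ∪ 𝒞₂`: configurations of nonzero weight with no or two worm heads. -/
def State {n : ℕ} (H : Coeffs n) (δ : ℝ) (L : ℕ) : Type :=
  {f : Config n L // ((heads f).card = 0 ∨ (heads f).card = 2) ∧ weight H δ f ≠ 0}

open Classical in
instance {n : ℕ} (H : Coeffs n) (δ : ℝ) (L : ℕ) : Fintype (State H δ L) :=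
  inferInstanceAs (Fintype {f : Config n L //
    ((heads f).card = 0 ∨ (heads f).card = 2) ∧ weight H δ f ≠ 0})

open Classical in
instance {n : ℕ} (H : Coeffs n) (δ : ℝ) (L : ℕ) : DecidableEq (State H δ L) :=
  Classical.decEq _

/-! ### The Markov chain -/

/-- The unnormalized stationary weight: `W` on `𝒞₀` and `2 / (M₁ + 2 M₂) * W` on `𝒞₂`. -/
def unnormalized {n : ℕ} (H : Coeffs n) (δ : ℝ) {L : ℕ} (x : State H δ L) : ℝ :=
  if (heads x.1).card = 0 then weight H δ x.1
  else 2 / ((numOne n L : ℝ) + 2 * (numTwo n L : ℝ)) * weight H δ x.1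

/-- The distribution `π` on `𝒞₀ ∪ 𝒞₂`. -/
def stationary {n : ℕ} (H : Coeffs n) (δ : ℝ) {L : ℕ} (x : State H δ L) : ℝ :=
  unnormalized H δ x / ∑ y : State H δ L, unnormalized H δ y

/-- Flip the bit on one leg. -/
def flipLeg {n L : ℕ} (k : Leg n L) (f : Config n L) : Config n L :=
  Function.update f k (f k + 1)

/-- Flip the bits on the legs `k` and `k'` of the box `m`.  This moves a worm head sitting at `k`
to `k'`, creates a pair of worm heads at `k` and `k'`, or annihilates such a pair.  For `k = k'`
nothing changes. -/
def move {n L : ℕ} (m : Fin (numOps n L)) (k k' : (op m).Leg) (f : Config n L) : Config n L :=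
  flipLeg ⟨m, k'⟩ (flipLeg ⟨m, k⟩ f)

/-- The heat-bath probability that a worm head entering the box `m` at the leg `k` leaves it at the
leg `k'`. -/
def heatBath {n L : ℕ} (H : Coeffs n) (δ : ℝ) (f : Config n L) (m : Fin (numOps n L))
    (k k' : (op m).Leg) : ℝ :=
  boxWeight H δ (move m k k' f) m / ∑ k'' : (op m).Leg, boxWeight H δ (move m k k'' f) m

/-- The legs from which the next step chooses uniformly: all `2 M₁ + 4 M₂` legs of boxes on `𝒞₀`,
and the four legs next to the two worm heads on `𝒞₂`. -/
def startLegs {n L : ℕ} (f : Config n L) : Finset (Leg n L) :=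
  if (heads f).card = 0 then Finset.univ else headLegs f

open Classical in
/-- The transition matrix of the operator-loop Markov chain. -/
def transition {n : ℕ} (H : Coeffs n) (δ : ℝ) (L : ℕ) :
    Matrix (State H δ L) (State H δ L) ℝ :=
  fun x y => ∑ k ∈ startLegs x.1, ((startLegs x.1).card : ℝ)⁻¹ *
    ∑ k' : (op k.1).Leg, if y.1 = move k.1 k.2 k' x.1 then heatBath H δ x.1 k.1 k.2 k' else 0

/-- The total variation distance. -/
def tvDist {Ω : Type*} [Fintype Ω] (μ ν : Ω → ℝ) : ℝ :=
  (∑ y, |μ y - ν y|) / 2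

/-- `IsMixingTime P π x η t`: `t` is the least time at which the chain `P` started at `x` is within
total variation distance `η` of `π`. -/
def IsMixingTime {Ω : Type*} [Fintype Ω] [DecidableEq Ω] (P : Matrix Ω Ω ℝ) (π : Ω → ℝ) (x : Ω)
    (η : ℝ) (t : ℕ) : Prop :=
  IsLeast {t : ℕ | tvDist ((P ^ t) x) π ≤ η} t

end XYWorm

end

/-! The proof bounds the spectral gap of the chain by a Poincaré inequality, which comes from a flow
of canonical paths in the style of windable functions.

Reversibility and positivity. Flipping the chosen leg leads to an odd intermediate configuration ζ,
and the heat-bath choice of the second leg depends only on ζ and on the box. Let N = M₁ + 2M₂ be the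
number of vertical lines. The factor 2/N in π is exactly what gives every admissible first flip the
same prefactor W/(2N), on 𝒞₀ as well as on 𝒞₂. Hence ⟨f, Pf⟩ is a sum of squares over pairs (ζ,
box), as `sum_mul_mulVec_transition` shows. The chain is therefore reversible with nonnegative
spectrum, and a Poincaré constant R gives mixing within R (log(1/π(x)) + 2 log(1/η)) + 1 steps
(`exists_isMixingTime_le`).

The flow. The weight of every box is windable: w(x)w(y) splits over pairings of the legs at which x
and y differ, and each part is unchanged when bits are exchanged on whole pairs
(`isWindable_twoWeight` is the essential case). A choice of pairings in all boxes, together with the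
vertical lines, breaks the difference set of x and y into paths and loops. Exchanging the pairs one
after another along these turns x into y by moves of the chain. The intermediate configuration z,
its complement z' and the pairing determine x, y and the time (`unwinding_injective`), so the flow
through z is at most W(z) times the total weight of the possible z'. If x and y have no heads, z'
has its heads exactly where z has them. The only quantity needed is then a bound κ for the ratio of
the partition function with two given heads to that without heads (`sum_headFree_le`). If x has two
heads, one of them is kept in place until the path reaches 𝒞₀, and there the path stops. The
complement never has more than two heads, and what remains is the variance on 𝒞₀, which is already
controlled (`sum_twoHeaded_le`).

The ratio κ. Sums over configurations with given heads are bounded by traces of transfer matrices.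
With A = CC†, which is positive semidefinite, two heads change at most two blocks, and tr(A^k D A^l
E) ≤ 2d² tr A^(k+l) by diagonalization. Every box is within δ of the identity in norm and a block
has at most 4n² boxes, so n²β² ≤ KL bounds κ in terms of K alone (`sum_weight_heads_le`,
`transfer_ratio_le`).

Altogether R = 832 κ² N³/(δ c_min). With N ≤ 8n²L, δ = β/(2L), L ≤ K n²β²/ε and log(1/π(x)) of order
n²β up to logarithms, this is the stated bound. -/

namespace XYWorm

/-! ### Mixing of reversible chains with nonnegative spectrum. -/

section Mixing

variable {Ω : Type*} [Fintype Ω]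

theorem sum_mul_mulVec_comm_of_reversible {P : Matrix Ω Ω ℝ} {π : Ω → ℝ}
    (hrev : ∀ x y, π x * P x y = π y * P y x) (f g : Ω → ℝ) :
    ∑ x, π x * f x * (P.mulVec g) x = ∑ x, π x * (P.mulVec f) x * g x := by
  simp only [Matrix.mulVec, dotProduct, Finset.mul_sum, Finset.sum_mul]
  rw [Finset.sum_comm]
  refine Finset.sum_congr rfl fun y _ => Finset.sum_congr rfl fun x _ => ?_
  linear_combination (f x * g y) * hrev x y

theorem sum_mulVec_of_reversible {P : Matrix Ω Ω ℝ} {π : Ω → ℝ}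
    (hrev : ∀ x y, π x * P x y = π y * P y x) (hrow : ∀ x, ∑ y, P x y = 1) (f : Ω → ℝ) :
    ∑ x, π x * (P.mulVec f) x = ∑ x, π x * f x := by
  have h := sum_mul_mulVec_comm_of_reversible hrev (fun _ => 1) f
  simp only [mul_one] at h
  rw [h]
  refine Finset.sum_congr rfl fun x _ => ?_
  simp [Matrix.mulVec, dotProduct, hrow]

/-- A reversible transition matrix with nonnegative spectrum contracts the variance by the
Poincaré constant. -/
theorem sum_sq_mulVec_le {P : Matrix Ω Ω ℝ} {π : Ω → ℝ} (hπ : ∀ x, 0 < π x)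
    (hrev : ∀ x y, π x * P x y = π y * P y x) (hrow : ∀ x, ∑ y, P x y = 1)
    (hpsd : ∀ f : Ω → ℝ, 0 ≤ ∑ x, π x * f x * (P.mulVec f) x) {R : ℝ} (hR : 0 < R)
    (hpoin : ∀ f : Ω → ℝ, ∑ x, π x * f x = 0 →
      ∑ x, π x * f x ^ 2 ≤ R * (∑ x, π x * f x ^ 2 - ∑ x, π x * f x * (P.mulVec f) x))
    (f : Ω → ℝ) (hf : ∑ x, π x * f x = 0) :
    ∑ x, π x * (P.mulVec f) x ^ 2 ≤ (1 - 1 / R) * ∑ x, π x * f x ^ 2 := by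
  set g := P.mulVec f with hg
  have hg0 : ∑ x, π x * g x = 0 := by rw [hg, sum_mulVec_of_reversible hrev hrow, hf]
  have hsq : ∀ h : Ω → ℝ, 0 ≤ ∑ x, π x * h x ^ 2 := fun h =>
    Finset.sum_nonneg fun x _ => mul_nonneg (hπ x).le (sq_nonneg _)
  -- The Poincaré inequality itself forces ⟨g, Pg⟩ ≤ ⟨g, g⟩: otherwise its right-hand side would be
  -- negative.
  have hcontr : ∑ x, π x * g x * (P.mulVec g) x ≤ ∑ x, π x * g x ^ 2 := by
    have := hpoin g hg0
    have h2 := hsq g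
    by_contra hcon
    push Not at hcon
    nlinarith
  have hsym : ∑ x, π x * f x * (P.mulVec g) x = ∑ x, π x * g x ^ 2 := by
    rw [sum_mul_mulVec_comm_of_reversible hrev]
    exact Finset.sum_congr rfl fun x _ => by rw [← hg]; ring
  -- Nonnegativity of the form at f - Pf. With `hcontr` it gives ‖Pf‖² ≤ ⟨f, Pf⟩, to which the
  -- Poincaré inequality for f applies; this is where eigenvalues near -1 are excluded.
  have hform : ∑ x, π x * f x * (P.mulVec f) x
      - 2 * ∑ x, π x * g x ^ 2 + ∑ x, π x * g x * (P.mulVec g) x ≥ 0 := by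
    have h := hpsd (f - g)
    have h2 : ∑ x, π x * g x * (P.mulVec f) x = ∑ x, π x * g x ^ 2 :=
      Finset.sum_congr rfl fun x _ => by rw [← hg]; ring
    have h3 : ∑ x, π x * (f - g) x * (P.mulVec (f - g)) x
        = ∑ x, π x * f x * (P.mulVec f) x - ∑ x, π x * f x * (P.mulVec g) x
          - ∑ x, π x * g x * (P.mulVec f) x + ∑ x, π x * g x * (P.mulVec g) x := by
      rw [Matrix.mulVec_sub, ← Finset.sum_sub_distrib, ← Finset.sum_sub_distrib,
        ← Finset.sum_add_distrib]
      exact Finset.sum_congr rfl fun x _ => by simp only [Pi.sub_apply]; ring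
    rw [h3, hsym, h2] at h
    linarith
  have hp := hpoin f hf
  have h4 : ∑ x, π x * f x ^ 2 / R
      ≤ ∑ x, π x * f x ^ 2 - ∑ x, π x * f x * (P.mulVec f) x := by
    rw [← Finset.sum_div, div_le_iff₀ hR]; linarith
  rw [← Finset.sum_div] at h4
  have h5 : (1 - 1 / R) * ∑ x, π x * f x ^ 2
      = ∑ x, π x * f x ^ 2 - (∑ x, π x * f x ^ 2) / R := by ring
  rw [h5]
  linarith

variable [DecidableEq Ω]

theorem sum_sq_pow_mulVec_le {P : Matrix Ω Ω ℝ} {π : Ω → ℝ} (hπ : ∀ x, 0 < π x)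
    (hrev : ∀ x y, π x * P x y = π y * P y x) (hrow : ∀ x, ∑ y, P x y = 1)
    (hpsd : ∀ f : Ω → ℝ, 0 ≤ ∑ x, π x * f x * (P.mulVec f) x) {R : ℝ} (hR : 1 ≤ R)
    (hpoin : ∀ f : Ω → ℝ, ∑ x, π x * f x = 0 →
      ∑ x, π x * f x ^ 2 ≤ R * (∑ x, π x * f x ^ 2 - ∑ x, π x * f x * (P.mulVec f) x))
    (t : ℕ) (f : Ω → ℝ) (hf : ∑ x, π x * f x = 0) :
    ∑ x, π x * ((P ^ t).mulVec f) x = 0 ∧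
      ∑ x, π x * ((P ^ t).mulVec f) x ^ 2 ≤ (1 - 1 / R) ^ t * ∑ x, π x * f x ^ 2 := by
  have hR0 : 0 < R := by linarith
  have h0 : 0 ≤ 1 - 1 / R := by
    rw [sub_nonneg, div_le_one hR0]; exact hR
  induction t with
  | zero => simp [hf]
  | succ t ih =>
    rw [pow_succ', ← Matrix.mulVec_mulVec]
    refine ⟨by rw [sum_mulVec_of_reversible hrev hrow, ih.1], ?_⟩
    refine (sum_sq_mulVec_le hπ hrev hrow hpsd hR0 hpoin _ ih.1).trans ?_
    rw [pow_succ', mul_assoc]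
    exact mul_le_mul_of_nonneg_left ih.2 h0

theorem reversible_pow {P : Matrix Ω Ω ℝ} {π : Ω → ℝ}
    (hrev : ∀ x y, π x * P x y = π y * P y x) (t : ℕ) (x y : Ω) :
    π x * (P ^ t) x y = π y * (P ^ t) y x := by
  induction t generalizing x y with
  | zero =>
    by_cases h : x = y
    · simp [h]
    · simp [h, Ne.symm h]
  | succ t ih =>
    conv_rhs => rw [pow_succ']
    rw [pow_succ, Matrix.mul_apply, Matrix.mul_apply, Finset.mul_sum, Finset.mul_sum]
    refine Finset.sum_congr rfl fun z _ => ?_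
    rw [← mul_assoc, ih, ← mul_assoc, ← hrev z y]
    ring

theorem sum_pow_row {P : Matrix Ω Ω ℝ} (hrow : ∀ x, ∑ y, P x y = 1) (t : ℕ) (x : Ω) :
    ∑ y, (P ^ t) x y = 1 := by
  induction t generalizing x with
  | zero => simp [Matrix.one_apply]
  | succ t ih =>
    simp only [pow_succ', Matrix.mul_apply]
    rw [Finset.sum_comm]
    simp only [← Finset.mul_sum, ih, mul_one, hrow]

/-- By reversibility the density of the law at time t, minus 1, is P^t applied to f, the density of
the point mass at x minus 1. This f has mean zero and second moment at most 1/π(x), so the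
contraction of the variance and Cauchy–Schwarz give the bound; the factor 1/2 in the distance is
given away. -/
theorem tvDist_pow_le {P : Matrix Ω Ω ℝ} {π : Ω → ℝ} (hπ : ∀ x, 0 < π x) (hsum : ∑ x, π x = 1)
    (hrev : ∀ x y, π x * P x y = π y * P y x) (hrow : ∀ x, ∑ y, P x y = 1)
    (hpsd : ∀ f : Ω → ℝ, 0 ≤ ∑ x, π x * f x * (P.mulVec f) x) {R : ℝ} (hR : 1 ≤ R)
    (hpoin : ∀ f : Ω → ℝ, ∑ x, π x * f x = 0 →
      ∑ x, π x * f x ^ 2 ≤ R * (∑ x, π x * f x ^ 2 - ∑ x, π x * f x * (P.mulVec f) x))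
    (x : Ω) (t : ℕ) :
    tvDist ((P ^ t) x) π ≤ Real.sqrt ((1 - 1 / R) ^ t / π x) := by
  set f : Ω → ℝ := fun y => (if y = x then 1 / π x else 0) - 1 with hfdef
  have hf0 : ∑ y, π y * f y = 0 := by
    simp only [hfdef, mul_sub, mul_one, Finset.sum_sub_distrib, hsum, mul_ite, mul_zero,
      Finset.sum_ite_eq', Finset.mem_univ, if_true]
    rw [mul_one_div_cancel (hπ x).ne', sub_self]
  have hf2 : ∑ y, π y * f y ^ 2 ≤ 1 / π x := by
    have : ∀ y, π y * f y ^ 2 = (if y = x then 1 / π x - 2 else 0) + π y := by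
      intro y
      simp only [hfdef]
      split_ifs with h
      · subst h; have := (hπ y).ne'; field_simp; ring
      · ring
    simp only [this, Finset.sum_add_distrib, Finset.sum_ite_eq', Finset.mem_univ, if_true, hsum]
    linarith
  obtain ⟨-, hle⟩ := sum_sq_pow_mulVec_le hπ hrev hrow hpsd hR hpoin t f hf0
  have hrowt := sum_pow_row hrow t
  have hval : ∀ y, (P ^ t) x y - π y = π y * ((P ^ t).mulVec f) y := by
    intro y
    have h1 : ((P ^ t).mulVec f) y = (P ^ t) y x / π x - 1 := by
      simp only [Matrix.mulVec, dotProduct, hfdef, mul_sub, mul_ite, mul_zero, mul_one,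
        Finset.sum_sub_distrib, Finset.sum_ite_eq', Finset.mem_univ, if_true, hrowt]
      ring
    rw [h1]
    have h2 := reversible_pow hrev t x y
    have := (hπ x).ne'
    field_simp
    linarith
  have hR0 : 0 < R := by linarith
  have h0 : 0 ≤ 1 - 1 / R := by
    rw [sub_nonneg, div_le_one hR0]; exact hR
  have hcs : (∑ y, |(P ^ t) x y - π y|) ^ 2 ≤ (1 - 1 / R) ^ t / π x := by
    have h1 : ∀ y, |(P ^ t) x y - π y| = π y * |((P ^ t).mulVec f) y| := by
      intro y; rw [hval, abs_mul, abs_of_pos (hπ y)]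
    simp only [h1]
    have h2 := Finset.sum_sq_le_sum_mul_sum_of_sq_le_mul Finset.univ (r := fun y =>
      π y * |((P ^ t).mulVec f) y|) (f := π) (g := fun y => π y * ((P ^ t).mulVec f) y ^ 2)
      (fun y _ => (hπ y).le) (fun y _ => mul_nonneg (hπ y).le (sq_nonneg _))
      (fun y _ => by rw [mul_pow, sq_abs]; exact le_of_eq (by ring))
    refine h2.trans ?_
    rw [hsum, one_mul]
    refine hle.trans ?_
    rw [div_eq_mul_one_div ((1 - 1 / R) ^ t)]
    exact mul_le_mul_of_nonneg_left hf2 (pow_nonneg h0 t)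
  have hnn : 0 ≤ ∑ y, |(P ^ t) x y - π y| := Finset.sum_nonneg fun _ _ => abs_nonneg _
  unfold tvDist
  have := Real.le_sqrt_of_sq_le hcs
  linarith

/-- Mixing time bound from a Poincaré inequality. -/
theorem exists_isMixingTime_le {P : Matrix Ω Ω ℝ} {π : Ω → ℝ} (hπ : ∀ x, 0 < π x)
    (hsum : ∑ x, π x = 1)
    (hrev : ∀ x y, π x * P x y = π y * P y x) (hrow : ∀ x, ∑ y, P x y = 1)
    (hpsd : ∀ f : Ω → ℝ, 0 ≤ ∑ x, π x * f x * (P.mulVec f) x) {R : ℝ} (hR : 1 ≤ R)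
    (hpoin : ∀ f : Ω → ℝ, ∑ x, π x * f x = 0 →
      ∑ x, π x * f x ^ 2 ≤ R * (∑ x, π x * f x ^ 2 - ∑ x, π x * f x * (P.mulVec f) x))
    (x : Ω) {η : ℝ} (hη : 0 < η) (hη1 : η < 1) :
    ∃ t : ℕ, IsMixingTime P π x η t ∧
      (t : ℝ) ≤ R * (Real.log (1 / π x) + 2 * Real.log (1 / η)) + 1 := by
  have hR0 : 0 < R := by linarith
  have hπ1 : π x ≤ 1 := by
    rw [← hsum]; exact Finset.single_le_sum (fun y _ => (hπ y).le) (Finset.mem_univ x)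
  have hlog : 0 ≤ Real.log (1 / π x) := Real.log_nonneg (by rw [le_div_iff₀ (hπ x)]; linarith)
  have hlogη : 0 ≤ Real.log (1 / η) := Real.log_nonneg (by rw [le_div_iff₀ hη]; linarith)
  -- The time after which exp(-s/R) ≤ η² π(x), which makes the square root in `tvDist_pow_le` at
  -- most η.
  set s := ⌈R * (Real.log (1 / π x) + 2 * Real.log (1 / η))⌉₊ with hs
  have hmem : s ∈ {t : ℕ | tvDist ((P ^ t) x) π ≤ η} := by
    refine (tvDist_pow_le hπ hsum hrev hrow hpsd hR hpoin x s).trans ?_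
    rw [Real.sqrt_le_left hη.le, div_le_iff₀ (hπ x)]
    have h1 : 1 - 1 / R ≤ Real.exp (-(1 / R)) := by
      have := Real.add_one_le_exp (-(1 / R)); linarith
    have h0 : 0 ≤ 1 - 1 / R := by
      rw [sub_nonneg, div_le_one hR0]; exact hR
    calc (1 - 1 / R) ^ s ≤ Real.exp (-(1 / R)) ^ s := pow_le_pow_left₀ h0 h1 s
      _ = Real.exp (-(s / R)) := by rw [← Real.exp_nat_mul]; congr 1; ring
      _ ≤ Real.exp (Real.log (η ^ 2 * π x)) := by
        apply Real.exp_le_exp.mpr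
        rw [Real.log_mul (by positivity) (hπ x).ne', Real.log_pow]
        have h2 : R * (Real.log (1 / π x) + 2 * Real.log (1 / η)) ≤ s := Nat.le_ceil _
        rw [one_div, one_div, Real.log_inv, Real.log_inv] at h2
        have h3 : (-Real.log (π x) + 2 * -Real.log η) ≤ s / R := by
          rw [le_div_iff₀ hR0]; linarith
        push_cast
        linarith
      _ = η ^ 2 * π x := Real.exp_log (mul_pos (by positivity) (hπ x))
  have hne : {t : ℕ | tvDist ((P ^ t) x) π ≤ η}.Nonempty := ⟨s, hmem⟩
  refine ⟨sInf {t : ℕ | tvDist ((P ^ t) x) π ≤ η}, ⟨Nat.sInf_mem hne, fun t ht =>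
    Nat.sInf_le ht⟩, ?_⟩
  have h1 : ((sInf {t : ℕ | tvDist ((P ^ t) x) π ≤ η} : ℕ) : ℝ) ≤ s := by
    exact_mod_cast Nat.sInf_le hmem
  refine h1.trans (Nat.ceil_lt_add_one ?_).le
  positivity

end Mixing

/-! ### Unwinding a paired set of legs -/

section Unwind

variable {Λ : Type*} [DecidableEq Λ]

/-- The elements of `R` whose partner under `ι` lies outside `R`. -/
def bdry (ι : Λ → Λ) (R : Finset Λ) : Finset Λ := R.filter fun k => ι k ∉ R

/-- `p` restricts to a fixed-point-free involution of `R`. -/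
def PairsUp (p : Λ → Λ) (R : Finset Λ) : Prop := ∀ k ∈ R, p k ∈ R ∧ p k ≠ k ∧ p (p k) = k

theorem mem_bdry {ι : Λ → Λ} {R : Finset Λ} {k : Λ} : k ∈ bdry ι R ↔ k ∈ R ∧ ι k ∉ R := by
  simp [bdry]

open Classical in
/-- The next element to be removed from `R`: a boundary element if possible, preferably one that is
not in `A`. -/
noncomputable def nextLeg (ι : Λ → Λ) (A R : Finset Λ) (h : R.Nonempty) : Λ :=
  if h1 : (bdry ι R \ A).Nonempty then h1.choose
  else if h2 : (bdry ι R).Nonempty then h2.choose else h.choose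

open Classical in
noncomputable def unwindStep (ι p : Λ → Λ) (A R : Finset Λ) : Finset Λ :=
  if h : R.Nonempty then R \ {nextLeg ι A R h, p (nextLeg ι A R h)} else R

/-- What is left of `D` after the removal of `t` pairs. -/
noncomputable def unwind (ι p : Λ → Λ) (A D : Finset Λ) (t : ℕ) : Finset Λ := (unwindStep ι p A)^[t] D

theorem unwind_zero (ι p : Λ → Λ) (A D : Finset Λ) : unwind ι p A D 0 = D := rfl

theorem unwind_succ (ι p : Λ → Λ) (A D : Finset Λ) (t : ℕ) :
    unwind ι p A D (t + 1) = unwindStep ι p A (unwind ι p A D t) :=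
  Function.iterate_succ_apply' _ _ _

theorem unwindStep_empty (ι p : Λ → Λ) (A : Finset Λ) : unwindStep ι p A ∅ = ∅ := by
  simp [unwindStep]

theorem exists_unwindStep_eq (ι p : Λ → Λ) (A : Finset Λ) {R : Finset Λ} (h : R.Nonempty) :
    ∃ k ∈ R, unwindStep ι p A R = R \ {k, p k} ∧ ((bdry ι R \ A).Nonempty → k ∈ bdry ι R \ A) ∧
      ((bdry ι R).Nonempty → k ∈ bdry ι R) := by
  refine ⟨nextLeg ι A R h, ?_, by rw [unwindStep, dif_pos h], ?_, ?_⟩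
  · unfold nextLeg
    split_ifs with h1 h2
    · exact (mem_bdry.1 (Finset.mem_sdiff.1 h1.choose_spec).1).1
    · exact (mem_bdry.1 h2.choose_spec).1
    · exact h.choose_spec
  · intro h1
    rw [nextLeg, dif_pos h1]
    exact h1.choose_spec
  · intro h2
    unfold nextLeg
    split_ifs with h1
    · exact (Finset.mem_sdiff.1 h1.choose_spec).1
    · exact h2.choose_spec

theorem unwindStep_subset (ι p : Λ → Λ) (A R : Finset Λ) : unwindStep ι p A R ⊆ R := by
  unfold unwindStep
  split_ifs
  · exact Finset.sdiff_subset
  · exact subset_rfl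

theorem unwind_antitone (ι p : Λ → Λ) (A D : Finset Λ) : Antitone (unwind ι p A D) :=
  antitone_nat_of_succ_le fun t => by
    rw [unwind_succ]; exact unwindStep_subset _ _ _ _

theorem unwind_subset (ι p : Λ → Λ) (A D : Finset Λ) (t : ℕ) : unwind ι p A D t ⊆ D :=
  unwind_antitone ι p A D (Nat.zero_le t)

theorem PairsUp.sdiff {p : Λ → Λ} {R : Finset Λ} (hp : PairsUp p R) {k : Λ} (hk : k ∈ R) :
    PairsUp p (R \ {k, p k}) := by
  intro l hl
  simp only [Finset.mem_sdiff, Finset.mem_insert, Finset.mem_singleton, not_or] at hl ⊢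
  obtain ⟨h1, h2, h3⟩ := hp l hl.1
  refine ⟨⟨h1, ?_, ?_⟩, h2, h3⟩
  · intro h; exact hl.2.2 (by rw [← h, h3])
  · intro h
    have := congrArg p h
    rw [h3, (hp k hk).2.2] at this
    exact hl.2.1 this

theorem PairsUp.unwindStep {p : Λ → Λ} {R : Finset Λ} (hp : PairsUp p R) (ι : Λ → Λ)
    (A : Finset Λ) : PairsUp p (unwindStep ι p A R) := by
  rcases R.eq_empty_or_nonempty with rfl | h
  · rwa [unwindStep_empty]
  · obtain ⟨k, hk, h1, -⟩ := exists_unwindStep_eq ι p A h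
    rw [h1]; exact hp.sdiff hk

theorem PairsUp.unwind {p : Λ → Λ} {D : Finset Λ} (hp : PairsUp p D) (ι : Λ → Λ) (A : Finset Λ)
    (t : ℕ) : PairsUp p (unwind ι p A D t) := by
  induction t with
  | zero => exact hp
  | succ t ih => rw [unwind_succ]; exact ih.unwindStep ι A

theorem card_unwind_le (ι p : Λ → Λ) (A D : Finset Λ) (t : ℕ) :
    (unwind ι p A D t).card ≤ D.card - t := by
  induction t with
  | zero => simp [unwind_zero]
  | succ t ih =>
    rw [unwind_succ]
    rcases (unwind ι p A D t).eq_empty_or_nonempty with h | h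
    · rw [h, unwindStep_empty]; simp
    · obtain ⟨k, hk, h1, -⟩ := exists_unwindStep_eq ι p A h
      have : unwindStep ι p A (unwind ι p A D t) ⊂ unwind ι p A D t := by
        rw [h1]
        refine Finset.ssubset_iff_subset_ne.2 ⟨Finset.sdiff_subset, fun h => ?_⟩
        rw [← h] at hk
        simp at hk
      have := Finset.card_lt_card this
      omega

theorem unwind_eq_empty (ι p : Λ → Λ) (A D : Finset Λ) {t : ℕ} (ht : D.card ≤ t) :
    unwind ι p A D t = ∅ := by
  have := card_unwind_le ι p A D t
  rw [← Finset.card_eq_zero]; omega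

variable {ι p : Λ → Λ}

/-- Creation of two heads: taking a pair out of a set closed under ι cuts exactly the two lines that
end at the pair. `hιp` excludes that the pair is itself a line; in the diagram lines join different
boxes while pairs stay inside one. -/
theorem bdry_sdiff_of_bdry_eq_empty (hι : Function.Involutive ι) (hfix : ∀ k, ι k ≠ k)
    (hιp : ∀ k, ι k ≠ p k) {R : Finset Λ} (hp : PairsUp p R) (hR : bdry ι R = ∅) {k : Λ}
    (hk : k ∈ R) : bdry ι (R \ {k, p k}) = {ι k, ι (p k)} ∧ ι k ≠ ι (p k) := by
  have hcl : ∀ l ∈ R, ι l ∈ R := by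
    intro l hl
    by_contra h
    have : l ∈ bdry ι R := mem_bdry.2 ⟨hl, h⟩
    simp [hR] at this
  obtain ⟨h1, h2, h3⟩ := hp k hk
  refine ⟨?_, fun h => h2 (hι.injective h).symm⟩
  ext l
  simp only [mem_bdry, Finset.mem_sdiff, Finset.mem_insert, Finset.mem_singleton, not_or, not_and,
    not_not]
  constructor
  · rintro ⟨⟨hl, -, -⟩, h⟩
    by_cases hlk : ι l = k
    · left; rw [← hlk, hι]
    · right; rw [← h (hcl l hl) hlk, hι]
  · rintro (rfl | rfl)
    · refine ⟨⟨hcl _ hk, hfix _, hιp _⟩, ?_⟩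
      rw [hι]; simp
    · refine ⟨⟨hcl _ h1, ?_, hfix _⟩, ?_⟩
      · intro h
        have := hιp (p k)
        rw [h, h3] at this
        exact this rfl
      · rw [hι]; simp

/-- A head enters a box at k and leaves it at p k. Either p k is the other boundary element and the
two heads annihilate, or the head moves on to the line at p k. -/
theorem bdry_sdiff_of_bdry_eq_pair (hι : Function.Involutive ι) (hfix : ∀ k, ι k ≠ k)
    {R : Finset Λ} (hp : PairsUp p R) {k b : Λ} (hkb : k ≠ b)
    (hR : bdry ι R = {k, b}) :
    bdry ι (R \ {k, p k}) = ∅ ∨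
      (bdry ι (R \ {k, p k}) = {b, ι (p k)} ∧ b ≠ ι (p k)) := by
  have hmem : ∀ l, (l ∈ R ∧ ι l ∉ R) ↔ l = k ∨ l = b := by
    intro l; rw [← mem_bdry, hR]; simp
  obtain ⟨hk, hk'⟩ := (hmem k).2 (Or.inl rfl)
  obtain ⟨hb, hb'⟩ := (hmem b).2 (Or.inr rfl)
  obtain ⟨h1, h2, h3⟩ := hp k hk
  by_cases hpb : p k = b
  · left
    rw [Finset.eq_empty_iff_forall_notMem]
    intro l hl
    rw [mem_bdry] at hl
    simp only [Finset.mem_sdiff, Finset.mem_insert, Finset.mem_singleton, not_or, hpb] at hl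
    obtain ⟨⟨hl, hlk, hlb⟩, h⟩ := hl
    by_cases hlR : ι l ∈ R
    · apply h
      refine ⟨hlR, fun h4 => hk' ?_, fun h4 => hb' ?_⟩
      · rw [← h4, hι]; exact hl
      · rw [← h4, hι]; exact hl
    · rcases (hmem l).1 ⟨hl, hlR⟩ with h5 | h5
      · exact hlk h5
      · exact hlb h5
  · right
    have hpk : ι (p k) ∈ R := by
      by_contra h
      rcases (hmem (p k)).1 ⟨h1, h⟩ with h5 | h5
      · exact h2 h5
      · exact hpb h5
    refine ⟨?_, fun h => hb' (by rw [h, hι]; exact h1)⟩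
    ext l
    simp only [mem_bdry, Finset.mem_sdiff, Finset.mem_insert, Finset.mem_singleton, not_or,
      not_and, not_not]
    constructor
    · rintro ⟨⟨hl, hlk, hlp⟩, h⟩
      by_cases hlR : ι l ∈ R
      · right
        rw [← h hlR, hι]
        intro h4
        exact hk' (by rw [← h4, hι]; exact hl)
      · rcases (hmem l).1 ⟨hl, hlR⟩ with h5 | h5
        · exact absurd h5 hlk
        · exact Or.inl h5
    · rintro (rfl | rfl)
      · exact ⟨⟨hb, hkb.symm, fun h => hpb h.symm⟩, fun h => absurd h hb'⟩
      · refine ⟨⟨hpk, ?_, hfix _⟩, ?_⟩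
        · intro h; exact hk' (by rw [← h, hι]; exact h1)
        · rw [hι]; simp

/-- The boundary of the remaining set always consists of at most two elements. -/
theorem card_bdry_unwindStep (hι : Function.Involutive ι) (hfix : ∀ k, ι k ≠ k)
    (hιp : ∀ k, ι k ≠ p k) {R : Finset Λ} (hp : PairsUp p R) (A : Finset Λ)
    (hR : (bdry ι R).card = 0 ∨ (bdry ι R).card = 2) :
    (bdry ι (unwindStep ι p A R)).card = 0 ∨ (bdry ι (unwindStep ι p A R)).card = 2 := by
  rcases R.eq_empty_or_nonempty with rfl | h
  · rwa [unwindStep_empty]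
  obtain ⟨k, hk, h1, -, h3⟩ := exists_unwindStep_eq ι p A h
  rw [h1]
  rcases hR with hR | hR
  · rw [Finset.card_eq_zero] at hR
    obtain ⟨h4, h5⟩ := bdry_sdiff_of_bdry_eq_empty hι hfix hιp hp hR hk
    right; rw [h4, Finset.card_pair h5]
  · obtain ⟨x, y, hxy, hR'⟩ := Finset.card_eq_two.1 hR
    have hk' := h3 (by rw [hR']; simp)
    obtain ⟨b, hkb, hb⟩ : ∃ b, k ≠ b ∧ bdry ι R = {k, b} := by
      rw [hR'] at hk' ⊢
      simp only [Finset.mem_insert, Finset.mem_singleton] at hk'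
      rcases hk' with rfl | rfl
      · exact ⟨y, hxy, rfl⟩
      · exact ⟨x, hxy.symm, Finset.pair_comm _ _⟩
    rcases bdry_sdiff_of_bdry_eq_pair hι hfix hp hkb hb with h4 | ⟨h4, h5⟩
    · left; rw [h4]; simp
    · right; rw [h4, Finset.card_pair h5]

theorem card_bdry_unwind (hι : Function.Involutive ι) (hfix : ∀ k, ι k ≠ k)
    (hιp : ∀ k, ι k ≠ p k) {D : Finset Λ} (hp : PairsUp p D) (A : Finset Λ)
    (hD : (bdry ι D).card = 0 ∨ (bdry ι D).card = 2) (t : ℕ) :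
    (bdry ι (unwind ι p A D t)).card = 0 ∨ (bdry ι (unwind ι p A D t)).card = 2 := by
  induction t with
  | zero => exact hD
  | succ t ih =>
    rw [unwind_succ]
    exact card_bdry_unwindStep hι hfix hιp (hp.unwind ι A t) A ih

/-- A boundary line never becomes a boundary line again after its end was removed. -/
theorem exists_removed_of_lt (ι p : Λ → Λ) (A D : Finset Λ) {s t : ℕ} (hst : s < t)
    (hs : (bdry ι (unwind ι p A D s)).Nonempty) :
    ∃ k ∈ bdry ι (unwind ι p A D s), k ∉ unwind ι p A D t ∧ ι k ∉ unwind ι p A D t := by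
  obtain ⟨l, hl⟩ := hs
  obtain ⟨k, hk, h1, -, h3⟩ := exists_unwindStep_eq ι p A (R := unwind ι p A D s)
    ⟨l, (mem_bdry.1 hl).1⟩
  have hkb := h3 ⟨l, hl⟩
  have hsub : unwind ι p A D t ⊆ unwind ι p A D (s + 1) := unwind_antitone ι p A D hst
  refine ⟨k, hkb, fun h => ?_, fun h => ?_⟩
  · have := hsub h
    rw [unwind_succ, h1] at this
    simp at this
  · exact (mem_bdry.1 hkb).2 (unwind_antitone ι p A D hst.le h)

/-- As long as the remaining set has a boundary, the boundary contains the anchor. -/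
theorem anchor_mem_bdry_unwind (hι : Function.Involutive ι) (hfix : ∀ k, ι k ≠ k)
    (hιp : ∀ k, ι k ≠ p k) {D : Finset Λ} (hp : PairsUp p D) {a : Λ} (ha : a ∈ bdry ι D)
    (hD : (bdry ι D).card = 2) (t : ℕ)
    (ht : ∀ s ≤ t, (bdry ι (unwind ι p {a} D s)).Nonempty) :
    a ∈ bdry ι (unwind ι p {a} D t) := by
  induction t with
  | zero => exact ha
  | succ t ih =>
    have iha := ih fun s hs => ht s (by omega)
    have hne := ht t (by omega)
    have hcard : (bdry ι (unwind ι p {a} D t)).card = 2 := by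
      rcases card_bdry_unwind hι hfix hιp hp {a} (Or.inr hD) t with h | h
      · rw [Finset.card_eq_zero] at h; simp [h] at hne
      · exact h
    set R := unwind ι p {a} D t with hRdef
    obtain ⟨l, hl⟩ := hne
    obtain ⟨k, hk, h1, h2, -⟩ := exists_unwindStep_eq ι p {a} (R := R) ⟨l, (mem_bdry.1 hl).1⟩
    -- Besides the anchor there is a second boundary element, so the rule of preference removes that
    -- one and the anchor survives until the boundary disappears.
    obtain ⟨b, hb, hba⟩ := Finset.exists_mem_ne (by omega : 1 < (bdry ι R).card) a
    have hk' := h2 ⟨b, by simp [hb, hba]⟩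
    simp only [Finset.mem_sdiff, Finset.mem_singleton] at hk'
    have hR : bdry ι R = {k, a} := by
      symm
      refine Finset.eq_of_subset_of_card_le ?_ ?_
      · intro x hx
        simp only [Finset.mem_insert, Finset.mem_singleton] at hx
        rcases hx with rfl | rfl
        · exact hk'.1
        · exact iha
      · rw [hcard, Finset.card_pair hk'.2]
    have hlast := ht (t + 1) le_rfl
    rw [unwind_succ, ← hRdef, h1] at hlast ⊢
    rcases bdry_sdiff_of_bdry_eq_pair hι hfix (hp.unwind ι {a} t) hk'.2 hR with h4 | ⟨h4, -⟩
    · rw [h4] at hlast; simp at hlast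
    · rw [h4]; simp

end Unwind

/-! ### Bit assignments and their heads -/

section Heads

set_option linter.unusedSectionVars false

variable {Λ : Type*} [DecidableEq Λ]

theorem fin2_ne_iff_eq_add_one (a b : Fin 2) : a ≠ b ↔ a = b + 1 := by
  fin_cases a <;> fin_cases b <;> decide

theorem fin2_add_one_add_one (a : Fin 2) : a + 1 + 1 = a := by
  fin_cases a <;> decide

/-- Flip the bit at `k`. -/
def flipAt (k : Λ) (f : Λ → Fin 2) : Λ → Fin 2 := Function.update f k (f k + 1)

theorem flipAt_same (k : Λ) (f : Λ → Fin 2) : flipAt k f k = f k + 1 := by simp [flipAt]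

theorem flipAt_ne {k l : Λ} (h : l ≠ k) (f : Λ → Fin 2) : flipAt k f l = f l := by
  simp [flipAt, h]

theorem flipAt_flipAt (k : Λ) (f : Λ → Fin 2) : flipAt k (flipAt k f) = f := by
  funext l
  by_cases h : l = k
  · subst h; rw [flipAt_same, flipAt_same, fin2_add_one_add_one]
  · rw [flipAt_ne h, flipAt_ne h]

theorem flipAt_comm (k l : Λ) (f : Λ → Fin 2) : flipAt k (flipAt l f) = flipAt l (flipAt k f) := by
  rcases eq_or_ne k l with rfl | hkl
  · rfl
  funext m
  by_cases h : m = k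
  · subst h; rw [flipAt_same, flipAt_ne hkl, flipAt_ne hkl, flipAt_same]
  · by_cases h' : m = l
    · subst h'; rw [flipAt_ne h, flipAt_same, flipAt_same, flipAt_ne h]
    · rw [flipAt_ne h, flipAt_ne h', flipAt_ne h', flipAt_ne h]

/-- This makes one step of the unwinding two bit flips, that is, a move of the chain when k and l
belong to the same box. -/
theorem piecewise_sdiff_pair {R : Finset Λ} {x y : Λ → Fin 2} {k l : Λ} (hk : k ∈ R) (hl : l ∈ R)
    (hkl : l ≠ k) (hxk : x k ≠ y k) (hxl : x l ≠ y l) :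
    (R \ {k, l}).piecewise x y = flipAt l (flipAt k (R.piecewise x y)) := by
  funext m
  by_cases h1 : m = l
  · subst h1
    rw [flipAt_same, flipAt_ne hkl, Finset.piecewise_eq_of_notMem _ _ _ (by simp),
      Finset.piecewise_eq_of_mem _ _ _ hl]
    exact (fin2_ne_iff_eq_add_one _ _).1 hxl.symm
  · rw [flipAt_ne h1]
    by_cases h2 : m = k
    · subst h2
      rw [flipAt_same, Finset.piecewise_eq_of_notMem _ _ _ (by simp),
        Finset.piecewise_eq_of_mem _ _ _ hk]
      exact (fin2_ne_iff_eq_add_one _ _).1 hxk.symm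
    · rw [flipAt_ne h2]
      by_cases h3 : m ∈ R
      · rw [Finset.piecewise_eq_of_mem _ _ _ h3, Finset.piecewise_eq_of_mem _ _ _ (by simp [*])]
      · rw [Finset.piecewise_eq_of_notMem _ _ _ h3,
          Finset.piecewise_eq_of_notMem _ _ _ (by simp [*])]

/-- Used to recover x from an intermediate configuration, its complement and the remaining set. -/
theorem piecewise_piecewise_swap (R : Finset Λ) (x y : Λ → Fin 2) :
    R.piecewise (R.piecewise x y) (R.piecewise y x) = x := by
  funext m
  by_cases h : m ∈ R <;> simp [h]

variable [Fintype Λ]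

/-- The set of the elements at which `x` and `y` differ. -/
def diffSet (x y : Λ → Fin 2) : Finset Λ := Finset.univ.filter fun k => x k ≠ y k

theorem mem_diffSet {x y : Λ → Fin 2} {k : Λ} : k ∈ diffSet x y ↔ x k ≠ y k := by simp [diffSet]

theorem diffSet_piecewise (R : Finset Λ) (x y : Λ → Fin 2) :
    diffSet (R.piecewise x y) (R.piecewise y x) = diffSet x y := by
  ext k
  rw [mem_diffSet, mem_diffSet]
  by_cases h : k ∈ R <;> simp [h, eq_comm]

theorem diffSet_piecewise_self (x y : Λ → Fin 2) : (diffSet x y).piecewise x y = x := by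
  funext k
  by_cases h : k ∈ diffSet x y
  · simp [h]
  · rw [Finset.piecewise_eq_of_notMem _ _ _ h]
    rw [mem_diffSet, not_not] at h
    exact h.symm

/-- The elements whose bit differs from the one of their partner. -/
def headSet (ι : Λ → Λ) (f : Λ → Fin 2) : Finset Λ := Finset.univ.filter fun k => f k ≠ f (ι k)

variable {ι : Λ → Λ}

theorem mem_headSet {f : Λ → Fin 2} {k : Λ} : k ∈ headSet ι f ↔ f k ≠ f (ι k) := by simp [headSet]

theorem mem_headSet_partner (hι : Function.Involutive ι) {f : Λ → Fin 2} {k : Λ} :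
    ι k ∈ headSet ι f ↔ k ∈ headSet ι f := by
  rw [mem_headSet, mem_headSet, hι, ne_comm]

/-- Exchanging bits on R toggles the head of a line exactly when one of its two ends lies in R. The
inclusion in `diffSet` guarantees that every exchange is a flip. -/
theorem mem_headSet_piecewise {R : Finset Λ} {x y : Λ → Fin 2} (hR : R ⊆ diffSet x y) {k : Λ} :
    k ∈ headSet ι (R.piecewise x y) ↔ (k ∈ headSet ι y ↔ (k ∈ R ↔ ι k ∈ R)) := by
  have h : ∀ l ∈ R, x l = y l + 1 := fun l hl =>
    (fin2_ne_iff_eq_add_one _ _).1 (mem_diffSet.1 (hR hl))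
  have key : ∀ a b : Fin 2, (a + 1 ≠ b + 1 ↔ a ≠ b) ∧ (a + 1 ≠ b ↔ a = b) ∧ (a ≠ b + 1 ↔ a = b) := by
    decide
  rw [mem_headSet, mem_headSet]
  by_cases h1 : k ∈ R <;> by_cases h2 : ι k ∈ R <;> simp only [h1, h2,
    Finset.piecewise_eq_of_mem, Finset.piecewise_eq_of_notMem, not_false_eq_true, h, iff_true,
    iff_false, not_true, key, not_not, ne_eq]

/-- The elements of the lines that leave `R`. -/
theorem headSet_piecewise_eq (hι : Function.Involutive ι) {R : Finset Λ} {x y : Λ → Fin 2}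
    (hR : R ⊆ diffSet x y) (hy : headSet ι y = ∅) :
    headSet ι (R.piecewise x y) = bdry ι R ∪ (bdry ι R).image ι := by
  ext k
  rw [mem_headSet_piecewise hR, hy, Finset.mem_union, Finset.mem_image, mem_bdry]
  have : (∃ a ∈ bdry ι R, ι a = k) ↔ (ι k ∈ R ∧ k ∉ R) := by
    constructor
    · rintro ⟨a, ha, rfl⟩
      rw [mem_bdry] at ha
      rwa [hι]
    · intro h
      exact ⟨ι k, mem_bdry.2 (by rwa [hι]), hι k⟩
  rw [this]
  simp only [Finset.notMem_empty, false_iff]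
  tauto

/-- `headSet` contains both ends of a line while `bdry` contains only the end inside R; hence the
factor 2, and two heads correspond to four legs. -/
theorem card_headSet_piecewise (hι : Function.Involutive ι) {R : Finset Λ} {x y : Λ → Fin 2}
    (hR : R ⊆ diffSet x y) (hy : headSet ι y = ∅) :
    (headSet ι (R.piecewise x y)).card = 2 * (bdry ι R).card := by
  rw [headSet_piecewise_eq hι hR hy, Finset.card_union_of_disjoint,
    Finset.card_image_of_injective _ hι.injective]
  · ring
  · rw [Finset.disjoint_left]
    intro k hk hk'
    obtain ⟨l, hl, rfl⟩ := Finset.mem_image.1 hk'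
    rw [mem_bdry] at hk hl
    exact hl.2 hk.1

theorem mem_headSet_flipAt (hι : Function.Involutive ι) (hfix : ∀ k, ι k ≠ k) (f : Λ → Fin 2)
    (k l : Λ) : l ∈ headSet ι (flipAt k f) ↔
      (l ∈ headSet ι f ↔ ¬ (l = k ∨ l = ι k)) := by
  have key : ∀ a b : Fin 2, (a + 1 = b ↔ ¬ a = b) ∧ (a = b + 1 ↔ ¬ a = b) := by
    decide
  rw [mem_headSet, mem_headSet]
  by_cases h1 : l = k
  · subst h1
    rw [flipAt_same, flipAt_ne (hfix l)]
    simp [key]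
  · by_cases h2 : l = ι k
    · subst h2
      rw [hι, flipAt_same, flipAt_ne (hfix k)]
      simp [key]
    · have h3 : ι l ≠ k := fun h => h2 (by rw [← h, hι])
      rw [flipAt_ne h1, flipAt_ne h3]
      simp [h1, h2]

theorem headSet_flipAt_of_mem (hι : Function.Involutive ι) (hfix : ∀ k, ι k ≠ k) {f : Λ → Fin 2}
    {k : Λ} (hk : k ∈ headSet ι f) : headSet ι (flipAt k f) = headSet ι f \ {k, ι k} := by
  ext l
  rw [mem_headSet_flipAt hι hfix, Finset.mem_sdiff, Finset.mem_insert, Finset.mem_singleton]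
  have : l = k ∨ l = ι k → l ∈ headSet ι f := by
    rintro (rfl | rfl)
    · exact hk
    · rwa [mem_headSet_partner hι]
  tauto

theorem headSet_flipAt_of_notMem (hι : Function.Involutive ι) (hfix : ∀ k, ι k ≠ k)
    {f : Λ → Fin 2} {k : Λ} (hk : k ∉ headSet ι f) :
    headSet ι (flipAt k f) = headSet ι f ∪ {k, ι k} := by
  ext l
  rw [mem_headSet_flipAt hι hfix, Finset.mem_union, Finset.mem_insert, Finset.mem_singleton]
  have : l = k ∨ l = ι k → l ∉ headSet ι f := by
    rintro (rfl | rfl)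
    · exact hk
    · rwa [mem_headSet_partner hι]
  tauto

theorem card_headSet_flipAt_of_mem (hι : Function.Involutive ι) (hfix : ∀ k, ι k ≠ k)
    {f : Λ → Fin 2} {k : Λ} (hk : k ∈ headSet ι f) :
    (headSet ι (flipAt k f)).card + 2 = (headSet ι f).card := by
  have hsub : {k, ι k} ⊆ headSet ι f := by
    intro l hl
    simp only [Finset.mem_insert, Finset.mem_singleton] at hl
    rcases hl with rfl | rfl
    · exact hk
    · rwa [mem_headSet_partner hι]
  have h := Finset.card_sdiff_add_card_eq_card hsub
  rw [Finset.card_pair (hfix k).symm] at h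
  rw [headSet_flipAt_of_mem hι hfix hk, h]

theorem card_headSet_flipAt_of_notMem (hι : Function.Involutive ι) (hfix : ∀ k, ι k ≠ k)
    {f : Λ → Fin 2} {k : Λ} (hk : k ∉ headSet ι f) :
    (headSet ι (flipAt k f)).card = (headSet ι f).card + 2 := by
  rw [headSet_flipAt_of_notMem hι hfix hk, Finset.card_union_of_disjoint,
    Finset.card_pair (hfix k).symm]
  rw [Finset.disjoint_right]
  intro l hl
  simp only [Finset.mem_insert, Finset.mem_singleton] at hl
  rcases hl with rfl | rfl
  · exact hk
  · rwa [mem_headSet_partner hι]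

/-- If the heads of `x` are joined by the boundary of `D` and the boundary of `R` shares an end
with the one of `D`, then the complementary assignment has again at most two heads. -/
theorem card_headSet_piecewise_swap (hι : Function.Involutive ι) (hfix : ∀ k, ι k ≠ k)
    {R : Finset Λ} {x y : Λ → Fin 2} (hR : R ⊆ diffSet x y) (hy : headSet ι y = ∅) {a : Λ}
    (haD : a ∈ bdry ι (diffSet x y)) (hD : (bdry ι (diffSet x y)).card = 2)
    (haR : a ∈ bdry ι R) (hRc : (bdry ι R).card = 2) :
    (headSet ι (R.piecewise y x)).card = 0 ∨ (headSet ι (R.piecewise y x)).card = 4 := by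
  -- If the boundary of S is {a, b}, the lines cut by S are precisely the ones through a and b, and
  -- these are different lines.
  have hpair : ∀ S : Finset Λ, a ∈ bdry ι S → (bdry ι S).card = 2 →
      ∃ b, a ≠ b ∧ a ≠ ι b ∧ ∀ k, (k ∈ S ↔ ι k ∈ S) ↔ ¬ (k = a ∨ k = ι a ∨ k = b ∨ k = ι b) := by
    intro S haS hS
    obtain ⟨b, hb, hba⟩ := Finset.exists_mem_ne (by omega : 1 < (bdry ι S).card) a
    have hSeq : bdry ι S = {a, b} := by
      symm
      refine Finset.eq_of_subset_of_card_le ?_ (by rw [hS, Finset.card_pair hba.symm])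
      intro l hl
      simp only [Finset.mem_insert, Finset.mem_singleton] at hl
      rcases hl with rfl | rfl <;> assumption
    refine ⟨b, hba.symm, ?_, fun k => ?_⟩
    · intro h
      rw [mem_bdry] at haS hb
      exact hb.2 (h ▸ haS.1)
    · have h1 : (k ∈ S ∧ ι k ∉ S) ↔ k = a ∨ k = b := by rw [← mem_bdry, hSeq]; simp
      have h2 : (ι k ∈ S ∧ k ∉ S) ↔ k = ι a ∨ k = ι b := by
        have : (ι k ∈ S ∧ ι (ι k) ∉ S) ↔ ι k = a ∨ ι k = b := by rw [← mem_bdry, hSeq]; simp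
        rw [hι] at this
        rw [this]
        constructor
        · rintro (h | h)
          · left; rw [← h, hι]
          · right; rw [← h, hι]
        · rintro (h | h)
          · left; rw [h, hι]
          · right; rw [h, hι]
      tauto
  obtain ⟨b, hab, hab', hb⟩ := hpair _ haD hD
  obtain ⟨c, hac, hac', hc⟩ := hpair _ haR hRc
  have hR' : R ⊆ diffSet y x := fun k hk => by
    have := hR hk
    rw [mem_diffSet] at this ⊢
    exact this.symm
  have hx : ∀ k, k ∈ headSet ι x ↔ (k = a ∨ k = ι a ∨ k = b ∨ k = ι b) := by
    intro k
    have := mem_headSet_piecewise (ι := ι) (subset_refl (diffSet x y)) (k := k)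
    rw [diffSet_piecewise_self, hy, hb] at this
    rw [this]
    simp only [Finset.notMem_empty, false_iff, not_not]
  have hz : ∀ k, k ∈ headSet ι (R.piecewise y x) ↔
      ((k = a ∨ k = ι a ∨ k = b ∨ k = ι b) ↔ ¬ (k = a ∨ k = ι a ∨ k = c ∨ k = ι c)) := by
    intro k
    rw [mem_headSet_piecewise hR', hx, hc]
  have hinj : ∀ u v : Λ, u = ι v ↔ ι u = v := fun u v =>
    ⟨fun h => by rw [h, hι], fun h => by rw [← h, hι]⟩
  -- The line of a carries a head of x and is toggled, so it drops out. If R and D also share their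
  -- second cut line, nothing is left; otherwise the lines through b and c carry the heads.
  by_cases hbc : b = c ∨ b = ι c
  · left
    rw [Finset.card_eq_zero, Finset.eq_empty_iff_forall_notMem]
    intro k
    rw [hz]
    have : (k = b ∨ k = ι b) ↔ (k = c ∨ k = ι c) := by
      rcases hbc with rfl | rfl
      · rfl
      · rw [hι]; exact or_comm
    tauto
  · right
    push Not at hbc
    have hset : headSet ι (R.piecewise y x) = {b, ι b, c, ι c} := by
      ext k
      rw [hz]
      simp only [Finset.mem_insert, Finset.mem_singleton]
      have e1 : k = b → ¬ (k = a ∨ k = ι a ∨ k = c ∨ k = ι c) := by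
        rintro rfl
        refine not_or.2 ⟨hab.symm, not_or.2 ⟨?_, not_or.2 hbc⟩⟩
        intro h; exact hab' (by rw [h, hι])
      have e2 : k = ι b → ¬ (k = a ∨ k = ι a ∨ k = c ∨ k = ι c) := by
        rintro rfl
        refine not_or.2 ⟨fun h => hab' h.symm, not_or.2 ⟨fun h => hab (hι.injective h).symm,
          not_or.2 ⟨fun h => hbc.2 ((hinj _ _).2 h), fun h => hbc.1 (hι.injective h)⟩⟩⟩
      have e3 : k = c → ¬ (k = a ∨ k = ι a ∨ k = b ∨ k = ι b) := by
        rintro rfl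
        refine not_or.2 ⟨hac.symm, not_or.2 ⟨?_, not_or.2 ⟨hbc.1.symm, ?_⟩⟩⟩
        · intro h; exact hac' (by rw [h, hι])
        · intro h; exact hbc.2 (by rw [h, hι])
      have e4 : k = ι c → ¬ (k = a ∨ k = ι a ∨ k = b ∨ k = ι b) := by
        rintro rfl
        refine not_or.2 ⟨fun h => hac' h.symm, not_or.2 ⟨fun h => hac (hι.injective h).symm,
          not_or.2 ⟨fun h => hbc.2 h.symm, fun h => hbc.1 (hι.injective h).symm⟩⟩⟩
      constructor
      · intro h
        by_cases hB : k = a ∨ k = ι a ∨ k = b ∨ k = ι b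
        · have hC := h.1 hB
          rcases hB with hB | hB | hB | hB
          · exact absurd (Or.inl hB) hC
          · exact absurd (Or.inr (Or.inl hB)) hC
          · exact Or.inl hB
          · exact Or.inr (Or.inl hB)
        · have hC := not_not.1 fun h' => hB (h.2 h')
          rcases hC with hC | hC | hC | hC
          · exact absurd (Or.inl hC) hB
          · exact absurd (Or.inr (Or.inl hC)) hB
          · exact Or.inr (Or.inr (Or.inl hC))
          · exact Or.inr (Or.inr (Or.inr hC))
      · rintro (h | h | h | h)
        · exact iff_of_true (Or.inr (Or.inr (Or.inl h))) (e1 h)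
        · exact iff_of_true (Or.inr (Or.inr (Or.inr h))) (e2 h)
        · exact iff_of_false (e3 h) (not_not.2 (Or.inr (Or.inr (Or.inl h))))
        · exact iff_of_false (e4 h) (not_not.2 (Or.inr (Or.inr (Or.inr h))))
    rw [hset]
    have hbc3 : ι b ≠ c := fun h => hbc.2 (by rw [← h, hι])
    have hbc4 : ι b ≠ ι c := fun h => hbc.1 (hι.injective h)
    rw [Finset.card_insert_of_notMem, Finset.card_insert_of_notMem, Finset.card_pair (hfix c).symm]
    · simp [hbc3, hbc4]
    · simp [hbc.1, hbc.2, (hfix b).symm]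

end Heads

/-! ### Windable box weights -/

/-- A weight on bit strings is windable if every product `w x * w y` can be distributed over
pairings of the positions at which `x` and `y` differ, in such a way that exchanging the bits of
`x` and `y` on a union of pairs does not change the distributed weight. -/
def IsWindable {κ : Type*} [Fintype κ] [DecidableEq κ] (w : (κ → Fin 2) → ℝ) : Prop :=
  ∃ B : (κ → Fin 2) → (κ → Fin 2) → (κ → κ) → ℝ,
    (∀ x y p, 0 ≤ B x y p) ∧ (∀ x y, ∑ p, B x y p = w x * w y) ∧
    (∀ x y p, B x y p ≠ 0 → PairsUp p (diffSet x y)) ∧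
    ∀ x y p, B x y p ≠ 0 → ∀ R ⊆ diffSet x y, (∀ k ∈ R, p k ∈ R) →
      B (R.piecewise x y) (R.piecewise y x) p = B x y p

/-! ### The global winding and the energy of single moves. -/

section Flow

set_option linter.unusedSectionVars false

variable {β : Type*} [Fintype β] [DecidableEq β] {leg : β → Type*} [∀ m, Fintype (leg m)]
  [∀ m, DecidableEq (leg m)]

/-- The product of the box weights. -/
def prodWeight (w : ∀ m, (leg m → Fin 2) → ℝ) (f : (Σ m, leg m) → Fin 2) : ℝ :=
  ∏ m, w m fun l => f ⟨m, l⟩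

/-- The pairing of all legs given by pairings of the legs of each box. -/
def boxPairing (J : ∀ m, leg m → leg m) (k : Σ m, leg m) : Σ m, leg m := ⟨k.1, J k.1 k.2⟩

theorem prodWeight_nonneg {w : ∀ m, (leg m → Fin 2) → ℝ} (hw : ∀ m s, 0 ≤ w m s)
    (f : (Σ m, leg m) → Fin 2) : 0 ≤ prodWeight w f :=
  Finset.prod_nonneg fun _ _ => hw _ _

/-- The weights of the boxes multiply, and so do their windings: expanding the product of the local
sums gives one term for each choice of a pairing in every box. Exchanges on unions of pairs restrict
to such exchanges in each box. -/
theorem exists_global_winding {w : ∀ m, (leg m → Fin 2) → ℝ}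
    (hwind : ∀ m, IsWindable (w m)) :
    ∃ B : ((Σ m, leg m) → Fin 2) → ((Σ m, leg m) → Fin 2) → (∀ m, leg m → leg m) → ℝ,
      (∀ x y J, 0 ≤ B x y J) ∧ (∀ x y, ∑ J, B x y J = prodWeight w x * prodWeight w y) ∧
      (∀ x y J, B x y J ≠ 0 → PairsUp (boxPairing J) (diffSet x y)) ∧
      (∀ x y J, B x y J ≠ 0 → ∀ R ⊆ diffSet x y, (∀ k ∈ R, boxPairing J k ∈ R) →
        B (R.piecewise x y) (R.piecewise y x) J = B x y J) ∧
      ∀ x y J, B x y J ≠ 0 → prodWeight w x ≠ 0 ∧ prodWeight w y ≠ 0 := by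
  choose B h0 hsum hpair hinv using hwind
  have hne : ∀ (x y : (Σ m, leg m) → Fin 2) (J : ∀ m, leg m → leg m),
      ∏ m, B m (fun l => x ⟨m, l⟩) (fun l => y ⟨m, l⟩) (J m) ≠ 0 →
      ∀ m, B m (fun l => x ⟨m, l⟩) (fun l => y ⟨m, l⟩) (J m) ≠ 0 := fun x y J h m =>
    Finset.prod_ne_zero_iff.1 h m (Finset.mem_univ m)
  refine ⟨fun x y J => ∏ m, B m (fun l => x ⟨m, l⟩) (fun l => y ⟨m, l⟩) (J m),
    fun x y J => Finset.prod_nonneg fun _ _ => h0 _ _ _ _, fun x y => ?_, fun x y J h => ?_,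
    fun x y J h R hR hRp => ?_, fun x y J h => ?_⟩
  · unfold prodWeight
    rw [← Finset.prod_mul_distrib, ← Fintype.piFinset_univ, ← Finset.prod_univ_sum]
    exact Finset.prod_congr rfl fun m _ => hsum m _ _
  · rintro ⟨m, l⟩ hk
    have h1 := hpair m _ _ _ (hne x y J h m) l (by rw [mem_diffSet] at hk ⊢; exact hk)
    refine ⟨?_, ?_, ?_⟩
    · have h2 := mem_diffSet.1 h1.1
      exact mem_diffSet.2 h2
    · intro h2
      have := eq_of_heq (Sigma.mk.inj h2).2
      exact h1.2.1 this
    · simp only [boxPairing, h1.2.2]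
  · refine Finset.prod_congr rfl fun m _ => ?_
    have h1 := hinv m _ _ _ (hne x y J h m) (Finset.univ.filter fun l => (⟨m, l⟩ : Σ m, leg m) ∈ R)
      (fun l hl => by
        have := hR (Finset.mem_filter.1 hl).2
        rw [mem_diffSet] at this ⊢
        exact this)
      (fun l hl => by
        exact Finset.mem_filter.2 ⟨Finset.mem_univ _, hRp _ (Finset.mem_filter.1 hl).2⟩)
    rw [← h1]
    congr 1
    · funext l
      by_cases hl : (⟨m, l⟩ : Σ m, leg m) ∈ R
      · rw [Finset.piecewise_eq_of_mem _ _ _ hl, Finset.piecewise_eq_of_mem _ _ _ (by simpa using hl)]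
      · rw [Finset.piecewise_eq_of_notMem _ _ _ hl,
          Finset.piecewise_eq_of_notMem _ _ _ (by simpa using hl)]
    · funext l
      by_cases hl : (⟨m, l⟩ : Σ m, leg m) ∈ R
      · rw [Finset.piecewise_eq_of_mem _ _ _ hl, Finset.piecewise_eq_of_mem _ _ _ (by simpa using hl)]
      · rw [Finset.piecewise_eq_of_notMem _ _ _ hl,
          Finset.piecewise_eq_of_notMem _ _ _ (by simpa using hl)]
  · have hm : ∀ m, w m (fun l => x ⟨m, l⟩) * w m (fun l => y ⟨m, l⟩) ≠ 0 := by
      intro m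
      rw [← hsum]
      have h1 : 0 < B m (fun l => x ⟨m, l⟩) (fun l => y ⟨m, l⟩) (J m) :=
        lt_of_le_of_ne (h0 _ _ _ _) (hne x y J h m).symm
      exact (lt_of_lt_of_le h1 (Finset.single_le_sum (fun p _ => h0 m _ _ p)
        (Finset.mem_univ (J m)))).ne'
    exact ⟨Finset.prod_ne_zero_iff.2 fun m _ => left_ne_zero_of_mul (hm m),
      Finset.prod_ne_zero_iff.2 fun m _ => right_ne_zero_of_mul (hm m)⟩

/-- The sum of the squared differences of `F` along all moves of heads of `z`. -/
noncomputable def moveEnergy (w : ∀ m, (leg m → Fin 2) → ℝ) (ι : (Σ m, leg m) → Σ m, leg m)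
    (F : ((Σ m, leg m) → Fin 2) → ℝ) (z : (Σ m, leg m) → Fin 2) : ℝ :=
  ∑ k ∈ headSet ι z, ∑ k' : leg k.1,
    if prodWeight w (flipAt ⟨k.1, k'⟩ (flipAt k z)) ≠ 0
    then (F z - F (flipAt ⟨k.1, k'⟩ (flipAt k z))) ^ 2 else 0

variable {w : ∀ m, (leg m → Fin 2) → ℝ} {ι : (Σ m, leg m) → Σ m, leg m}
  {F : ((Σ m, leg m) → Fin 2) → ℝ}

theorem moveEnergy_nonneg (z : (Σ m, leg m) → Fin 2) : 0 ≤ moveEnergy w ι F z :=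
  Finset.sum_nonneg fun _ _ => Finset.sum_nonneg fun _ _ => by
    split_ifs
    · exact sq_nonneg _
    · exact le_rfl

theorem sq_sub_le_moveEnergy {z : (Σ m, leg m) → Fin 2} {k : Σ m, leg m} (hk : k ∈ headSet ι z)
    (k' : leg k.1) (hz : prodWeight w (flipAt ⟨k.1, k'⟩ (flipAt k z)) ≠ 0) :
    (F z - F (flipAt ⟨k.1, k'⟩ (flipAt k z))) ^ 2 ≤ moveEnergy w ι F z := by
  have hnn : ∀ (k : Σ m, leg m) (k' : leg k.1), 0 ≤
      if prodWeight w (flipAt ⟨k.1, k'⟩ (flipAt k z)) ≠ 0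
      then (F z - F (flipAt ⟨k.1, k'⟩ (flipAt k z))) ^ 2 else 0 := by
    intro k k'
    split_ifs
    · exact sq_nonneg _
    · exact le_rfl
  refine le_trans ?_ (Finset.single_le_sum
    (fun k _ => Finset.sum_nonneg fun k' _ => hnn k k') hk)
  refine le_trans ?_ (Finset.single_le_sum (fun k' _ => hnn k k') (Finset.mem_univ k'))
  rw [if_pos hz]

/-- The squared increment of `F` along one step of an unwinding is bounded by the move energy of
whichever end of the step has heads. -/
theorem sq_sub_unwind_le (hι : Function.Involutive ι) (hbox : ∀ k, (ι k).1 ≠ k.1)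
    {J : ∀ m, leg m → leg m} {R : Finset (Σ m, leg m)} {x y : (Σ m, leg m) → Fin 2}
    (hR : R ⊆ diffSet x y) (hp : PairsUp (boxPairing J) R) (A : Finset (Σ m, leg m))
    (hy : headSet ι y = ∅)
    (h0 : prodWeight w (R.piecewise x y) ≠ 0)
    (h1 : prodWeight w ((unwindStep ι (boxPairing J) A R).piecewise x y) ≠ 0) :
    ((bdry ι R).Nonempty →
      (F (R.piecewise x y) - F ((unwindStep ι (boxPairing J) A R).piecewise x y)) ^ 2
        ≤ moveEnergy w ι F (R.piecewise x y)) ∧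
    (bdry ι R = ∅ →
      (F (R.piecewise x y) - F ((unwindStep ι (boxPairing J) A R).piecewise x y)) ^ 2
        ≤ if (bdry ι (unwindStep ι (boxPairing J) A R)).Nonempty then
            moveEnergy w ι F ((unwindStep ι (boxPairing J) A R).piecewise x y) else 0) := by
  have hfix : ∀ k, ι k ≠ k := fun k h => hbox k (by rw [h])
  have hιp : ∀ k, ι k ≠ boxPairing J k := fun k h => hbox k (by rw [h]; rfl)
  rcases R.eq_empty_or_nonempty with rfl | hne
  · rw [unwindStep_empty]
    refine ⟨fun h => ?_, fun _ => ?_⟩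
    · simp [bdry] at h
    · simp [bdry]
  obtain ⟨k, hk, hstep, -, hkb⟩ := exists_unwindStep_eq ι (boxPairing J) A hne
  obtain ⟨hpk, hpne, hpp⟩ := hp k hk
  have hflip := piecewise_sdiff_pair hk hpk hpne (mem_diffSet.1 (hR hk)) (mem_diffSet.1 (hR hpk))
  rw [hstep] at h1 ⊢
  rw [hflip] at h1 ⊢
  refine ⟨fun h => ?_, fun h => ?_⟩
  · refine sq_sub_le_moveEnergy (k := k) ?_ (J k.1 k.2) h1
    rw [headSet_piecewise_eq hι hR hy]
    exact Finset.mem_union_left _ (hkb h)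
  -- The step creates heads, so it is read backwards, as the annihilating move out of its end point,
  -- where `moveEnergy` sees the heads.
  · obtain ⟨hb, -⟩ := bdry_sdiff_of_bdry_eq_empty hι hfix hιp hp h hk
    rw [if_pos (by rw [hb]; simp)]
    have hback : flipAt (boxPairing J k) (flipAt k (flipAt (boxPairing J k)
        (flipAt k (R.piecewise x y)))) = R.piecewise x y := by
      rw [flipAt_comm, flipAt_flipAt, flipAt_flipAt]
    have := sq_sub_le_moveEnergy (w := w) (ι := ι) (F := F)
      (z := flipAt (boxPairing J k) (flipAt k (R.piecewise x y))) (k := k) (by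
        rw [← hflip, headSet_piecewise_eq hι (Finset.sdiff_subset.trans hR) hy, hb]
        refine Finset.mem_union_right _ (Finset.mem_image.2 ⟨ι k, by simp, hι k⟩)) (J k.1 k.2)
        (by
          change prodWeight w (flipAt (boxPairing J k) (flipAt k (flipAt (boxPairing J k)
            (flipAt k (R.piecewise x y))))) ≠ 0
          rw [hback]; exact h0)
    change (F _ - F (flipAt (boxPairing J k) (flipAt k (flipAt (boxPairing J k)
        (flipAt k (R.piecewise x y)))))) ^ 2 ≤ _ at this
    rw [hback] at this
    rw [sub_sq_comm]
    exact this

end Flow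

/-! ### Unwindings as canonical paths, and their reindexing by intermediate configurations. -/

section Flow

set_option linter.unusedSectionVars false

variable {β : Type*} [Fintype β] [DecidableEq β] {leg : β → Type*} [∀ m, Fintype (leg m)]
  [∀ m, DecidableEq (leg m)]

/-- The remaining set after `t` steps of the unwinding of `x` into `y`. -/
noncomputable def restSet (ι : (Σ m, leg m) → Σ m, leg m)
    (anc : Finset (Σ m, leg m) → Finset (Σ m, leg m)) (J : ∀ m, leg m → leg m)
    (x y : (Σ m, leg m) → Fin 2) (t : ℕ) : Finset (Σ m, leg m) :=
  unwind ι (boxPairing J) (anc (diffSet x y)) (diffSet x y) t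

variable {w : ∀ m, (leg m → Fin 2) → ℝ} {ι : (Σ m, leg m) → Σ m, leg m}
  {F : ((Σ m, leg m) → Fin 2) → ℝ}
  {B : ((Σ m, leg m) → Fin 2) → ((Σ m, leg m) → Fin 2) → (∀ m, leg m → leg m) → ℝ}
  (anc : Finset (Σ m, leg m) → Finset (Σ m, leg m))

theorem restSet_subset (J : ∀ m, leg m → leg m) (x y : (Σ m, leg m) → Fin 2) (t : ℕ) :
    restSet ι anc J x y t ⊆ diffSet x y := unwind_subset _ _ _ _ _

theorem restSet_zero_piecewise (J : ∀ m, leg m → leg m) (x y : (Σ m, leg m) → Fin 2) :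
    (restSet ι anc J x y 0).piecewise x y = x := diffSet_piecewise_self x y

/-- The intermediate configuration, its complement and the pairing determine the end points and
the time, as long as there are heads. -/
theorem unwinding_injective (hι : Function.Involutive ι) (J : ∀ m, leg m → leg m)
    {x y x' y' : (Σ m, leg m) → Fin 2} {t t' : ℕ} (hy : headSet ι y = ∅) (hy' : headSet ι y' = ∅)
    (ht : (bdry ι (restSet ι anc J x y t)).Nonempty)
    (ht' : (bdry ι (restSet ι anc J x' y' t')).Nonempty)
    (h1 : (restSet ι anc J x y t).piecewise x y = (restSet ι anc J x' y' t').piecewise x' y')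
    (h2 : (restSet ι anc J x y t).piecewise y x = (restSet ι anc J x' y' t').piecewise y' x') :
    x = x' ∧ y = y' ∧ t = t' := by
  have hD : diffSet x y = diffSet x' y' := by
    rw [← diffSet_piecewise (restSet ι anc J x y t) x y, h1, h2, diffSet_piecewise]
  have hrest : ∀ s, restSet ι anc J x y s = restSet ι anc J x' y' s := by
    intro s; unfold restSet; rw [hD]
  have hhead : ∀ k, k ∈ bdry ι (restSet ι anc J x y t) ∪ (bdry ι (restSet ι anc J x y t)).image ι ↔
      k ∈ bdry ι (restSet ι anc J x y t') ∪ (bdry ι (restSet ι anc J x y t')).image ι := by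
    intro k
    rw [← headSet_piecewise_eq hι (restSet_subset anc J x y t) hy, h1,
      headSet_piecewise_eq hι (restSet_subset anc J x' y' t') hy', hrest t']
  have hnot : ∀ s s', s < s' → (bdry ι (restSet ι anc J x y s)).Nonempty →
      ¬ (∀ k, k ∈ bdry ι (restSet ι anc J x y s) ∪ (bdry ι (restSet ι anc J x y s)).image ι ↔
      k ∈ bdry ι (restSet ι anc J x y s') ∪ (bdry ι (restSet ι anc J x y s')).image ι) := by
    intro s s' hss hne hall
    obtain ⟨k, hk, hk1, hk2⟩ := exists_removed_of_lt ι (boxPairing J) (anc (diffSet x y))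
      (diffSet x y) hss hne
    have := (hall k).1 (Finset.mem_union_left _ hk)
    rw [Finset.mem_union, Finset.mem_image] at this
    rcases this with h | ⟨l, hl, rfl⟩
    · exact hk1 (mem_bdry.1 h).1
    · rw [hι] at hk2
      exact hk2 (mem_bdry.1 hl).1
  have htt : t = t' := by
    rcases lt_trichotomy t t' with h | h | h
    · exact absurd hhead (hnot t t' h ht)
    · exact h
    · rw [← hrest] at ht'
      exact absurd (fun k => (hhead k).symm) (hnot t' t h ht')
  subst htt
  refine ⟨?_, ?_, rfl⟩
  · rw [← piecewise_piecewise_swap (restSet ι anc J x y t) x y, h1, h2, hrest,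
      piecewise_piecewise_swap]
  · rw [← piecewise_piecewise_swap (restSet ι anc J x y t) y x, h1, h2, hrest,
      piecewise_piecewise_swap]

/-- Summation over all unwindings, reindexed by the intermediate configuration. -/
theorem sum_unwinding_le (hι : Function.Involutive ι) (J : ∀ m, leg m → leg m)
    (hB : ∀ x y, 0 ≤ B x y J) {H : ((Σ m, leg m) → Fin 2) → ℝ} (hH : ∀ z, 0 ≤ H z)
    (S : Finset (((Σ m, leg m) → Fin 2) × ((Σ m, leg m) → Fin 2) × ℕ))
    (U : Finset (((Σ m, leg m) → Fin 2) × ((Σ m, leg m) → Fin 2)))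
    (hS : ∀ i ∈ S, headSet ι i.2.1 = ∅ ∧ (bdry ι (restSet ι anc J i.1 i.2.1 i.2.2)).Nonempty ∧
      B ((restSet ι anc J i.1 i.2.1 i.2.2).piecewise i.1 i.2.1)
        ((restSet ι anc J i.1 i.2.1 i.2.2).piecewise i.2.1 i.1) J = B i.1 i.2.1 J ∧
      ((restSet ι anc J i.1 i.2.1 i.2.2).piecewise i.1 i.2.1,
        (restSet ι anc J i.1 i.2.1 i.2.2).piecewise i.2.1 i.1) ∈ U) :
    ∑ i ∈ S, B i.1 i.2.1 J * H ((restSet ι anc J i.1 i.2.1 i.2.2).piecewise i.1 i.2.1) ≤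
      ∑ q ∈ U, B q.1 q.2 J * H q.1 := by
  classical
  set e : ((Σ m, leg m) → Fin 2) × ((Σ m, leg m) → Fin 2) × ℕ →
      ((Σ m, leg m) → Fin 2) × ((Σ m, leg m) → Fin 2) := fun i =>
    ((restSet ι anc J i.1 i.2.1 i.2.2).piecewise i.1 i.2.1,
        (restSet ι anc J i.1 i.2.1 i.2.2).piecewise i.2.1 i.1) with he
  have hinj : Set.InjOn e S := by
    rintro ⟨x, y, t⟩ hi ⟨x', y', t'⟩ hi' heq
    have h1 := hS _ hi
    have h2 := hS _ hi'
    have h3 := Prod.mk.inj heq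
    obtain ⟨rfl, rfl, rfl⟩ := unwinding_injective anc hι J h1.1 h2.1 h1.2.1 h2.2.1 h3.1 h3.2
    rfl
  calc ∑ i ∈ S, B i.1 i.2.1 J * H ((restSet ι anc J i.1 i.2.1 i.2.2).piecewise i.1 i.2.1)
      = ∑ i ∈ S, B (e i).1 (e i).2 J * H (e i).1 :=
        Finset.sum_congr rfl fun i hi => by rw [he, (hS i hi).2.2.1]
    _ = ∑ q ∈ S.image e, B q.1 q.2 J * H q.1 := 
        (Finset.sum_image (f := fun q : ((Σ m, leg m) → Fin 2) × ((Σ m, leg m) → Fin 2) =>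
          B q.1 q.2 J * H q.1) hinj).symm
    _ ≤ ∑ q ∈ U, B q.1 q.2 J * H q.1 := by
        refine Finset.sum_le_sum_of_subset_of_nonneg ?_ fun q _ _ => mul_nonneg (hB _ _) (hH _)
        intro q hq
        obtain ⟨i, hi, rfl⟩ := Finset.mem_image.1 hq
        exact (hS i hi).2.2.2

theorem sq_sub_le_mul_sum (f : ℕ → ℝ) (s : ℕ) :
    (f 0 - f s) ^ 2 ≤ s * ∑ t ∈ Finset.range s, (f t - f (t + 1)) ^ 2 := by
  rw [← Finset.sum_range_sub']
  simpa using sq_sum_le_card_mul_sum_sq (s := Finset.range s) (f := fun t => f t - f (t + 1))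

/-- The properties of a global winding that the flow arguments use. -/
structure Winding (w : ∀ m, (leg m → Fin 2) → ℝ)
    (B : ((Σ m, leg m) → Fin 2) → ((Σ m, leg m) → Fin 2) → (∀ m, leg m → leg m) → ℝ) : Prop where
  nonneg : ∀ x y J, 0 ≤ B x y J
  sum_eq : ∀ x y, ∑ J, B x y J = prodWeight w x * prodWeight w y
  pairsUp : ∀ x y J, B x y J ≠ 0 → PairsUp (boxPairing J) (diffSet x y)
  exchange : ∀ x y J, B x y J ≠ 0 → ∀ R ⊆ diffSet x y, (∀ k ∈ R, boxPairing J k ∈ R) →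
    B (R.piecewise x y) (R.piecewise y x) J = B x y J
  ne_zero : ∀ x y J, B x y J ≠ 0 → prodWeight w x ≠ 0 ∧ prodWeight w y ≠ 0

theorem exists_winding (hwind : ∀ m, IsWindable (w m)) : ∃ B, Winding w B := by
  obtain ⟨B, h1, h2, h3, h4, h5⟩ := exists_global_winding hwind
  exact ⟨B, h1, h2, h3, h4, h5⟩

theorem Winding.exchange_restSet (hB : Winding w B) {x y : (Σ m, leg m) → Fin 2}
    {J : ∀ m, leg m → leg m} (h : B x y J ≠ 0) (t : ℕ) :
    B ((restSet ι anc J x y t).piecewise x y) ((restSet ι anc J x y t).piecewise y x) J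
      = B x y J :=
  hB.exchange x y J h _ (restSet_subset anc J x y t) fun k hk =>
    ((hB.pairsUp x y J h).unwind ι (anc (diffSet x y)) t k hk).1

theorem Winding.prodWeight_restSet_ne_zero (hB : Winding w B) {x y : (Σ m, leg m) → Fin 2}
    {J : ∀ m, leg m → leg m} (h : B x y J ≠ 0) (t : ℕ) :
    prodWeight w ((restSet ι anc J x y t).piecewise x y) ≠ 0 :=
  (hB.ne_zero _ _ J (by rwa [hB.exchange_restSet anc h t] : B
    ((restSet ι anc J x y t).piecewise x y) ((restSet ι anc J x y t).piecewise y x) J ≠ 0)).1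

/-- Telescoping and Cauchy–Schwarz along the path. Each step is charged to an end that carries
heads, so every intermediate configuration is charged at most twice. -/
theorem Winding.sq_sub_le_sum (hB : Winding w B) (hι : Function.Involutive ι)
    (hbox : ∀ k, (ι k).1 ≠ k.1) {x y : (Σ m, leg m) → Fin 2} {J : ∀ m, leg m → leg m}
    (h : B x y J ≠ 0) (hy : headSet ι y = ∅) :
    (F x - F y) ^ 2 ≤ 2 * (Fintype.card (Σ m, leg m) : ℝ) *
      ∑ t ∈ Finset.range (Fintype.card (Σ m, leg m)),
        if (bdry ι (restSet ι anc J x y t)).Nonempty then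
          moveEnergy w ι F ((restSet ι anc J x y t).piecewise x y) else 0 := by
  set T := Fintype.card (Σ m, leg m)
  set g : ℕ → ℝ := fun t => if (bdry ι (restSet ι anc J x y t)).Nonempty then
          moveEnergy w ι F ((restSet ι anc J x y t).piecewise x y) else 0 with hg
  have hT : restSet ι anc J x y T = ∅ := unwind_eq_empty _ _ _ _ (Finset.card_le_univ _)
  have hgT : g T = 0 := by simp [hg, hT, bdry]
  have hg0 : ∀ t, 0 ≤ g t := by
    intro t; simp only [hg]; split_ifs
    · exact moveEnergy_nonneg _
    · exact le_rfl
  have h1 := sq_sub_le_mul_sum (fun t => F ((restSet ι anc J x y t).piecewise x y)) T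
  have hend : (restSet ι anc J x y T).piecewise x y = y := by
    funext k; simp [hT]
  simp only [restSet_zero_piecewise, hend] at h1
  have hstep : ∀ t, (F ((restSet ι anc J x y t).piecewise x y)
      - F ((restSet ι anc J x y (t + 1)).piecewise x y)) ^ 2 ≤ g t + g (t + 1) := by
    intro t
    have hs : restSet ι anc J x y (t + 1)
        = unwindStep ι (boxPairing J) (anc (diffSet x y)) (restSet ι anc J x y t) :=
      unwind_succ _ _ _ _ _
    have h3 := hB.prodWeight_restSet_ne_zero anc (ι := ι) h (t + 1)
    have hkey := sq_sub_unwind_le (w := w) (F := F) hι hbox (restSet_subset anc J x y t)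
      ((hB.pairsUp x y J h).unwind ι (anc (diffSet x y)) t) (anc (diffSet x y)) hy
      (hB.prodWeight_restSet_ne_zero anc h t) (by rwa [hs] at h3)
    by_cases hne : (bdry ι (restSet ι anc J x y t)).Nonempty
    · have := hkey.1 hne
      rw [← hs] at this
      refine this.trans ?_
      have : g t = moveEnergy w ι F ((restSet ι anc J x y t).piecewise x y) := if_pos hne
      rw [← this]
      linarith [hg0 (t + 1)]
    · have := hkey.2 (Finset.not_nonempty_iff_eq_empty.1 hne)
      rw [← hs] at this
      refine this.trans ?_
      change g (t + 1) ≤ _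
      linarith [hg0 t]
  have h2 : ∑ t ∈ Finset.range T, (F ((restSet ι anc J x y t).piecewise x y)
      - F ((restSet ι anc J x y (t + 1)).piecewise x y)) ^ 2 ≤ 2 * ∑ t ∈ Finset.range T, g t := by
    refine (Finset.sum_le_sum fun t _ => hstep t).trans ?_
    rw [Finset.sum_add_distrib]
    -- The sum of g (t + 1) is the sum of g up to the boundary terms g 0 ≥ 0 and g T = 0.
    have h3 := Finset.sum_range_succ g T
    rw [Finset.sum_range_succ', hgT] at h3
    linarith [hg0 0]
  refine h1.trans ?_
  have := mul_le_mul_of_nonneg_left h2 (Nat.cast_nonneg (α := ℝ) T)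
  linarith

/-- As long as the path starts every step with heads present, each step is charged to its starting
point, and no factor 2 arises. -/
theorem Winding.sq_sub_le_sum_of_lt (hB : Winding w B) (hι : Function.Involutive ι)
    (hbox : ∀ k, (ι k).1 ≠ k.1) {x y : (Σ m, leg m) → Fin 2} {J : ∀ m, leg m → leg m}
    (h : B x y J ≠ 0) (hy : headSet ι y = ∅) {s : ℕ}
    (hs : ∀ t < s, (bdry ι (restSet ι anc J x y t)).Nonempty) :
    (F x - F ((restSet ι anc J x y s).piecewise x y)) ^ 2 ≤
      s * ∑ t ∈ Finset.range s, moveEnergy w ι F ((restSet ι anc J x y t).piecewise x y) := by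
  have h1 := sq_sub_le_mul_sum (fun t => F ((restSet ι anc J x y t).piecewise x y)) s
  simp only [restSet_zero_piecewise] at h1
  refine h1.trans (mul_le_mul_of_nonneg_left (Finset.sum_le_sum fun t ht => ?_)
    (Nat.cast_nonneg _))
  have hs' : restSet ι anc J x y (t + 1)
      = unwindStep ι (boxPairing J) (anc (diffSet x y)) (restSet ι anc J x y t) :=
    unwind_succ _ _ _ _ _
  have h3 := hB.prodWeight_restSet_ne_zero anc (ι := ι) h (t + 1)
  have hkey := (sq_sub_unwind_le (w := w) (F := F) hι hbox (restSet_subset anc J x y t)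
    ((hB.pairsUp x y J h).unwind ι (anc (diffSet x y)) t) (anc (diffSet x y)) hy
    (hB.prodWeight_restSet_ne_zero anc h t) (by rwa [hs'] at h3)).1
    (hs t (Finset.mem_range.1 ht))
  rwa [← hs'] at hkey

end Flow

/-! ### Variance bounds on 𝒞₀ and on 𝒞₂ from the flow. -/

section Flow

set_option linter.unusedSectionVars false

variable {β : Type*} [Fintype β] [DecidableEq β] {leg : β → Type*} [∀ m, Fintype (leg m)]
  [∀ m, DecidableEq (leg m)]

/-- The assignments without heads. -/
def headFree (ι : (Σ m, leg m) → Σ m, leg m) : Finset ((Σ m, leg m) → Fin 2) :=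
  Finset.univ.filter fun f => headSet ι f = ∅

/-- The assignments with two lines carrying heads. -/
def twoHeaded (ι : (Σ m, leg m) → Σ m, leg m) : Finset ((Σ m, leg m) → Fin 2) :=
  Finset.univ.filter fun f => (headSet ι f).card = 4

variable {w : ∀ m, (leg m → Fin 2) → ℝ} {ι : (Σ m, leg m) → Σ m, leg m}
  {F : ((Σ m, leg m) → Fin 2) → ℝ}
  {B : ((Σ m, leg m) → Fin 2) → ((Σ m, leg m) → Fin 2) → (∀ m, leg m → leg m) → ℝ}

theorem mem_headFree {f : (Σ m, leg m) → Fin 2} : f ∈ headFree ι ↔ headSet ι f = ∅ := by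
  simp [headFree]

theorem mem_twoHeaded {f : (Σ m, leg m) → Fin 2} :
    f ∈ twoHeaded ι ↔ (headSet ι f).card = 4 := by
  simp [twoHeaded]

theorem diffSet_comm {Λ : Type*} [Fintype Λ] [DecidableEq Λ] (x y : Λ → Fin 2) :
    diffSet x y = diffSet y x := by
  ext k; rw [mem_diffSet, mem_diffSet, ne_comm]

theorem card_bdry_restSet (anc : Finset (Σ m, leg m) → Finset (Σ m, leg m))
    (hι : Function.Involutive ι) (hbox : ∀ k, (ι k).1 ≠ k.1) (hB : Winding w B)
    {x y : (Σ m, leg m) → Fin 2} {J : ∀ m, leg m → leg m} (h : B x y J ≠ 0)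
    (hD : (bdry ι (diffSet x y)).card = 0 ∨ (bdry ι (diffSet x y)).card = 2) (t : ℕ) :
    (bdry ι (restSet ι anc J x y t)).card = 0 ∨ (bdry ι (restSet ι anc J x y t)).card = 2 :=
  card_bdry_unwind hι (fun k h => hbox k (by rw [h])) (fun k h => hbox k (by rw [h]; rfl))
    (hB.pairsUp x y J h) _ hD t

theorem card_headSet_eq_diffSet (hι : Function.Involutive ι) {x y : (Σ m, leg m) → Fin 2}
    (hy : headSet ι y = ∅) : (headSet ι x).card = 2 * (bdry ι (diffSet x y)).card := by
  have := card_headSet_piecewise hι (subset_refl (diffSet x y)) hy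
  rwa [diffSet_piecewise_self] at this

theorem card_headSet_restSet (anc : Finset (Σ m, leg m) → Finset (Σ m, leg m))
    (hι : Function.Involutive ι) (hbox : ∀ k, (ι k).1 ≠ k.1) (hB : Winding w B)
    {x y : (Σ m, leg m) → Fin 2} {J : ∀ m, leg m → leg m} (h : B x y J ≠ 0)
    (hy : headSet ι y = ∅) (hx : (headSet ι x).card = 0 ∨ (headSet ι x).card = 4) {t : ℕ}
    (ht : (bdry ι (restSet ι anc J x y t)).Nonempty) :
    (bdry ι (restSet ι anc J x y t)).card = 2 ∧
      (headSet ι ((restSet ι anc J x y t).piecewise x y)).card = 4 := by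
  have h1 := card_bdry_restSet anc hι hbox hB h
    (by rw [card_headSet_eq_diffSet hι hy] at hx; omega) t
  have h2 := Finset.card_pos.2 ht
  rw [card_headSet_piecewise hι (restSet_subset anc J x y t) hy]
  omega

theorem Winding.sum_sum_sum_mul (hB : Winding w B) (C C' : Finset ((Σ m, leg m) → Fin 2))
    (G : ((Σ m, leg m) → Fin 2) → ((Σ m, leg m) → Fin 2) → ℝ) :
    ∑ J, ∑ x ∈ C, ∑ y ∈ C', B x y J * G x y =
      ∑ x ∈ C, ∑ y ∈ C', prodWeight w x * prodWeight w y * G x y := by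
  rw [Finset.sum_comm]
  refine Finset.sum_congr rfl fun x _ => ?_
  rw [Finset.sum_comm]
  refine Finset.sum_congr rfl fun y _ => ?_
  rw [← Finset.sum_mul, hB.sum_eq]

theorem Winding.sum_sum_mul (hB : Winding w B)
    (U : Finset (((Σ m, leg m) → Fin 2) × ((Σ m, leg m) → Fin 2)))
    (G : ((Σ m, leg m) → Fin 2) → ℝ) :
    ∑ J, ∑ q ∈ U, B q.1 q.2 J * G q.1 =
      ∑ q ∈ U, prodWeight w q.1 * prodWeight w q.2 * G q.1 := by
  rw [Finset.sum_comm]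
  refine Finset.sum_congr rfl fun q _ => ?_
  rw [← Finset.sum_mul, hB.sum_eq]

/-- Since x and y are both free of heads, exchanging bits on R creates the same heads in z and in
its complement z'. The partners of z in the flow are thus confined to one fixed position of the
heads, and a bound Q for that restricted sum replaces the much larger total weight with two heads.
-/
theorem sum_headFree_le (hι : Function.Involutive ι) (hbox : ∀ k, (ι k).1 ≠ k.1)
    (hw : ∀ m s, 0 ≤ w m s) (hwind : ∀ m, IsWindable (w m)) {Q : ℝ}
    (hQ : ∀ z ∈ twoHeaded ι, ∑ z' ∈ Finset.univ.filter (fun z' => headSet ι z' = headSet ι z),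
      prodWeight w z' ≤ Q) :
    ∑ x ∈ headFree ι, ∑ y ∈ headFree ι, prodWeight w x * prodWeight w y * (F x - F y) ^ 2 ≤
      2 * (Fintype.card (Σ m, leg m) : ℝ) * Q *
        ∑ z ∈ twoHeaded ι, prodWeight w z * moveEnergy w ι F z := by
  classical
  obtain ⟨B, hB⟩ := exists_winding hwind
  set T := Fintype.card (Σ m, leg m)
  -- No anchor is needed here: the complement has the heads of the intermediate configuration
  -- whatever the order of removal.
  set anc : Finset (Σ m, leg m) → Finset (Σ m, leg m) := fun _ => ∅
  set S : (∀ m, leg m → leg m) →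
      Finset (((Σ m, leg m) → Fin 2) × ((Σ m, leg m) → Fin 2) × ℕ) := fun J =>
    (headFree ι ×ˢ headFree ι ×ˢ Finset.range T).filter fun i =>
      B i.1 i.2.1 J ≠ 0 ∧ (bdry ι (restSet ι anc J i.1 i.2.1 i.2.2)).Nonempty with hSdef
  set U : Finset (((Σ m, leg m) → Fin 2) × ((Σ m, leg m) → Fin 2)) :=
    (twoHeaded ι ×ˢ Finset.univ).filter fun q => headSet ι q.2 = headSet ι q.1 with hUdef
  have hJ : ∀ J, ∑ x ∈ headFree ι, ∑ y ∈ headFree ι, B x y J * (F x - F y) ^ 2 ≤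
      2 * (T : ℝ) * ∑ q ∈ U, B q.1 q.2 J * moveEnergy w ι F q.1 := by
    intro J
    have h1 : ∀ x ∈ headFree ι, ∀ y ∈ headFree ι, B x y J * (F x - F y) ^ 2 ≤
        2 * (T : ℝ) * ∑ t ∈ Finset.range T,
          if B x y J ≠ 0 ∧ (bdry ι (restSet ι anc J x y t)).Nonempty then
            B x y J * moveEnergy w ι F ((restSet ι anc J x y t).piecewise x y) else 0 := by
      intro x _ y hy
      by_cases h0 : B x y J = 0
      · simp [h0]
      · refine (mul_le_mul_of_nonneg_left (hB.sq_sub_le_sum anc hι hbox h0 (mem_headFree.1 hy))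
          (hB.nonneg _ _ _)).trans (le_of_eq ?_)
        rw [mul_left_comm, Finset.mul_sum]
        congr 1
        refine Finset.sum_congr rfl fun t _ => ?_
        by_cases h2 : (bdry ι (restSet ι anc J x y t)).Nonempty <;> simp [h0, h2]
    refine (Finset.sum_le_sum fun x hx => Finset.sum_le_sum fun y hy => h1 x hx y hy).trans ?_
    simp only [← Finset.mul_sum]
    refine mul_le_mul_of_nonneg_left ?_ (by positivity)
    have h3 := sum_unwinding_le anc hι J (fun x y => hB.nonneg x y J)
      (H := moveEnergy w ι F) (fun z => moveEnergy_nonneg z) (S J) U ?_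
    · refine le_trans (le_of_eq ?_) h3
      rw [hSdef, Finset.sum_filter, Finset.sum_product]
      refine Finset.sum_congr rfl fun x _ => ?_
      rw [Finset.sum_product]
    · rintro ⟨x, y, t⟩ hi
      simp only [hSdef, Finset.mem_filter, Finset.mem_product, mem_headFree] at hi
      obtain ⟨⟨hx, hy, -⟩, h0, hne⟩ := hi
      refine ⟨hy, hne, hB.exchange_restSet anc h0 t, ?_⟩
      simp only [hUdef, Finset.mem_filter, Finset.mem_product, mem_twoHeaded, Finset.mem_univ,
        and_true]
      refine ⟨(card_headSet_restSet anc hι hbox hB h0 hy (Or.inl (by simp [hx])) hne).2, ?_⟩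
      rw [headSet_piecewise_eq hι (restSet_subset anc J x y t) hy, headSet_piecewise_eq hι
        (by rw [diffSet_comm]; exact restSet_subset anc J x y t) hx]
  calc ∑ x ∈ headFree ι, ∑ y ∈ headFree ι, prodWeight w x * prodWeight w y * (F x - F y) ^ 2
      = ∑ J, ∑ x ∈ headFree ι, ∑ y ∈ headFree ι, B x y J * (F x - F y) ^ 2 :=
        (hB.sum_sum_sum_mul _ _ _).symm
    _ ≤ ∑ J, 2 * (T : ℝ) * ∑ q ∈ U, B q.1 q.2 J * moveEnergy w ι F q.1 :=
        Finset.sum_le_sum fun J _ => hJ J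
    _ = 2 * (T : ℝ) * ∑ q ∈ U, prodWeight w q.1 * prodWeight w q.2 * moveEnergy w ι F q.1 := by
        rw [← Finset.mul_sum, hB.sum_sum_mul]
    _ = 2 * (T : ℝ) * ∑ z ∈ twoHeaded ι, (prodWeight w z * moveEnergy w ι F z) *
          ∑ z' ∈ Finset.univ.filter (fun z' => headSet ι z' = headSet ι z), prodWeight w z' := by
        congr 1
        rw [hUdef, Finset.sum_filter, Finset.sum_product]
        refine Finset.sum_congr rfl fun z _ => ?_
        rw [Finset.sum_filter, Finset.mul_sum]
        refine Finset.sum_congr rfl fun z' _ => ?_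
        split_ifs <;> ring
    _ ≤ 2 * (T : ℝ) * ∑ z ∈ twoHeaded ι, (prodWeight w z * moveEnergy w ι F z) * Q := by
        refine mul_le_mul_of_nonneg_left (Finset.sum_le_sum fun z hz => ?_) (by positivity)
        exact mul_le_mul_of_nonneg_left (hQ z hz)
          (mul_nonneg (prodWeight_nonneg hw z) (moveEnergy_nonneg z))
    _ = _ := by rw [← Finset.sum_mul]; ring

/-- A one-element subset of the boundary, if there is a boundary. -/
noncomputable def anchor (ι : (Σ m, leg m) → Σ m, leg m) (D : Finset (Σ m, leg m)) :
    Finset (Σ m, leg m) :=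
  if h : (bdry ι D).Nonempty then {h.choose} else ∅

/-- The first time at which the remaining set has no boundary. -/
noncomputable def closingTime (ι : (Σ m, leg m) → Σ m, leg m) (J : ∀ m, leg m → leg m)
    (x y : (Σ m, leg m) → Fin 2) : ℕ :=
  sInf {t | bdry ι (restSet ι (anchor ι) J x y t) = ∅}

theorem closingTime_spec (J : ∀ m, leg m → leg m) (x y : (Σ m, leg m) → Fin 2) :
    bdry ι (restSet ι (anchor ι) J x y (closingTime ι J x y)) = ∅ ∧
    closingTime ι J x y ≤ Fintype.card (Σ m, leg m) ∧
    ∀ t < closingTime ι J x y, (bdry ι (restSet ι (anchor ι) J x y t)).Nonempty := by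
  have hT : bdry ι (restSet ι (anchor ι) J x y (Fintype.card (Σ m, leg m))) = ∅ := by
    rw [restSet, unwind_eq_empty _ _ _ _ (Finset.card_le_univ _)]; simp [bdry]
  refine ⟨Nat.sInf_mem (s := {t | bdry ι (restSet ι (anchor ι) J x y t) = ∅}) ⟨_, hT⟩,
    Nat.sInf_le hT, fun t ht => ?_⟩
  rw [Finset.nonempty_iff_ne_empty]
  exact Nat.notMem_of_lt_sInf ht

/-- The path from x is followed only until its heads annihilate, say in v. Then (F x - c)² ≤ 2 (F x
- F v)² + 2 (F v - c)². The first term is the energy along the path, during which the complement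
lies in 𝒞₀ ∪ 𝒞₂ because of the anchor. In the second term the exchange maps (x, y) injectively to a
pair in 𝒞₀ × 𝒞₂, which leaves the second moment of F - c on 𝒞₀ times the weight of 𝒞₂. -/
theorem sum_twoHeaded_le (hι : Function.Involutive ι) (hbox : ∀ k, (ι k).1 ≠ k.1)
    (hwind : ∀ m, IsWindable (w m)) (c : ℝ) :
    ∑ x ∈ twoHeaded ι, ∑ y ∈ headFree ι, prodWeight w x * prodWeight w y * (F x - c) ^ 2 ≤
      2 * (Fintype.card (Σ m, leg m) : ℝ) *
          (∑ z ∈ headFree ι, prodWeight w z + ∑ z ∈ twoHeaded ι, prodWeight w z) *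
          (∑ z ∈ twoHeaded ι, prodWeight w z * moveEnergy w ι F z) +
        2 * (∑ z ∈ twoHeaded ι, prodWeight w z) *
          ∑ x ∈ headFree ι, prodWeight w x * (F x - c) ^ 2 := by
  classical
  obtain ⟨B, hB⟩ := exists_winding hwind
  have hfix : ∀ k, ι k ≠ k := fun k h => hbox k (by rw [h])
  set T := Fintype.card (Σ m, leg m)
  set S : (∀ m, leg m → leg m) →
      Finset (((Σ m, leg m) → Fin 2) × ((Σ m, leg m) → Fin 2) × ℕ) := fun J =>
    (twoHeaded ι ×ˢ headFree ι ×ˢ Finset.range T).filter fun i =>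
      B i.1 i.2.1 J ≠ 0 ∧ i.2.2 < closingTime ι J i.1 i.2.1 with hSdef
  set U : Finset (((Σ m, leg m) → Fin 2) × ((Σ m, leg m) → Fin 2)) :=
    twoHeaded ι ×ˢ (headFree ι ∪ twoHeaded ι) with hUdef
  -- The part not yet exchanged when the heads first disappear. Continuing to y could create new
  -- heads away from those of x, and the complement could then have four.
  set fin : (∀ m, leg m → leg m) → ((Σ m, leg m) → Fin 2) → ((Σ m, leg m) → Fin 2) →
    Finset (Σ m, leg m) := fun J x y => restSet ι (anchor ι) J x y (closingTime ι J x y) with hfin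
  have hJ1 : ∀ J, ∑ x ∈ twoHeaded ι, ∑ y ∈ headFree ι,
      B x y J * (F x - F ((fin J x y).piecewise x y)) ^ 2 ≤
      (T : ℝ) * ∑ q ∈ U, B q.1 q.2 J * moveEnergy w ι F q.1 := by
    intro J
    have h1 : ∀ x ∈ twoHeaded ι, ∀ y ∈ headFree ι,
        B x y J * (F x - F ((fin J x y).piecewise x y)) ^ 2 ≤
        (T : ℝ) * ∑ t ∈ Finset.range T,
          if B x y J ≠ 0 ∧ t < closingTime ι J x y then
            B x y J * moveEnergy w ι F ((restSet ι (anchor ι) J x y t).piecewise x y) else 0 := by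
      intro x _ y hy
      by_cases h0 : B x y J = 0
      · simp [h0]
      · obtain ⟨-, h2, h3⟩ := closingTime_spec (ι := ι) J x y
        have h4 := hB.sq_sub_le_sum_of_lt (F := F) (anchor ι) hι hbox h0 (mem_headFree.1 hy) h3
        have h5 : (closingTime ι J x y : ℝ) * ∑ t ∈ Finset.range (closingTime ι J x y),
            moveEnergy w ι F ((restSet ι (anchor ι) J x y t).piecewise x y) ≤
            (T : ℝ) * ∑ t ∈ Finset.range T, if t < closingTime ι J x y then
              moveEnergy w ι F ((restSet ι (anchor ι) J x y t).piecewise x y) else 0 := by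
          refine mul_le_mul (by exact_mod_cast h2) (le_of_eq ?_)
            (Finset.sum_nonneg fun _ _ => moveEnergy_nonneg _) (by positivity)
          rw [← Finset.sum_filter]
          refine Finset.sum_congr ?_ fun _ _ => rfl
          ext t
          simp only [Finset.mem_range, Finset.mem_filter]
          omega
        refine (mul_le_mul_of_nonneg_left (h4.trans h5) (hB.nonneg _ _ _)).trans (le_of_eq ?_)
        rw [mul_left_comm, Finset.mul_sum]
        congr 1
        refine Finset.sum_congr rfl fun t _ => ?_
        by_cases h2 : t < closingTime ι J x y <;> simp [h0, h2]
    refine (Finset.sum_le_sum fun x hx => Finset.sum_le_sum fun y hy => h1 x hx y hy).trans ?_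
    simp only [← Finset.mul_sum]
    refine mul_le_mul_of_nonneg_left ?_ (by positivity)
    have h3 := sum_unwinding_le (anchor ι) hι J (fun x y => hB.nonneg x y J)
      (H := moveEnergy w ι F) (fun z => moveEnergy_nonneg z) (S J) U ?_
    · refine le_trans (le_of_eq ?_) h3
      rw [hSdef, Finset.sum_filter, Finset.sum_product]
      refine Finset.sum_congr rfl fun x _ => ?_
      rw [Finset.sum_product]
    · rintro ⟨x, y, t⟩ hi
      simp only [hSdef, Finset.mem_filter, Finset.mem_product, mem_headFree, mem_twoHeaded] at hi
      obtain ⟨⟨hx, hy, -⟩, h0, hlt⟩ := hi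
      obtain ⟨-, -, h3⟩ := closingTime_spec (ι := ι) J x y
      refine ⟨hy, h3 t hlt, hB.exchange_restSet _ h0 t, ?_⟩
      simp only [hUdef, Finset.mem_product, Finset.mem_union, mem_twoHeaded, mem_headFree]
      have hz := card_headSet_restSet (anchor ι) hι hbox hB h0 hy (Or.inr hx) (h3 t hlt)
      refine ⟨hz.2, ?_⟩
      have hD : (bdry ι (diffSet x y)).card = 2 := by
        rw [card_headSet_eq_diffSet hι hy] at hx; omega
      have hDne : (bdry ι (diffSet x y)).Nonempty := Finset.card_pos.1 (by omega)
      have hanc : anchor ι (diffSet x y) = {hDne.choose} := dif_pos hDne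
      have ha := anchor_mem_bdry_unwind hι hfix
        (fun k h => hbox k (by rw [h]; rfl)) (hB.pairsUp x y J h0) hDne.choose_spec hD t
        (fun s hs => by
          rw [← hanc]; exact h3 s (by omega))
      rw [← hanc] at ha
      have := card_headSet_piecewise_swap hι hfix (restSet_subset (anchor ι) J x y t) hy
        hDne.choose_spec hD ha hz.1
      rwa [Finset.card_eq_zero] at this
  have hJ2 : ∀ J, ∑ x ∈ twoHeaded ι, ∑ y ∈ headFree ι,
      B x y J * (F ((fin J x y).piecewise x y) - c) ^ 2 ≤
      ∑ q ∈ headFree ι ×ˢ twoHeaded ι, B q.1 q.2 J * (F q.1 - c) ^ 2 := by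
    intro J
    set e : ((Σ m, leg m) → Fin 2) × ((Σ m, leg m) → Fin 2) →
      ((Σ m, leg m) → Fin 2) × ((Σ m, leg m) → Fin 2) := fun i =>
        ((fin J i.1 i.2).piecewise i.1 i.2, (fin J i.1 i.2).piecewise i.2 i.1) with he
    have hDe : ∀ i, diffSet (e i).1 (e i).2 = diffSet i.1 i.2 := fun i => diffSet_piecewise _ _ _
    -- The final set depends on x and y only through their difference set, which the exchange
    -- preserves; this makes the exchange injective.
    have hfinD : ∀ x y x' y', diffSet x y = diffSet x' y' → fin J x y = fin J x' y' := by
      intro x y x' y' h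
      simp only [hfin, closingTime, restSet, h]
    have hinj : Function.Injective e := by
      intro i i' h
      have hD : diffSet i.1 i.2 = diffSet i'.1 i'.2 := by rw [← hDe, ← hDe i', h]
      have hR := hfinD _ _ _ _ hD
      obtain ⟨h1, h2⟩ := Prod.mk.inj h
      refine Prod.ext ?_ ?_
      · rw [← piecewise_piecewise_swap (fin J i.1 i.2) i.1 i.2, h1, h2, hR,
          piecewise_piecewise_swap]
      · rw [← piecewise_piecewise_swap (fin J i.1 i.2) i.2 i.1, h1, h2, hR,
          piecewise_piecewise_swap]
    rw [← Finset.sum_product']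
    calc ∑ i ∈ twoHeaded ι ×ˢ headFree ι, B i.1 i.2 J * (F ((fin J i.1 i.2).piecewise i.1 i.2) - c) ^ 2
        = ∑ i ∈ (twoHeaded ι ×ˢ headFree ι).filter (fun i => B i.1 i.2 J ≠ 0),
            B (e i).1 (e i).2 J * (F (e i).1 - c) ^ 2 := by
          rw [Finset.sum_filter]
          refine Finset.sum_congr rfl fun i _ => ?_
          split_ifs with h
          · rw [he]
            dsimp only
            rw [hB.exchange_restSet _ h]
          · rw [not_not] at h
            rw [h, zero_mul]
      _ = ∑ q ∈ ((twoHeaded ι ×ˢ headFree ι).filter (fun i => B i.1 i.2 J ≠ 0)).image e,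
            B q.1 q.2 J * (F q.1 - c) ^ 2 :=
          (Finset.sum_image (f := fun q : ((Σ m, leg m) → Fin 2) × ((Σ m, leg m) → Fin 2) =>
            B q.1 q.2 J * (F q.1 - c) ^ 2) hinj.injOn).symm
      _ ≤ ∑ q ∈ headFree ι ×ˢ twoHeaded ι, B q.1 q.2 J * (F q.1 - c) ^ 2 := by
          refine Finset.sum_le_sum_of_subset_of_nonneg ?_ fun q _ _ =>
            mul_nonneg (hB.nonneg _ _ _) (sq_nonneg _)
          intro q hq
          obtain ⟨⟨x, y⟩, hi, rfl⟩ := Finset.mem_image.1 hq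
          simp only [Finset.mem_filter, Finset.mem_product, mem_headFree, mem_twoHeaded] at hi
          obtain ⟨⟨hx, hy⟩, h0⟩ := hi
          obtain ⟨hcl, -, -⟩ := closingTime_spec (ι := ι) J x y
          simp only [he, Finset.mem_product, mem_headFree, mem_twoHeaded]
          have hsub := restSet_subset (ι := ι) (anchor ι) J x y (closingTime ι J x y)
          refine ⟨?_, ?_⟩
          · rw [headSet_piecewise_eq hι hsub hy, hcl]; simp
          -- The final set cuts no line, so exchanging on it toggles no head and the complement
          -- keeps the heads of x.
          · have : headSet ι ((fin J x y).piecewise y x) = headSet ι x := by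
              ext k
              rw [mem_headSet_piecewise (by rw [diffSet_comm]; exact hsub)]
              have hiff : k ∈ fin J x y ↔ ι k ∈ fin J x y := by
                have h1 : ∀ l, l ∈ fin J x y → ι l ∈ fin J x y := by
                  intro l hl
                  by_contra hcon
                  have : l ∈ bdry ι (fin J x y) := mem_bdry.2 ⟨hl, hcon⟩
                  change l ∈ bdry ι (restSet ι (anchor ι) J x y (closingTime ι J x y)) at this
                  rw [hcl] at this
                  simp at this
                exact ⟨h1 k, fun h => by have := h1 _ h; rwa [hι] at this⟩
              simp [hiff]
            rw [this, hx]
  have hexp : ∀ (C C' : Finset ((Σ m, leg m) → Fin 2)) (G : ((Σ m, leg m) → Fin 2) → ℝ),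
      ∑ J, ∑ q ∈ C ×ˢ C', B q.1 q.2 J * G q.1 =
        (∑ z ∈ C, prodWeight w z * G z) * ∑ z ∈ C', prodWeight w z := by
    intro C C' G
    rw [hB.sum_sum_mul, Finset.sum_mul_sum, ← Finset.sum_product']
    exact Finset.sum_congr rfl fun q _ => by ring
  have hdisj : Disjoint (headFree ι) (twoHeaded ι) := by
    rw [Finset.disjoint_left]
    intro f hf hf'
    rw [mem_headFree] at hf
    rw [mem_twoHeaded, hf] at hf'
    simp at hf'
  calc ∑ x ∈ twoHeaded ι, ∑ y ∈ headFree ι, prodWeight w x * prodWeight w y * (F x - c) ^ 2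
      = ∑ J, ∑ x ∈ twoHeaded ι, ∑ y ∈ headFree ι, B x y J * (F x - c) ^ 2 :=
        (hB.sum_sum_sum_mul _ _ _).symm
    _ ≤ ∑ J, (2 * ∑ x ∈ twoHeaded ι, ∑ y ∈ headFree ι,
            B x y J * (F x - F ((fin J x y).piecewise x y)) ^ 2 +
          2 * ∑ x ∈ twoHeaded ι, ∑ y ∈ headFree ι,
            B x y J * (F ((fin J x y).piecewise x y) - c) ^ 2) := by
        refine Finset.sum_le_sum fun J _ => ?_
        simp only [Finset.mul_sum]
        rw [← Finset.sum_add_distrib]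
        refine Finset.sum_le_sum fun x _ => ?_
        rw [← Finset.sum_add_distrib]
        refine Finset.sum_le_sum fun y _ => ?_
        have h1 := hB.nonneg x y J
        set v := F ((fin J x y).piecewise x y)
        have h2 : (F x - c) ^ 2 ≤ 2 * (F x - v) ^ 2 + 2 * (v - c) ^ 2 := by
          nlinarith [sq_nonneg (F x - v - (v - c))]
        have := mul_le_mul_of_nonneg_left h2 h1
        linarith
    _ ≤ ∑ J, (2 * ((T : ℝ) * ∑ q ∈ U, B q.1 q.2 J * moveEnergy w ι F q.1) +
          2 * ∑ q ∈ headFree ι ×ˢ twoHeaded ι, B q.1 q.2 J * (F q.1 - c) ^ 2) := by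
        refine Finset.sum_le_sum fun J _ => ?_
        have h1 := hJ1 J
        have h2 := hJ2 J
        linarith
    _ = _ := by
        rw [Finset.sum_add_distrib, ← Finset.mul_sum, ← Finset.mul_sum, ← Finset.mul_sum, hUdef,
          hexp, hexp _ _ (fun z => (F z - c) ^ 2), Finset.sum_union hdisj]
        ring

end Flow

/-! ### The boxes of the diagram have windable weights. -/

section Windable

variable {κ : Type*} [Fintype κ] [DecidableEq κ]

open Classical in
/-- The pairing that exchanges the elements of a two-element set. -/
noncomputable def otherElement (D : Finset κ) (k : κ) : κ :=
  if h : k ∈ D ∧ (D.erase k).Nonempty then h.2.choose else k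

omit [Fintype κ] in
theorem otherElement_pair {a b : κ} (hab : a ≠ b) : otherElement {a, b} a = b := by
  have h : a ∈ ({a, b} : Finset κ) ∧ (({a, b} : Finset κ).erase a).Nonempty :=
    ⟨by simp, b, by simp [hab.symm]⟩
  rw [otherElement, dif_pos h]
  have := h.2.choose_spec
  simp only [Finset.mem_erase, Finset.mem_insert, Finset.mem_singleton] at this
  tauto

omit [Fintype κ] in
theorem otherElement_pair' {a b : κ} (hab : a ≠ b) : otherElement {a, b} b = a := by
  rw [Finset.pair_comm]; exact otherElement_pair hab.symm

/-- With at most one pair the closed subsets are the empty set and the whole difference set, so an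
exchange fixes or swaps x and y, and w x * w y is invariant. -/
theorem piecewise_eq_of_subset_of_closed {x y : κ → Fin 2} (hD : (diffSet x y).card = 0 ∨
    (diffSet x y).card = 2) {R : Finset κ} (hR : R ⊆ diffSet x y)
    (hcl : ∀ k ∈ R, otherElement (diffSet x y) k ∈ R) :
    (R.piecewise x y = x ∧ R.piecewise y x = y) ∨ (R.piecewise x y = y ∧ R.piecewise y x = x) := by
  rcases R.eq_empty_or_nonempty with rfl | ⟨k, hk⟩
  · right; simp
  · left
    have hRD : R = diffSet x y := by
      rcases hD with hD | hD
      · rw [Finset.card_eq_zero] at hD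
        rw [hD] at hR ⊢
        exact Finset.subset_empty.1 hR
      · obtain ⟨a, b, hab, hD⟩ := Finset.card_eq_two.1 hD
        rw [hD] at hR hcl ⊢
        refine Finset.Subset.antisymm hR ?_
        have hk' := hR hk
        simp only [Finset.mem_insert, Finset.mem_singleton] at hk'
        have h2 := hcl k hk
        rcases hk' with rfl | rfl
        · rw [otherElement_pair hab] at h2
          intro l hl
          simp only [Finset.mem_insert, Finset.mem_singleton] at hl
          rcases hl with rfl | rfl <;> assumption
        · rw [otherElement_pair' hab] at h2
          intro l hl
          simp only [Finset.mem_insert, Finset.mem_singleton] at hl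
          rcases hl with rfl | rfl <;> assumption
    refine ⟨by rw [hRD, diffSet_piecewise_self], ?_⟩
    rw [hRD, diffSet_comm, diffSet_piecewise_self]

omit [Fintype κ] in
theorem pairsUp_otherElement {D : Finset κ} (hD : D.card = 0 ∨ D.card = 2) :
    PairsUp (otherElement D) D := by
  rcases hD with hD | hD
  · rw [Finset.card_eq_zero] at hD
    intro k hk; simp [hD] at hk
  · obtain ⟨a, b, hab, rfl⟩ := Finset.card_eq_two.1 hD
    intro k hk
    simp only [Finset.mem_insert, Finset.mem_singleton] at hk
    rcases hk with rfl | rfl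
    · rw [otherElement_pair hab, otherElement_pair' hab]
      exact ⟨by simp, hab.symm, rfl⟩
    · rw [otherElement_pair' hab, otherElement_pair hab]
      exact ⟨by simp, hab, rfl⟩

/-- A weight that is supported on strings of one parity is windable as soon as the pairs of strings
that differ at more than two positions can be dealt with. -/
theorem isWindable_of_large {w : (κ → Fin 2) → ℝ} (hw : ∀ x, 0 ≤ w x)
    (V : (κ → Fin 2) → (κ → Fin 2) → (κ → κ) → ℝ)
    (hpar : ∀ x y, w x ≠ 0 → w y ≠ 0 → (diffSet x y).card ≤ 2 →
      (diffSet x y).card = 0 ∨ (diffSet x y).card = 2)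
    (h0 : ∀ x y p, 0 ≤ V x y p)
    (hsum : ∀ x y, 2 < (diffSet x y).card → ∑ p, V x y p = w x * w y)
    (hpair : ∀ x y p, 2 < (diffSet x y).card → V x y p ≠ 0 → PairsUp p (diffSet x y))
    (hex : ∀ x y p, 2 < (diffSet x y).card → V x y p ≠ 0 → ∀ R ⊆ diffSet x y,
      (∀ k ∈ R, p k ∈ R) → V (R.piecewise x y) (R.piecewise y x) p = V x y p) :
    IsWindable w := by
  classical
  refine ⟨fun x y p => if (diffSet x y).card ≤ 2 then
    (if p = otherElement (diffSet x y) then w x * w y else 0) else V x y p, ?_, ?_, ?_, ?_⟩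
  · intro x y p
    dsimp only
    split_ifs
    · exact mul_nonneg (hw _) (hw _)
    · exact le_rfl
    · exact h0 _ _ _
  · intro x y
    by_cases h : (diffSet x y).card ≤ 2
    · simp [h]
    · simp only [h, if_false]
      exact hsum x y (not_le.1 h)
  · intro x y p h
    by_cases hD : (diffSet x y).card ≤ 2
    · simp only [hD, if_true, ne_eq, ite_eq_right_iff, Classical.not_imp] at h
      obtain ⟨rfl, h⟩ := h
      exact pairsUp_otherElement (hpar x y (left_ne_zero_of_mul h) (right_ne_zero_of_mul h) hD)
    · simp only [hD, if_false] at h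
      exact hpair x y p (not_le.1 hD) h
  · intro x y p h R hR hcl
    dsimp only at h ⊢
    rw [diffSet_piecewise]
    by_cases hD : (diffSet x y).card ≤ 2
    · simp only [hD, if_true, ne_eq, ite_eq_right_iff, Classical.not_imp] at h
      obtain ⟨rfl, h⟩ := h
      rcases piecewise_eq_of_subset_of_closed (hpar x y (left_ne_zero_of_mul h)
        (right_ne_zero_of_mul h) hD) hR hcl with ⟨h1, h2⟩ | ⟨h1, h2⟩
      · rw [h1, h2]
      · simp only [hD, if_true]
        rw [h1, h2, mul_comm (w y)]
    · simp only [hD, if_false] at h ⊢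
      exact hex x y p (not_le.1 hD) h R hR hcl

/-- Even weights on two positions are windable. -/
theorem isWindable_of_card_le_two {w : (κ → Fin 2) → ℝ} (hw : ∀ x, 0 ≤ w x)
    (hκ : Fintype.card κ ≤ 2)
    (hpar : ∀ x y, w x ≠ 0 → w y ≠ 0 → (diffSet x y).card ≠ 1) : IsWindable w := by
  have hc : ∀ x y : κ → Fin 2, ¬ 2 < (diffSet x y).card := fun x y h =>
    absurd ((Finset.card_le_univ _).trans hκ) (not_le.2 h)
  refine isWindable_of_large hw (fun _ _ _ => 0) (fun x y hx hy h => ?_) (fun _ _ _ => le_rfl)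
    (fun x y h => absurd h (hc x y)) (fun x y _ h => absurd h (hc x y))
    (fun x y _ h => absurd h (hc x y))
  have := hpar x y hx hy
  omega

/-- The entries of an operator `I + (a X X - b Y Y)`, where `p = a + b` and `q = a - b`. -/
noncomputable def twoWeight (p q : ℝ) (ua ub la lb : Fin 2) : ℝ :=
  if ua = la ∧ ub = lb then 1 else if ua ≠ la ∧ ub ≠ lb then (if ua = ub then p else q) else 0

theorem twoWeight_nonneg {p q : ℝ} (hp : 0 ≤ p) (hq : 0 ≤ q) (ua ub la lb : Fin 2) :
    0 ≤ twoWeight p q ua ub la lb := by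
  unfold twoWeight; split_ifs <;> simp [*]

theorem even_of_twoWeight_ne_zero {p q : ℝ} {ua ub la lb : Fin 2}
    (h : twoWeight p q ua ub la lb ≠ 0) : ua = la ↔ ub = lb := by
  unfold twoWeight at h
  split_ifs at h <;> tauto

/-- Nonzero entries have an even number of qubits flipped, so two such strings differ at an even
number of the four legs; 1 and 3 are therefore excluded. -/
theorem card_even_diff : ∀ x1 x2 x3 x4 y1 y2 y3 y4 : Fin 2, (x1 = x3 ↔ x2 = x4) →
    (y1 = y3 ↔ y2 = y4) →
    (((if x1 ≠ y1 then 1 else 0) + (if x3 ≠ y3 then 1 else 0)) +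
      ((if x2 ≠ y2 then 1 else 0) + (if x4 ≠ y4 then 1 else 0)) : ℕ) ≠ 1 ∧
    (((if x1 ≠ y1 then 1 else 0) + (if x3 ≠ y3 then 1 else 0)) +
      ((if x2 ≠ y2 then 1 else 0) + (if x4 ≠ y4 then 1 else 0)) : ℕ) ≠ 3 := by
  decide

variable {Q : Type*} [Fintype Q] [DecidableEq Q]

theorem univ_eq_pair {a b : Q} (hQ : ∀ q, q = a ∨ q = b) : (Finset.univ : Finset Q) = {a, b} := by
  ext q; simpa using hQ q

theorem card_diffSet_four {a b : Q} (hab : a ≠ b) (hQ : ∀ q, q = a ∨ q = b)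
    (x y : Q × Bool → Fin 2) : (diffSet x y).card =
    ((if x (a, false) ≠ y (a, false) then 1 else 0) + (if x (a, true) ≠ y (a, true) then 1 else 0))
    + ((if x (b, false) ≠ y (b, false) then 1 else 0)
      + (if x (b, true) ≠ y (b, true) then 1 else 0)) := by
  rw [diffSet, Finset.card_filter, Fintype.sum_prod_type, univ_eq_pair hQ, Finset.sum_pair hab]
  simp only [Fintype.sum_bool]
  omega

open Classical in
/-- The distribution of `w x * w y` over the three pairings of the four legs of a two-qubit box, for
complementary `x` and `y`. -/
noncomputable def fourWinding (a b : Q) (p q : ℝ) (x : Q × Bool → Fin 2)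
    (φ : Q × Bool → Q × Bool) : ℝ :=
  if (x (a, false) = x (a, true) ↔ x (b, false) = x (b, true)) then
    (if φ = fun k => (Equiv.swap a b k.1, k.2) then
      (if x (a, false) = x (b, false) then p ^ 2 / 2 else q ^ 2 / 2) else 0) +
    (if φ = fun k => (k.1, !k.2) then
      (if x (a, false) = x (a, true) then 1 - (p ^ 2 + q ^ 2) / 2 else 0) else 0) +
    (if φ = fun k => (Equiv.swap a b k.1, !k.2) then
      (if x (a, false) = x (b, true) then q ^ 2 / 2 else p ^ 2 / 2) else 0)
  else 0

/-- The product for complementary strings is 1 if the box acts diagonally. Otherwise it is p² or q²,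
according to whether the two upper bits agree. The three summands belong to the horizontal, the
vertical and the diagonal pairing of the legs, and their weights are chosen to solve these
equations. -/
theorem sum_fourWinding_aux (p q : ℝ) (u v l m : Fin 2) :
    (if (u = l ↔ v = m) then (if u = v then p ^ 2 / 2 else q ^ 2 / 2) +
      (if u = l then 1 - (p ^ 2 + q ^ 2) / 2 else 0) +
      (if u = m then q ^ 2 / 2 else p ^ 2 / 2) else 0) =
    twoWeight p q u v l m * twoWeight p q (u + 1) (v + 1) (l + 1) (m + 1) := by
  fin_cases u <;> fin_cases v <;> fin_cases l <;> fin_cases m <;> simp [twoWeight] <;> ring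

section

variable {a b : Q} {p q : ℝ} {x : Q × Bool → Fin 2}

theorem sum_fourWinding :
    ∑ φ, fourWinding a b p q x φ =
      twoWeight p q (x (a, false)) (x (b, false)) (x (a, true)) (x (b, true)) *
      twoWeight p q (x (a, false) + 1) (x (b, false) + 1) (x (a, true) + 1) (x (b, true) + 1) := by
  rw [← sum_fourWinding_aux]
  unfold fourWinding
  by_cases h : x (a, false) = x (a, true) ↔ x (b, false) = x (b, true)
  · simp only [h, if_true, Finset.sum_add_distrib, Finset.sum_ite_eq', Finset.mem_univ]
  · simp only [h, if_false, Finset.sum_const_zero]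

theorem pairing_of_fourWinding_ne_zero {φ : Q × Bool → Q × Bool}
    (h : fourWinding a b p q x φ ≠ 0) :
    φ = (fun k => (Equiv.swap a b k.1, k.2)) ∨ φ = (fun k => (k.1, !k.2)) ∨
      φ = fun k => (Equiv.swap a b k.1, !k.2) := by
  unfold fourWinding at h
  by_contra hcon
  push Not at hcon
  simp [hcon] at h

theorem pairsUp_univ_of_fourWinding_ne_zero (hab : a ≠ b) (hQ : ∀ q, q = a ∨ q = b)
    {φ : Q × Bool → Q × Bool} (h : fourWinding a b p q x φ ≠ 0) :
    PairsUp φ Finset.univ := by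
  have hs : ∀ c : Q, Equiv.swap a b c ≠ c := by
    intro c
    rcases hQ c with rfl | rfl
    · simpa using hab.symm
    · simpa using hab
  rcases pairing_of_fourWinding_ne_zero h with rfl | rfl | rfl
  · rintro ⟨c, l⟩ -
    simp [hs]
  · rintro ⟨c, l⟩ -
    simp
  · rintro ⟨c, l⟩ -
    simp

/-- The weight given to a pairing depends only on whether the two bits of one of its pairs agree,
and on the parity of the string; flipping both bits of a pair changes neither. -/
theorem fourWinding_exchange (hab : a ≠ b) {φ : Q × Bool → Q × Bool}
    (h : fourWinding a b p q x φ ≠ 0) (R : Finset (Q × Bool)) (hR : ∀ k, k ∈ R ↔ φ k ∈ R) :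
    fourWinding a b p q (R.piecewise x fun k => x k + 1) φ = fourWinding a b p q x φ := by
  have e12 : (fun k : Q × Bool => (Equiv.swap a b k.1, k.2)) ≠ fun k => (k.1, !k.2) := fun h => by
    have := congrFun h (a, false); simp at this
  have e13 : (fun k : Q × Bool => (Equiv.swap a b k.1, k.2)) ≠
      fun k => (Equiv.swap a b k.1, !k.2) := fun h => by
    have := congrFun h (a, false); simp at this
  have e23 : (fun k : Q × Bool => (k.1, !k.2)) ≠ fun k => (Equiv.swap a b k.1, !k.2) := fun h => by
    have := congrFun h (a, false); simp [hab] at this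
  have key : ∀ u v : Fin 2, (u + 1 = v ↔ ¬ u = v) ∧ (u = v + 1 ↔ ¬ u = v) := by decide
  have hne : ∀ A B : Prop, ((¬ A ↔ ¬ B) ↔ (A ↔ B)) := fun A B => by tauto
  have k1 := hR (a, false)
  have k2 := hR (a, true)
  rcases pairing_of_fourWinding_ne_zero h with rfl | rfl | rfl
  · simp only [Equiv.swap_apply_left] at k1 k2
    unfold fourWinding
    simp only [if_true, e12, e13, if_false]
    by_cases h1 : (a, false) ∈ R <;> by_cases h2 : (a, true) ∈ R <;>
      simp only [Finset.piecewise, h1, h2, ← k1, ← k2, if_true, if_false, key, hne,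
        not_not]
  · have k3 := hR (b, false)
    simp only [Bool.not_false] at k1 k3
    unfold fourWinding
    simp only [if_true, e12.symm, e23, if_false]
    by_cases h1 : (a, false) ∈ R <;> by_cases h2 : (b, false) ∈ R <;>
      simp only [Finset.piecewise, h1, h2, ← k1, ← k3, if_true, if_false, key,
        not_not]
  · simp only [Equiv.swap_apply_left, Bool.not_false, Bool.not_true] at k1 k2
    unfold fourWinding
    simp only [if_true, e13.symm, e23.symm, if_false]
    by_cases h1 : (a, false) ∈ R <;> by_cases h2 : (a, true) ∈ R <;>
      simp only [Finset.piecewise, h1, h2, ← k1, ← k2, if_true, if_false, key, hne,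
        not_not]

end

/-- By parity, strings of nonzero weight that differ at more than two legs differ at all four, so
only complementary strings need `fourWinding`. The condition p² + q² ≤ 2 is what makes the weight of
the vertical pairing nonnegative. -/
theorem isWindable_twoWeight {a b : Q} (hab : a ≠ b) (hQ : ∀ q, q = a ∨ q = b) {p q : ℝ}
    (hp : 0 ≤ p) (hq : 0 ≤ q) (hpq : p ^ 2 + q ^ 2 ≤ 2) :
    IsWindable fun s : Q × Bool → Fin 2 =>
      twoWeight p q (s (a, false)) (s (b, false)) (s (a, true)) (s (b, true)) := by
  classical
  have hcard := card_diffSet_four hab hQ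
  have hκ : (Finset.univ : Finset (Q × Bool)).card = 4 := by
    rw [Finset.card_univ, Fintype.card_prod, Fintype.card_bool, ← Finset.card_univ,
      univ_eq_pair hQ, Finset.card_pair hab]
  have hcompl : ∀ x y : Q × Bool → Fin 2, (∀ k, x k ≠ y k) → y = fun k => x k + 1 := fun x y h =>
    funext fun k => (fin2_ne_iff_eq_add_one _ _).1 (h k).symm
  have huniv : ∀ x y : Q × Bool → Fin 2, (∀ k, x k ≠ y k) → diffSet x y = Finset.univ :=
    fun x y h => by ext k; simp [mem_diffSet, h]
  refine isWindable_of_large (fun x => twoWeight_nonneg hp hq _ _ _ _)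
    (fun x y φ => if ∀ k, x k ≠ y k then fourWinding a b p q x φ else 0) ?_ ?_ ?_ ?_ ?_
  · intro x y hx hy h
    have h1 := card_even_diff (x (a, false)) (x (b, false)) (x (a, true)) (x (b, true))
      (y (a, false)) (y (b, false)) (y (a, true)) (y (b, true))
      (even_of_twoWeight_ne_zero hx) (even_of_twoWeight_ne_zero hy)
    rw [← hcard] at h1
    omega
  · intro x y φ
    split_ifs
    · unfold fourWinding
      have h1 : 0 ≤ 1 - (p ^ 2 + q ^ 2) / 2 := by linarith
      have h2 : 0 ≤ p ^ 2 / 2 := by positivity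
      have h3 : 0 ≤ q ^ 2 / 2 := by positivity
      split_ifs <;> linarith
    · exact le_rfl
  · intro x y hD
    by_cases h : ∀ k, x k ≠ y k
    · simp only [h, ne_eq, not_false_eq_true, implies_true, if_true]
      rw [sum_fourWinding, hcompl x y h]
    · simp only [h, if_false, Finset.sum_const_zero]
      symm
      by_contra hne
      have h1 := card_even_diff (x (a, false)) (x (b, false)) (x (a, true)) (x (b, true))
        (y (a, false)) (y (b, false)) (y (a, true)) (y (b, true))
        (even_of_twoWeight_ne_zero (left_ne_zero_of_mul hne))
        (even_of_twoWeight_ne_zero (right_ne_zero_of_mul hne))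
      rw [← hcard] at h1
      push Not at h
      obtain ⟨k, hk⟩ := h
      have h2 : diffSet x y ⊂ Finset.univ := by
        refine Finset.ssubset_univ_iff.2 fun h => ?_
        have := h ▸ Finset.mem_univ k
        exact mem_diffSet.1 this hk
      have := Finset.card_lt_card h2
      omega
  · intro x y φ _ h
    split_ifs at h with hall
    · rw [huniv x y hall]
      exact pairsUp_univ_of_fourWinding_ne_zero hab hQ h
    · exact absurd rfl h
  · intro x y φ hD h R hR hcl
    split_ifs at h with hall
    · have hp' := pairsUp_univ_of_fourWinding_ne_zero hab hQ h
      rw [if_pos hall, if_pos, hcompl x y hall]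
      · refine fourWinding_exchange hab h R fun k => ⟨hcl k, fun hk => ?_⟩
        have := hcl _ hk
        rwa [(hp' k (Finset.mem_univ k)).2.2] at this
      · intro k
        rw [← mem_diffSet, diffSet_piecewise, huniv x y hall]
        exact Finset.mem_univ k
    · exact absurd rfl h

end Windable

/-! ### The vertical lines as a fixed-point-free involution of the legs. -/

section Diagram

variable {n L : ℕ}

/-! ### The list of operators -/

/-- The factors of `C C†`. -/
def blockGates (n : ℕ) : List (Gate n) := stepGates n ++ (stepGates n).reverse

theorem mem_gates_iff {g : Gate n} : g ∈ gates n L ↔ L ≠ 0 ∧ g ∈ stepGates n := by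
  simp only [gates, List.mem_flatten, List.mem_replicate]
  constructor
  · rintro ⟨l, ⟨h, rfl⟩, hg⟩
    simpa [h] using hg
  · rintro ⟨h, hg⟩
    exact ⟨_, ⟨h, rfl⟩, by simp [hg]⟩

theorem two_mem_stepGates {i j : Fin n} : Gate.two i j ∈ stepGates n ↔ i < j := by
  simp [stepGates]

theorem one_mem_stepGates (i : Fin n) : Gate.one i ∈ stepGates n := by
  simp [stepGates]

theorem lt_of_op_eq_two {m : Fin (numOps n L)} {i j : Fin n} (h : op m = Gate.two i j) :
    i < j := by
  have : op m ∈ gates n L := List.get_mem _ _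
  rw [h, mem_gates_iff, two_mem_stepGates] at this
  exact this.2

theorem length_gates : numOps n L = L * (blockGates n).length := by
  simp [numOps, gates, blockGates]

theorem getElem_flatten_replicate {α : Type*} (l : List α) (L i : ℕ)
    (h : i < (List.replicate L l).flatten.length) :
    (List.replicate L l).flatten[i] = l[i % l.length]'(Nat.mod_lt _ (by
      by_contra hl
      have : l.length = 0 := by omega
      simp [this] at h)) := by
  induction L generalizing i with
  | zero => simp at h
  | succ L ih =>
    simp only [List.replicate_succ, List.flatten_cons, List.getElem_append]
    split_ifs with hi
    · simp [Nat.mod_eq_of_lt hi]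
    · rw [ih]
      congr 1
      conv_rhs => rw [show i = (i - l.length) + l.length by omega]
      rw [Nat.add_mod_right]

theorem op_eq_getElem (m : Fin (numOps n L)) :
    ∃ h, op m = (blockGates n)[(m : ℕ) % (blockGates n).length]'h :=
  ⟨_, getElem_flatten_replicate (blockGates n) L m m.2⟩

/-- The field operator of each qubit occurs in C and again in C†. Consequently no line returns to
the box where it starts, which the unwinding requires. -/
theorem exists_two_boxes (hL : L ≠ 0) (q : Fin n) :
    ∃ m m' : Fin (numOps n L), m ≠ m' ∧ q ∈ (op m).support ∧ q ∈ (op m').support := by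
  obtain ⟨i, hi, h1⟩ := List.getElem_of_mem (one_mem_stepGates q)
  obtain ⟨j, hj, h2⟩ := List.getElem_of_mem (List.mem_reverse.2 (one_mem_stepGates q))
  have hlen : (blockGates n).length = (stepGates n).length + (stepGates n).length := by
    simp [blockGates]
  have hj' : j < (stepGates n).length := by simpa using hj
  have hM : (blockGates n).length ≤ numOps n L := by
    rw [length_gates]; exact Nat.le_mul_of_pos_left _ (Nat.pos_of_ne_zero hL)
  refine ⟨⟨i, by omega⟩, ⟨(stepGates n).length + j, by omega⟩, ?_, ?_, ?_⟩
  · intro h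
    have := congrArg Fin.val h
    simp only at this
    omega
  · obtain ⟨_, h⟩ := op_eq_getElem (L := L) (⟨i, by omega⟩ : Fin (numOps n L))
    have : op (⟨i, by omega⟩ : Fin (numOps n L)) = Gate.one q := by
      rw [h, ← h1]
      simp only [Nat.mod_eq_of_lt (show i < (blockGates n).length by omega)]
      simp [blockGates, hi]
    rw [this]; simp [Gate.support]
  · obtain ⟨_, h⟩ := op_eq_getElem (L := L)
      (⟨(stepGates n).length + j, by omega⟩ : Fin (numOps n L))
    have : op (⟨(stepGates n).length + j, by omega⟩ : Fin (numOps n L)) = Gate.one q := by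
      rw [h, ← h2]
      simp only [Nat.mod_eq_of_lt (show (stepGates n).length + j < (blockGates n).length by omega)]
      simp [blockGates]
    rw [this]; simp [Gate.support]

/-! ### Vertical lines -/

theorem Leg.ext_iff' {k l : Leg n L} :
    k = l ↔ k.1 = l.1 ∧ (k.2.1 : Fin n) = l.2.1 ∧ k.2.2 = l.2.2 := by
  obtain ⟨m, ⟨q, hq⟩, b⟩ := k
  obtain ⟨m', ⟨q', hq'⟩, b'⟩ := l
  constructor
  · intro h; rw [h]; exact ⟨rfl, rfl, rfl⟩
  · rintro ⟨h1, h2, h3⟩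
    simp only at h1 h2 h3
    subst h1 h2 h3
    rfl

theorem numOps_pos (k : Leg n L) : 0 < numOps n L := lt_of_le_of_lt (Nat.zero_le _) k.1.2

theorem exists_joined {k : Leg n L} (hk : k.2.2 = true) : ∃ l, Joined k l := by
  classical
  have hM := numOps_pos k
  have hex : ∃ r : ℕ, 0 < r ∧ (k.2.1 : Fin n) ∈
      (op (⟨((k.1 : ℕ) + r) % numOps n L, Nat.mod_lt _ hM⟩ : Fin (numOps n L))).support := by
    refine ⟨numOps n L, hM, ?_⟩
    have : (⟨((k.1 : ℕ) + numOps n L) % numOps n L, Nat.mod_lt _ hM⟩ : Fin (numOps n L)) = k.1 := by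
      ext; simp [Nat.mod_eq_of_lt k.1.2]
    rw [this]; exact k.2.1.2
  obtain ⟨h0, h1⟩ := Nat.find_spec hex
  refine ⟨⟨_, ⟨⟨_, h1⟩, false⟩⟩, hk, rfl, rfl, Nat.find hex, h0, rfl, fun s hs hsr m hm hmem => ?_⟩
  refine Nat.find_min hex hsr ⟨hs, ?_⟩
  have : m = (⟨((k.1 : ℕ) + s) % numOps n L, Nat.mod_lt _ hM⟩ : Fin (numOps n L)) := Fin.ext hm
  rwa [← this]

theorem Joined.right_unique {k l l' : Leg n L} (h : Joined k l) (h' : Joined k l') : l = l' := by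
  obtain ⟨-, hl, hq, r, hr, hlr, hmin⟩ := h
  obtain ⟨-, hl', hq', r', hr', hlr', hmin'⟩ := h'
  have hrr : r = r' := by
    rcases lt_trichotomy r r' with h | h | h
    · exact absurd (hq ▸ l.2.1.2) (hmin' r hr h l.1 hlr)
    · exact h
    · exact absurd (hq' ▸ l'.2.1.2) (hmin r' hr' h l'.1 hlr')
  subst hrr
  exact Leg.ext_iff'.2 ⟨Fin.ext (hlr.trans hlr'.symm), hq.symm.trans hq', hl.trans hl'.symm⟩

theorem eq_add_mod_of_add_mod {M a b r s c : ℕ} (ha : a < M) (h1 : c = (a + r) % M)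
    (h2 : c = (b + s) % M) (hrs : r ≤ s) : a = (b + (s - r)) % M := by
  have h : (a + r) ≡ (b + (s - r)) + r [MOD M] := by
    unfold Nat.ModEq
    rw [← h1, h2]; congr 1; omega
  have := Nat.ModEq.add_right_cancel' r h
  unfold Nat.ModEq at this
  rwa [Nat.mod_eq_of_lt ha] at this

theorem Joined.left_unique {k k' l : Leg n L} (h : Joined k l) (h' : Joined k' l) : k = k' := by
  obtain ⟨hk, -, hq, r, hr, hlr, hmin⟩ := h
  obtain ⟨hk', -, hq', r', hr', hlr', hmin'⟩ := h'
  have hqq : (k.2.1 : Fin n) = k'.2.1 := hq.trans hq'.symm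
  have hrr : r = r' := by
    rcases lt_trichotomy r r' with h | h | h
    · have := eq_add_mod_of_add_mod k.1.2 hlr hlr' h.le
      exact absurd (hqq ▸ k.2.1.2) (hmin' (r' - r) (by omega) (by omega) k.1 this)
    · exact h
    · have := eq_add_mod_of_add_mod k'.1.2 hlr' hlr h.le
      exact absurd (hqq ▸ k'.2.1.2) (hmin (r - r') (by omega) (by omega) k'.1 this)
  subst hrr
  have := eq_add_mod_of_add_mod k.1.2 hlr hlr' le_rfl
  refine Leg.ext_iff'.2 ⟨Fin.ext ?_, hqq, hk.trans hk'.symm⟩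
  rw [this]; simp [Nat.mod_eq_of_lt k'.1.2]

/-- A line ending at its own box would go once around imaginary time and pass every other box on the
qubit, and there is at least one. -/
theorem Joined.fst_ne (hL : L ≠ 0) {k l : Leg n L} (h : Joined k l) : l.1 ≠ k.1 := by
  intro heq
  obtain ⟨-, -, hq, r, hr, hlr, hmin⟩ := h
  have hM := numOps_pos k
  obtain ⟨m1, m2, hm, h1, h2⟩ := exists_two_boxes hL (k.2.1 : Fin n)
  obtain ⟨m, hmk, hms⟩ : ∃ m : Fin (numOps n L), m ≠ k.1 ∧ (k.2.1 : Fin n) ∈ (op m).support := by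
    by_cases h : m1 = k.1
    · exact ⟨m2, fun h' => hm (h.trans h'.symm), h2⟩
    · exact ⟨m1, h, h1⟩
  -- Equality of the two boxes means that r is a positive multiple of M.
  have hrM : numOps n L ≤ r := by
    by_contra hlt
    push Not at hlt
    rw [heq] at hlr
    have h3 := k.1.2
    rcases lt_or_ge ((k.1 : ℕ) + r) (numOps n L) with h4 | h4
    · rw [Nat.mod_eq_of_lt h4] at hlr; omega
    · rw [Nat.mod_eq_sub_mod h4, Nat.mod_eq_of_lt (by omega)] at hlr; omega
  have hmk' : (m : ℕ) ≠ k.1 := fun h => hmk (Fin.ext h)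
  have hm2 := m.2
  have hk2 := k.1.2
  rcases lt_or_gt_of_ne hmk' with h4 | h4
  · refine hmin ((m : ℕ) + numOps n L - k.1) (by omega) (by omega) m ?_ hms
    rw [show (k.1 : ℕ) + ((m : ℕ) + numOps n L - k.1) = m + numOps n L by omega]
    simp [Nat.mod_eq_of_lt hm2]
  · refine hmin ((m : ℕ) - k.1) (by omega) (by omega) m ?_ hms
    rw [show (k.1 : ℕ) + ((m : ℕ) - k.1) = m by omega, Nat.mod_eq_of_lt hm2]

/-- Instead of searching backwards, the map from lower legs to the next upper legs is extended by
sending each upper leg to the lower leg below it in the same box. This is an injective self-map of a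
finite set, hence surjective, and an upper leg can only be hit through a line. -/
theorem exists_joined_left {l : Leg n L} (hl : l.2.2 = false) : ∃ k, Joined k l := by
  classical
  choose nxt hnxt using fun k : {k : Leg n L // k.2.2 = true} => exists_joined k.2
  let f : Leg n L → Leg n L := fun k =>
    if h : k.2.2 = true then nxt ⟨k, h⟩ else ⟨k.1, k.2.1, true⟩
  have hf : Function.Injective f := by
    intro k k' h
    by_cases hk : k.2.2 = true <;> by_cases hk' : k'.2.2 = true
    · simp only [f, hk, hk', dif_pos] at h
      exact (hnxt ⟨k, hk⟩).left_unique (h ▸ hnxt ⟨k', hk'⟩)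
    · simp only [f, hk, hk', dif_pos] at h
      have h1 := (hnxt ⟨k, hk⟩).2.1
      rw [h] at h1; simp at h1
    · simp only [f, hk, hk', dif_pos] at h
      have h1 := (hnxt ⟨k', hk'⟩).2.1
      rw [← h] at h1; simp at h1
    · simp only [f, hk, hk'] at h
      have h1 := Leg.ext_iff'.1 h
      refine Leg.ext_iff'.2 ⟨h1.1, h1.2.1, ?_⟩
      simp only [Bool.not_eq_true] at hk hk'
      rw [hk, hk']
  obtain ⟨k, hk⟩ := (Finite.injective_iff_surjective.1 hf) l
  by_cases h : k.2.2 = true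
  · simp only [f, h, dif_pos] at hk
    exact ⟨k, hk ▸ hnxt ⟨k, h⟩⟩
  · simp only [f, h] at hk
    rw [← hk] at hl
    simp at hl

theorem exists_partner (k : Leg n L) : ∃ l, Joined k l ∨ Joined l k := by
  by_cases h : k.2.2 = true
  · obtain ⟨l, hl⟩ := exists_joined h
    exact ⟨l, Or.inl hl⟩
  · obtain ⟨l, hl⟩ := exists_joined_left (by simpa using h)
    exact ⟨l, Or.inr hl⟩

/-- The other end of the line at a leg. -/
noncomputable def partner (k : Leg n L) : Leg n L := (exists_partner k).choose

theorem joined_or_joined_iff {k l : Leg n L} : (Joined k l ∨ Joined l k) ↔ l = partner k := by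
  have hp := (exists_partner k).choose_spec
  constructor
  · rintro (h | h) <;> rcases hp with h' | h'
    · exact h.right_unique h'
    · have := h.1; rw [h'.2.1] at this; simp at this
    · have := h'.1; rw [h.2.1] at this; simp at this
    · exact h.left_unique h'
  · rintro rfl; exact hp

theorem partner_involutive : Function.Involutive (partner (n := n) (L := L)) := fun k =>
  (joined_or_joined_iff.1 (joined_or_joined_iff.2 (rfl : partner k = _)).symm).symm

theorem partner_fst_ne (hL : L ≠ 0) (k : Leg n L) : (partner k).1 ≠ k.1 := by
  rcases joined_or_joined_iff.2 (rfl : partner k = _) with h | h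
  · exact h.fst_ne hL
  · exact (h.fst_ne hL).symm

theorem partner_ne (hL : L ≠ 0) (k : Leg n L) : partner k ≠ k := fun h =>
  partner_fst_ne hL k (by rw [h])

theorem joined_iff_of_lower {k l : Leg n L} (hk : k.2.2 = true) : Joined k l ↔ l = partner k := by
  rw [← joined_or_joined_iff]
  constructor
  · exact Or.inl
  · rintro (h | h)
    · exact h
    · rw [h.2.1] at hk; simp at hk

theorem partner_snd (k : Leg n L) : (partner k).2.2 = !k.2.2 := by
  rcases joined_or_joined_iff.2 (rfl : partner k = _) with h | h
  · rw [h.1, h.2.1]; rfl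
  · rw [h.1, h.2.1]; rfl

theorem headLegs_eq (f : Config n L) : headLegs f = headSet partner f := by
  ext k
  simp only [headLegs, Finset.mem_filter, Finset.mem_univ, true_and, joined_or_joined_iff,
    mem_headSet]
  simp

theorem heads_eq (f : Config n L) : heads f = (headSet partner f).filter fun k => k.2.2 = true := by
  ext k
  simp only [heads, Finset.mem_filter, Finset.mem_univ, true_and, mem_headSet]
  constructor
  · rintro ⟨l, h, hf⟩
    have := (joined_iff_of_lower h.1).1 h
    rw [this] at hf
    exact ⟨hf, h.1⟩
  · rintro ⟨hf, hk⟩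
    exact ⟨partner k, (joined_iff_of_lower hk).2 rfl, hf⟩

/-- `heads` records one end of each line and `headSet` both; this translates between the two ways of
counting. -/
theorem card_headSet_partner (f : Config n L) :
    (headSet partner f).card = 2 * (heads f).card := by
  classical
  have h1 := Finset.card_filter_add_card_filter_not (s := headSet partner f)
    (fun k : Leg n L => k.2.2 = true)
  have h2 : ((headSet partner f).filter fun k => ¬ k.2.2 = true) = (heads f).image partner := by
    ext k
    simp only [heads_eq, Finset.mem_filter, Finset.mem_image]
    constructor
    · rintro ⟨hk, hk'⟩
      refine ⟨partner k, ⟨(mem_headSet_partner partner_involutive).2 hk, ?_⟩, partner_involutive k⟩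
      rw [partner_snd]; simpa using hk'
    · rintro ⟨l, ⟨hl, hl'⟩, rfl⟩
      refine ⟨(mem_headSet_partner partner_involutive).2 hl, ?_⟩
      rw [partner_snd, hl']; simp
  rw [h2, ← heads_eq, Finset.card_image_of_injective _ partner_involutive.injective] at h1
  omega

theorem headSet_eq_iff_heads_eq (f g : Config n L) :
    headSet partner f = headSet partner g ↔ heads f = heads g := by
  constructor
  · intro h; rw [heads_eq, heads_eq, h]
  · intro h
    ext k
    by_cases hk : k.2.2 = true
    · have := Finset.ext_iff.1 h k
      simpa only [heads_eq, Finset.mem_filter, hk, and_true] using this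
    · have := Finset.ext_iff.1 h (partner k)
      have hk' : (partner k).2.2 = true := by rw [partner_snd]; simpa using hk
      simpa only [heads_eq, Finset.mem_filter, hk', and_true,
        mem_headSet_partner partner_involutive] using this

end Diagram

/-! ### Size, positivity and windability of the matrix elements. -/

section BoxWeights

variable {n L : ℕ}

theorem oneQubitOp_re (δ d : ℝ) (u v : Fin 2) : (oneQubitOp δ d u v).re =
    if u = v then (if u = 0 then 1 - δ * d else 1 + δ * d) else 0 := by
  fin_cases u <;> fin_cases v <;> simp [oneQubitOp, pauliZ]

theorem twoQubitOp_re (δ a b : ℝ) (u v l m : Fin 2) : (twoQubitOp δ a b (u, v) (l, m)).re =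
    twoWeight (δ * (a + b)) (δ * (a - b)) u v l m := by
  fin_cases u <;> fin_cases v <;> fin_cases l <;> fin_cases m <;>
    simp [twoQubitOp, pauliX, pauliY, twoWeight] <;> ring

theorem weight_one_eq (H : Coeffs n) (δ : ℝ) (i : Fin n) (s : (Gate.one i).Leg → Fin 2) :
    (Gate.one i).weight H δ s =
      if s (⟨i, by simp [Gate.support]⟩, false) = s (⟨i, by simp [Gate.support]⟩, true) then
        (if s (⟨i, by simp [Gate.support]⟩, false) = 0 then 1 - δ * H.d i else 1 + δ * H.d i)
      else 0 := by
  exact oneQubitOp_re _ _ _ _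

theorem weight_two_eq (H : Coeffs n) (δ : ℝ) (i j : Fin n) (s : (Gate.two i j).Leg → Fin 2) :
    (Gate.two i j).weight H δ s =
      twoWeight (δ * (H.a i j + H.b i j)) (δ * (H.a i j - H.b i j))
        (s (⟨i, by simp [Gate.support]⟩, false)) (s (⟨j, by simp [Gate.support]⟩, false))
        (s (⟨i, by simp [Gate.support]⟩, true)) (s (⟨j, by simp [Gate.support]⟩, true)) := by
  exact twoQubitOp_re _ _ _ _ _ _ _

theorem cMin_pos {H : Coeffs n} (hH : H.IsStoquastic) : 0 < H.cMin := by
  unfold Coeffs.cMin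
  rw [Finset.lt_min'_iff]
  intro c hc
  simp only [Coeffs.amplitudes, Finset.mem_insert, Finset.mem_filter, Finset.mem_union,
    Finset.mem_image, Finset.mem_univ, true_and, Prod.exists] at hc
  rcases hc with rfl | ⟨⟨i, j, hij, rfl⟩ | ⟨i, j, hij, rfl⟩, hne⟩
  · exact one_pos
  · have := abs_le.1 (hH.1 i j hij).1
    exact lt_of_le_of_ne (by linarith) hne.symm
  · have := abs_le.1 (hH.1 i j hij).1
    exact lt_of_le_of_ne (by linarith) hne.symm

theorem cMin_le_one (H : Coeffs n) : H.cMin ≤ 1 :=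
  Finset.min'_le _ _ (by simp)

theorem cMin_le_sub (H : Coeffs n) {i j : Fin n} (hij : i < j) (h : H.a i j - H.b i j ≠ 0) :
    H.cMin ≤ H.a i j - H.b i j := by
  refine Finset.min'_le _ _ ?_
  simp only [Coeffs.amplitudes, Finset.mem_insert, Finset.mem_filter, Finset.mem_union,
    Finset.mem_image, Finset.mem_univ, true_and, Prod.exists]
  exact Or.inr ⟨Or.inl ⟨i, j, hij, rfl⟩, h⟩

theorem cMin_le_add (H : Coeffs n) {i j : Fin n} (hij : i < j) (h : H.a i j + H.b i j ≠ 0) :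
    H.cMin ≤ H.a i j + H.b i j := by
  refine Finset.min'_le _ _ ?_
  simp only [Coeffs.amplitudes, Finset.mem_insert, Finset.mem_filter, Finset.mem_union,
    Finset.mem_image, Finset.mem_univ, true_and, Prod.exists]
  exact Or.inr ⟨Or.inr ⟨i, j, hij, rfl⟩, h⟩

/-- The product of a field `d` with `|d| ≤ 1` and `0 ≤ δ ≤ 1/2`. -/
theorem abs_mul_le_half {δ d : ℝ} (h0 : 0 ≤ δ) (h1 : δ ≤ 1 / 2) (hd : |d| ≤ 1) :
    |δ * d| ≤ 1 / 2 := by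
  rw [abs_mul, abs_of_nonneg h0]
  nlinarith [abs_nonneg d]

/-- What the later arguments use about the weight of a box. -/
theorem gate_weight_bounds {H : Coeffs n} (hH : H.IsStoquastic) {δ : ℝ} (h0 : 0 < δ)
    (h1 : δ ≤ 1 / 2) (g : Gate n) (hg : ∀ i j, g = Gate.two i j → i < j) :
    (∀ s, 0 ≤ g.weight H δ s) ∧ (∀ s, g.weight H δ s ≤ 2) ∧
    (∀ s, g.weight H δ s ≠ 0 → δ * H.cMin ≤ g.weight H δ s) ∧ IsWindable (g.weight H δ) := by
  have hc0 := cMin_pos hH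
  have hc1 := cMin_le_one H
  have hcd : δ * H.cMin ≤ 1 / 2 := by nlinarith
  cases g with
  | one i =>
    have hd := abs_le.1 (abs_mul_le_half h0.le h1 (hH.2 i))
    have hnn : ∀ s, 0 ≤ (Gate.one i).weight H δ s := by
      intro s; rw [weight_one_eq]; split_ifs <;> linarith
    refine ⟨hnn, ?_, ?_, ?_⟩
    · intro s; rw [weight_one_eq]; split_ifs <;> linarith
    · intro s hs
      rw [weight_one_eq] at hs ⊢
      split_ifs at hs ⊢
      · linarith
      · linarith
      · exact absurd rfl hs
    · refine isWindable_of_card_le_two hnn (by simp [Gate.support]) fun x y hx hy hcard => ?_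
      rw [weight_one_eq] at hx hy
      have hx' : x (⟨i, by simp [Gate.support]⟩, false) = x (⟨i, by simp [Gate.support]⟩, true) := by
        by_contra h; simp [h] at hx
      have hy' : y (⟨i, by simp [Gate.support]⟩, false) = y (⟨i, by simp [Gate.support]⟩, true) := by
        by_contra h; simp [h] at hy
      obtain ⟨⟨⟨q, hq⟩, l⟩, hk⟩ := Finset.card_eq_one.1 hcard
      have hqi : q = i := by simpa [Gate.support] using hq
      subst hqi
      have hf : ((⟨q, hq⟩, false) : (Gate.one q).Leg) ∈ diffSet x y ↔
          ((⟨q, hq⟩, true) : (Gate.one q).Leg) ∈ diffSet x y := by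
        rw [mem_diffSet, mem_diffSet, hx', hy']
      rw [hk] at hf
      cases l <;> simp at hf
  | two i j =>
    have hij := hg i j rfl
    have hab := abs_le.1 (hH.1 i j hij).1
    have ha := (hH.1 i j hij).2
    have hp0 : 0 ≤ δ * (H.a i j + H.b i j) := mul_nonneg h0.le (by linarith)
    have hq0 : 0 ≤ δ * (H.a i j - H.b i j) := mul_nonneg h0.le (by linarith)
    have hp1 : δ * (H.a i j + H.b i j) ≤ 1 / 2 := by nlinarith
    have hq1 : δ * (H.a i j - H.b i j) ≤ 1 / 2 := by nlinarith
    refine ⟨?_, ?_, ?_, ?_⟩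
    · intro s; rw [weight_two_eq]; exact twoWeight_nonneg hp0 hq0 _ _ _ _
    · intro s; rw [weight_two_eq]; unfold twoWeight; split_ifs <;> linarith
    · intro s hs
      rw [weight_two_eq] at hs ⊢
      unfold twoWeight at hs ⊢
      split_ifs at hs ⊢
      · linarith
      · exact mul_le_mul_of_nonneg_left (cMin_le_add H hij (right_ne_zero_of_mul hs)) h0.le
      · exact mul_le_mul_of_nonneg_left (cMin_le_sub H hij (right_ne_zero_of_mul hs)) h0.le
      · exact absurd rfl hs
    · have hne : (⟨i, by simp [Gate.support]⟩ : (Gate.two i j).support) ≠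
          ⟨j, by simp [Gate.support]⟩ := fun h => hij.ne (Subtype.mk.inj h)
      have := isWindable_twoWeight hne (fun q => by
        obtain ⟨q, hq⟩ := q
        have hq' : q = i ∨ q = j := by simpa [Gate.support] using hq
        exact hq'.imp Subtype.ext Subtype.ext) hp0 hq0 (by nlinarith)
      have heq : (Gate.two i j).weight H δ = _ := funext fun s => weight_two_eq H δ i j s
      rw [heq]
      exact this

theorem weight_eq_prodWeight (H : Coeffs n) (δ : ℝ) (f : Config n L) :
    weight H δ f = prodWeight (fun m => (op m).weight H δ) f := rfl

theorem boxWeight_eq (H : Coeffs n) (δ : ℝ) (f : Config n L) (m : Fin (numOps n L)) :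
    boxWeight H δ f m = (op m).weight H δ fun k => f ⟨m, k⟩ := rfl

theorem op_weight_bounds {H : Coeffs n} (hH : H.IsStoquastic) {δ : ℝ} (h0 : 0 < δ)
    (h1 : δ ≤ 1 / 2) (m : Fin (numOps n L)) :
    (∀ s, 0 ≤ (op m).weight H δ s) ∧ (∀ s, (op m).weight H δ s ≤ 2) ∧
    (∀ s, (op m).weight H δ s ≠ 0 → δ * H.cMin ≤ (op m).weight H δ s) ∧
    IsWindable ((op m).weight H δ) :=
  gate_weight_bounds hH h0 h1 (op m) fun _ _ h => lt_of_op_eq_two h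

theorem flipLeg_eq_flipAt (k : Leg n L) (f : Config n L) : flipLeg k f = flipAt k f := by
  unfold flipLeg flipAt
  congr!

theorem card_gateLeg (g : Gate n) (hg : ∀ i j, g = Gate.two i j → i < j) :
    Fintype.card g.Leg = if g.isTwoQubit then 4 else 2 := by
  cases g with
  | one i => simp [Gate.support, Gate.isTwoQubit]
  | two i j =>
    rw [Fintype.card_prod, Fintype.card_coe]
    simp [Gate.support, Gate.isTwoQubit, Finset.card_pair (hg i j rfl).ne]

/-- Induction over the list of operators: a one-qubit box contributes two legs, a two-qubit box
four. Here `i < j` matters, since otherwise the support could be a single qubit. -/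
theorem card_leg : Fintype.card (Leg n L) = 2 * (numOne n L + 2 * numTwo n L) := by
  rw [Fintype.card_sigma]
  have h1 : ∀ m : Fin (numOps n L), Fintype.card (op m).Leg =
      if (op m).isTwoQubit then 4 else 2 := fun m =>
    card_gateLeg _ fun _ _ h => lt_of_op_eq_two h
  simp only [h1]
  have h2 : ∀ l : List (Gate n), ∑ m : Fin l.length, (if (l.get m).isTwoQubit then 4 else 2) =
      2 * ((l.countP fun g => !g.isTwoQubit) + 2 * l.countP fun g => g.isTwoQubit) := by
    intro l
    induction l with
    | nil => simp
    | cons g l ih =>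
      simp only [List.length_cons, Fin.sum_univ_succ, List.get_eq_getElem, Fin.val_zero,
        List.getElem_cons_zero, Fin.val_succ, List.getElem_cons_succ] at ih ⊢
      rw [ih, List.countP_cons, List.countP_cons]
      by_cases hg : g.isTwoQubit = true
      · simp [hg]; ring
      · simp [hg]; ring
  exact h2 (gates n L)

end BoxWeights

/-! ### The chain: detailed balance and positivity through odd intermediate configurations. -/

section Chain

variable {n L : ℕ} {H : Coeffs n} {δ : ℝ}

/-- The configurations that belong to the state space. -/
def IsState (H : Coeffs n) (δ : ℝ) (f : Config n L) : Prop :=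
  ((heads f).card = 0 ∨ (heads f).card = 2) ∧ weight H δ f ≠ 0

theorem State.isState (x : State H δ L) : IsState H δ x.1 := x.2

open Classical in
/-- The extension by zero of a function on the state space. -/
noncomputable def extendZero (f : State H δ L → ℝ) (c : Config n L) : ℝ :=
  if h : IsState H δ c then f ⟨c, h⟩ else 0

theorem extendZero_val (f : State H δ L → ℝ) (x : State H δ L) : extendZero f x.1 = f x := by
  rw [extendZero, dif_pos x.isState]
  rfl

theorem extendZero_of_not {f : State H δ L → ℝ} {c : Config n L} (h : ¬ IsState H δ c) :
    extendZero f c = 0 := by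
  rw [extendZero, dif_neg h]

open Classical in
theorem sum_state_eq (g : Config n L → ℝ) :
    ∑ x : State H δ L, g x.1 = ∑ c ∈ Finset.univ.filter (IsState H δ), g c := by
  refine Finset.sum_bij (fun x _ => x.1) (fun x _ => ?_) (fun x _ y _ h => Subtype.ext h)
    (fun c hc => ?_) (fun _ _ => rfl)
  · exact Finset.mem_filter.2 ⟨Finset.mem_univ _, x.isState⟩
  · exact ⟨⟨c, (Finset.mem_filter.1 hc).2⟩, Finset.mem_univ _, rfl⟩

theorem card_headSet_of_isState {c : Config n L} (h : IsState H δ c) :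
    (headSet partner c).card = 0 ∨ (headSet partner c).card = 4 := by
  have := card_headSet_partner c
  rcases h.1 with h | h <;> omega

theorem card_heads_eq_zero_iff (c : Config n L) :
    (heads c).card = 0 ↔ (headSet partner c).card = 0 := by
  have := card_headSet_partner c
  omega

theorem move_eq (m : Fin (numOps n L)) (k k' : (op m).Leg) (f : Config n L) :
    move m k k' f = flipAt ⟨m, k'⟩ (flipAt ⟨m, k⟩ f) := by
  rw [move, flipLeg_eq_flipAt, flipLeg_eq_flipAt]

theorem boxWeight_flipAt_ne {m m' : Fin (numOps n L)} (h : m' ≠ m) (k : (op m).Leg)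
    (f : Config n L) : boxWeight H δ (flipAt ⟨m, k⟩ f) m' = boxWeight H δ f m' := by
  rw [boxWeight_eq, boxWeight_eq]
  congr 1
  funext l
  exact flipAt_ne (fun h' => h (congrArg Sigma.fst h')) f

/-- The product of the weights of all boxes but one. -/
noncomputable def restWeight (H : Coeffs n) (δ : ℝ) (f : Config n L) (m : Fin (numOps n L)) : ℝ :=
  ∏ m' ∈ Finset.univ.erase m, boxWeight H δ f m'

theorem weight_eq_restWeight_mul (f : Config n L) (m : Fin (numOps n L)) :
    weight H δ f = restWeight H δ f m * boxWeight H δ f m :=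
  (Finset.prod_erase_mul _ _ (Finset.mem_univ m)).symm

theorem restWeight_flipAt (f : Config n L) (m : Fin (numOps n L)) (k : (op m).Leg) :
    restWeight H δ (flipAt ⟨m, k⟩ f) m = restWeight H δ f m :=
  Finset.prod_congr rfl fun _ hm' => boxWeight_flipAt_ne (Finset.ne_of_mem_erase hm') k f

theorem weight_flipAt (f : Config n L) (m : Fin (numOps n L)) (k : (op m).Leg) :
    weight H δ (flipAt ⟨m, k⟩ f)
      = restWeight H δ f m * boxWeight H δ (flipAt ⟨m, k⟩ f) m := by
  rw [weight_eq_restWeight_mul _ m, restWeight_flipAt]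

/-- A first flip is allowed exactly when it leaves a single line whose ends differ. This treats the
creation of heads and the motion of a head alike and lets the sum over states be reorganized by the
intermediate configuration. -/
theorem mem_startLegs_iff (hL : L ≠ 0) {c : Config n L} (hc : IsState H δ c) (k : Leg n L) :
    k ∈ startLegs c ↔ (headSet partner (flipAt k c)).card = 2 := by
  have h2 := card_headSet_partner c
  have h3 := fun h => card_headSet_flipAt_of_mem (k := k) (f := c) partner_involutive (partner_ne hL) h
  have h4 := fun h => card_headSet_flipAt_of_notMem (k := k) (f := c) partner_involutive
    (partner_ne hL) h
  unfold startLegs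
  rw [headLegs_eq]
  split_ifs with h0
  · simp only [Finset.mem_univ, true_iff]
    have h5 : headSet partner c = ∅ := by
      rw [← Finset.card_eq_zero]; omega
    have := h4 (by simp [h5])
    omega
  · have h5 : (headSet partner c).card = 4 := by
      rcases hc.1 with h | h
      · exact absurd h h0
      · omega
    constructor
    · intro h; have := h3 h; omega
    · intro h; by_contra h'; have := h4 h'; omega

theorem card_heads_flipAt_of_card_eq_two (hL : L ≠ 0) {c : Config n L}
    (hc : (headSet partner c).card = 2) (k : Leg n L) :
    (heads (flipAt k c)).card = 0 ∨ (heads (flipAt k c)).card = 2 := by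
  have h2 := card_headSet_partner (flipAt k c)
  by_cases h : k ∈ headSet partner c
  · have := card_headSet_flipAt_of_mem partner_involutive (partner_ne hL) h
    omega
  · have := card_headSet_flipAt_of_notMem partner_involutive (partner_ne hL) h
    omega

theorem isState_move_iff (hL : L ≠ 0) {c : Config n L} (hc : IsState H δ c) {k : Leg n L}
    (hk : k ∈ startLegs c) (k' : (op k.1).Leg) :
    IsState H δ (flipAt ⟨k.1, k'⟩ (flipAt k c)) ↔
      boxWeight H δ (flipAt ⟨k.1, k'⟩ (flipAt k c)) k.1 ≠ 0 := by
  have h1 := card_heads_flipAt_of_card_eq_two hL ((mem_startLegs_iff hL hc k).1 hk) ⟨k.1, k'⟩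
  have h2 : restWeight H δ (flipAt k c) k.1 ≠ 0 := by
    have := hc.2
    rw [weight_eq_restWeight_mul _ k.1] at this
    rw [restWeight_flipAt c k.1 k.2]
    exact left_ne_zero_of_mul this
  unfold IsState
  rw [weight_flipAt]
  constructor
  · rintro ⟨-, h⟩; exact right_ne_zero_of_mul h
  · intro h; exact ⟨h1, mul_ne_zero h2 h⟩

/-- Moves to configurations outside the state space contribute nothing, which is why extension by
zero may replace the sum over target states. -/
theorem mulVec_transition (f : State H δ L → ℝ) (x : State H δ L) :
    ((transition H δ L).mulVec f) x = ∑ k ∈ startLegs x.1, ((startLegs x.1).card : ℝ)⁻¹ *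
      ∑ k' : (op k.1).Leg, heatBath H δ x.1 k.1 k.2 k' * extendZero f (move k.1 k.2 k' x.1) := by
  classical
  have key : ∀ (c : Config n L) (h : ℝ),
      ∑ y : State H δ L, (if y.1 = c then h else 0) * f y = h * extendZero f c := by
    intro c h
    by_cases hc : IsState H δ c
    · refine (Finset.sum_eq_single (⟨c, hc⟩ : State H δ L) ?_ ?_).trans ?_
      rotate_left 2
      · rw [extendZero, dif_pos hc, if_pos rfl]
      · intro y _ hy
        rw [if_neg (fun h' => hy (Subtype.ext h')), zero_mul]
      · intro h'; exact absurd (Finset.mem_univ _) h'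
    · rw [extendZero_of_not hc, mul_zero]
      refine Finset.sum_eq_zero fun y _ => ?_
      rw [if_neg (fun h' => hc (by rw [← h']; exact y.isState)), zero_mul]
  simp only [Matrix.mulVec, dotProduct, transition, Finset.sum_mul]
  rw [Finset.sum_comm]
  refine Finset.sum_congr rfl fun k _ => ?_
  simp only [mul_assoc, ← Finset.mul_sum, Finset.sum_mul]
  congr 1
  rw [Finset.sum_comm]
  exact Finset.sum_congr rfl fun k' _ => key _ _

/-- The number of vertical lines. -/
noncomputable def numLines (n L : ℕ) : ℝ := (numOne n L : ℝ) + 2 * (numTwo n L : ℝ)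

theorem card_leg_eq : (Fintype.card (Leg n L) : ℝ) = 2 * numLines n L := by
  rw [card_leg, numLines]; push_cast; ring

/-- The reason for the factor 2/N in π: on 𝒞₀ there are 2N legs to choose from, on 𝒞₂ only four, and
(2/N)(1/4) = 1/(2N). -/
theorem unnormalized_mul_card_inv (x : State H δ L) :
    unnormalized H δ x * ((startLegs x.1).card : ℝ)⁻¹ = weight H δ x.1 / (2 * numLines n L) := by
  unfold unnormalized startLegs
  split_ifs with h
  · rw [Finset.card_univ, card_leg_eq]; rfl
  · rw [headLegs_eq]
    have h1 := (card_headSet_of_isState x.isState).resolve_left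
      (fun h' => h ((card_heads_eq_zero_iff _).2 h'))
    rw [h1, ← numLines]
    push_cast
    ring

/-- The total weight of the configurations that are reached from `ζ` by flipping a leg of `m`. -/
noncomputable def flipSum (H : Coeffs n) (δ : ℝ) (ζ : Config n L) (m : Fin (numOps n L)) : ℝ :=
  ∑ k : (op m).Leg, boxWeight H δ (flipAt ⟨m, k⟩ ζ) m

/-- Seen from the odd configuration ζ, the probability of k' does not depend on the leg k through
which ζ was reached; hence the symmetric factorization of the quadratic form. -/
theorem heatBath_flipAt (ζ : Config n L) (m : Fin (numOps n L)) (k k' : (op m).Leg) :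
    heatBath H δ (flipAt ⟨m, k⟩ ζ) m k k' =
      boxWeight H δ (flipAt ⟨m, k'⟩ ζ) m / flipSum H δ ζ m := by
  simp only [heatBath, move_eq, flipAt_flipAt, flipSum]

theorem heatBath_eq (f : Config n L) (m : Fin (numOps n L)) (k k' : (op m).Leg) :
    heatBath H δ f m k k' = boxWeight H δ (flipAt ⟨m, k'⟩ (flipAt ⟨m, k⟩ f)) m /
      flipSum H δ (flipAt ⟨m, k⟩ f) m := by
  rw [← heatBath_flipAt, flipAt_flipAt]

theorem boxWeight_nonneg (hH : H.IsStoquastic) (h0 : 0 < δ) (h1 : δ ≤ 1 / 2) (f : Config n L)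
    (m : Fin (numOps n L)) : 0 ≤ boxWeight H δ f m :=
  (op_weight_bounds hH h0 h1 m).1 _

theorem weight_nonneg (hH : H.IsStoquastic) (h0 : 0 < δ) (h1 : δ ≤ 1 / 2) (f : Config n L) :
    0 ≤ weight H δ f := Finset.prod_nonneg fun _ _ => boxWeight_nonneg hH h0 h1 _ _

theorem flipSum_nonneg (hH : H.IsStoquastic) (h0 : 0 < δ) (h1 : δ ≤ 1 / 2) (ζ : Config n L)
    (m : Fin (numOps n L)) : 0 ≤ flipSum H δ ζ m :=
  Finset.sum_nonneg fun _ _ => boxWeight_nonneg hH h0 h1 _ _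

theorem flipSum_le (hH : H.IsStoquastic) (h0 : 0 < δ) (h1 : δ ≤ 1 / 2) (ζ : Config n L)
    (m : Fin (numOps n L)) : flipSum H δ ζ m ≤ 8 := by
  have h2 : Fintype.card (op m).Leg ≤ 4 := by
    rw [card_gateLeg _ fun _ _ h => lt_of_op_eq_two h]; split_ifs <;> norm_num
  have h3 : flipSum H δ ζ m ≤ ∑ _k : (op m).Leg, (2 : ℝ) :=
    Finset.sum_le_sum fun k _ => (op_weight_bounds hH h0 h1 m).2.1 _
  rw [Finset.sum_const, Finset.card_univ, nsmul_eq_mul] at h3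
  have h4 : (Fintype.card (op m).Leg : ℝ) ≤ 4 := by exact_mod_cast h2
  linarith

/-- The quadratic form of the chain as a sum of squares over the odd boxes. -/
theorem sum_mul_mulVec_transition (hL : L ≠ 0) (f g : State H δ L → ℝ) :
    ∑ x, unnormalized H δ x * f x * ((transition H δ L).mulVec g) x =
      (1 / (2 * numLines n L)) * ∑ ζ : Config n L, ∑ m : Fin (numOps n L),
        if (headSet partner ζ).card = 2 then
          restWeight H δ ζ m / flipSum H δ ζ m *
            (∑ k : (op m).Leg, boxWeight H δ (flipAt ⟨m, k⟩ ζ) m * extendZero f (flipAt ⟨m, k⟩ ζ)) *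
            ∑ k : (op m).Leg, boxWeight H δ (flipAt ⟨m, k⟩ ζ) m * extendZero g (flipAt ⟨m, k⟩ ζ)
        else 0 := by
  classical
  set Φ : Leg n L → Config n L → ℝ := fun k c =>
    if (headSet partner (flipAt k c)).card = 2 then
      weight H δ c * extendZero f c * ∑ k' : (op k.1).Leg,
        heatBath H δ c k.1 k.2 k' * extendZero g (flipAt ⟨k.1, k'⟩ (flipAt k c)) else 0 with hΦ
  have h1 : ∀ x : State H δ L, unnormalized H δ x * f x * ((transition H δ L).mulVec g) x =
      (1 / (2 * numLines n L)) * ∑ k, Φ k x.1 := by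
    intro x
    rw [mulVec_transition, Finset.mul_sum, Finset.mul_sum, ← Finset.sum_filter_add_sum_filter_not
      Finset.univ (fun k => k ∈ startLegs x.1) (fun k => 1 / (2 * numLines n L) * Φ k x.1)]
    rw [Finset.sum_eq_zero (s := Finset.univ.filter fun k => ¬ k ∈ startLegs x.1), add_zero]
    · rw [Finset.filter_mem_eq_inter, Finset.univ_inter]
      refine Finset.sum_congr rfl fun k hk => ?_
      simp only [hΦ]
      rw [if_pos ((mem_startLegs_iff hL x.isState k).1 hk), extendZero_val]
      simp only [move_eq]
      have := unnormalized_mul_card_inv x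
      linear_combination (f x * ∑ k' : (op k.1).Leg, heatBath H δ x.1 k.1 k.2 k' *
        extendZero g (flipAt ⟨k.1, k'⟩ (flipAt k x.1))) * this
    · intro k hk
      rw [Finset.mem_filter] at hk
      simp only [hΦ]
      rw [if_neg (fun h => hk.2 ((mem_startLegs_iff hL x.isState k).2 h)), mul_zero]
  rw [Finset.sum_congr rfl fun x _ => h1 x, ← Finset.mul_sum]
  congr 1
  rw [sum_state_eq (fun c => ∑ k, Φ k c), Finset.sum_filter_of_ne]
  swap
  · intro c _ hc
    by_contra h
    apply hc
    refine Finset.sum_eq_zero fun k _ => ?_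
    simp only [hΦ]
    rw [extendZero_of_not h]
    simp
  rw [Finset.sum_comm]
  -- Flipping k is an involution, so the sum may run over the odd intermediate configuration instead
  -- of the starting configuration.
  have h2 : ∀ k : Leg n L, ∑ c, Φ k c = ∑ ζ, Φ k (flipAt k ζ) := fun k =>
    (Equiv.sum_comp (Function.Involutive.toPerm (flipAt k) (flipAt_flipAt k)) (Φ k)).symm
  rw [Finset.sum_congr rfl fun k _ => h2 k, Finset.sum_comm]
  refine Finset.sum_congr rfl fun ζ _ => ?_
  rw [Fintype.sum_sigma]
  refine Finset.sum_congr rfl fun m _ => ?_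
  simp only [hΦ, flipAt_flipAt]
  split_ifs with hζ
  · rw [mul_assoc, Finset.sum_mul, Finset.mul_sum]
    refine Finset.sum_congr rfl fun k _ => ?_
    simp only [heatBath_flipAt]
    rw [weight_flipAt, Finset.mul_sum, Finset.mul_sum, Finset.mul_sum]
    refine Finset.sum_congr rfl fun k' _ => ?_
    ring
  · simp

theorem form_symm (hL : L ≠ 0) (f g : State H δ L → ℝ) :
    ∑ x, unnormalized H δ x * f x * ((transition H δ L).mulVec g) x =
      ∑ x, unnormalized H δ x * g x * ((transition H δ L).mulVec f) x := by
  rw [sum_mul_mulVec_transition hL, sum_mul_mulVec_transition hL]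
  congr 1
  refine Finset.sum_congr rfl fun ζ _ => Finset.sum_congr rfl fun m _ => ?_
  split_ifs <;> ring

theorem form_nonneg (hH : H.IsStoquastic) (h0 : 0 < δ) (h1 : δ ≤ 1 / 2) (hL : L ≠ 0)
    (f : State H δ L → ℝ) :
    0 ≤ ∑ x, unnormalized H δ x * f x * ((transition H δ L).mulVec f) x := by
  rw [sum_mul_mulVec_transition hL]
  refine mul_nonneg (by unfold numLines; positivity) (Finset.sum_nonneg fun ζ _ =>
    Finset.sum_nonneg fun m _ => ?_)
  split_ifs
  · rw [mul_assoc]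
    refine mul_nonneg (div_nonneg (Finset.prod_nonneg fun _ _ => boxWeight_nonneg hH h0 h1 _ _)
      (flipSum_nonneg hH h0 h1 _ _)) (mul_self_nonneg _)
  · exact le_rfl

/-- The symmetry of the quadratic form, tested on two point masses. -/
theorem detailed_balance (hL : L ≠ 0) (x y : State H δ L) :
    unnormalized H δ x * transition H δ L x y = unnormalized H δ y * transition H δ L y x := by
  have h := form_symm hL (Pi.single x 1 : State H δ L → ℝ) (Pi.single y 1)
  have h1 : ∀ x y : State H δ L, ∑ z, unnormalized H δ z * (Pi.single x 1 : State H δ L → ℝ) z *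
      ((transition H δ L).mulVec (Pi.single y 1)) z
      = unnormalized H δ x * transition H δ L x y := by
    intro x y
    rw [Finset.sum_eq_single x]
    · simp
    · intro z _ hz; simp [Pi.single_eq_of_ne hz]
    · intro h; exact absurd (Finset.mem_univ _) h
  rwa [h1, h1] at h

theorem flipSum_pos (hH : H.IsStoquastic) (h0 : 0 < δ) (h1 : δ ≤ 1 / 2) {c : Config n L}
    (hc : weight H δ c ≠ 0) (k : Leg n L) : 0 < flipSum H δ (flipAt k c) k.1 := by
  have hpos : 0 < boxWeight H δ (flipAt k (flipAt k c)) k.1 := by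
    rw [flipAt_flipAt]
    exact lt_of_le_of_ne (boxWeight_nonneg hH h0 h1 _ _)
      (Finset.prod_ne_zero_iff.1 hc k.1 (Finset.mem_univ _)).symm
  exact lt_of_lt_of_le hpos (Finset.single_le_sum (f := fun k' : (op k.1).Leg =>
    boxWeight H δ (flipAt ⟨k.1, k'⟩ (flipAt k c)) k.1)
    (fun k' _ => boxWeight_nonneg hH h0 h1 _ _) (Finset.mem_univ k.2))

theorem startLegs_card_pos (hn : 1 ≤ n) (hL : L ≠ 0) {c : Config n L} (hc : IsState H δ c) :
    0 < (startLegs c).card := by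
  unfold startLegs
  split_ifs with h
  · obtain ⟨m, -, -, h1, -⟩ := exists_two_boxes hL (⟨0, hn⟩ : Fin n)
    exact Finset.card_pos.2 ⟨(⟨m, ⟨⟨_, h1⟩, true⟩⟩ : Leg n L), Finset.mem_univ _⟩
  · rw [headLegs_eq]
    have := (card_headSet_of_isState hc).resolve_left
      (fun h' => h ((card_heads_eq_zero_iff _).2 h'))
    omega

theorem transition_row_sum (hH : H.IsStoquastic) (h0 : 0 < δ) (h1 : δ ≤ 1 / 2) (hn : 1 ≤ n)
    (hL : L ≠ 0) (x : State H δ L) : ∑ y, transition H δ L x y = 1 := by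
  have h2 := mulVec_transition (fun _ => (1 : ℝ)) x
  simp only [Matrix.mulVec, dotProduct, mul_one] at h2
  rw [h2]
  have h3 : ∀ k ∈ startLegs x.1, ((startLegs x.1).card : ℝ)⁻¹ * ∑ k' : (op k.1).Leg,
      heatBath H δ x.1 k.1 k.2 k' * extendZero (fun _ : State H δ L => (1 : ℝ))
        (move k.1 k.2 k' x.1) = ((startLegs x.1).card : ℝ)⁻¹ := by
    intro k hk
    have h4 : ∀ k' : (op k.1).Leg, heatBath H δ x.1 k.1 k.2 k' *
        extendZero (fun _ : State H δ L => (1 : ℝ)) (move k.1 k.2 k' x.1)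
        = boxWeight H δ (flipAt ⟨k.1, k'⟩ (flipAt k x.1)) k.1 / flipSum H δ (flipAt k x.1) k.1 := by
      intro k'
      rw [move_eq, heatBath_eq]
      by_cases h5 : boxWeight H δ (flipAt ⟨k.1, k'⟩ (flipAt k x.1)) k.1 = 0
      · simp [h5]
      · rw [extendZero, dif_pos ((isState_move_iff hL x.isState hk k').2 h5), mul_one]
    simp only [h4]
    rw [← Finset.sum_div]
    change _ * (flipSum H δ (flipAt k x.1) k.1 / _) = _
    rw [div_self (flipSum_pos hH h0 h1 x.isState.2 k).ne', mul_one]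
  rw [Finset.sum_congr rfl h3, Finset.sum_const, nsmul_eq_mul]
  exact mul_inv_cancel₀ (by exact_mod_cast (startLegs_card_pos hn hL x.isState).ne')

end Chain

/-! ### The Poincaré inequality and the mixing time in terms of κ. -/

section Poincare

variable {n L : ℕ} {H : Coeffs n} {δ : ℝ}

/-- The weights of the boxes of the diagram. -/
noncomputable abbrev opWeight (H : Coeffs n) (δ : ℝ) (L : ℕ) (m : Fin (numOps n L)) :
    ((op m).Leg → Fin 2) → ℝ := (op m).weight H δ

/-- The total weight of the configurations without worm heads. -/
noncomputable def weightZero (H : Coeffs n) (δ : ℝ) (L : ℕ) : ℝ :=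
  ∑ z ∈ headFree (partner (n := n) (L := L)), weight H δ z

/-- The total weight of the configurations with two worm heads. -/
noncomputable def weightTwo (H : Coeffs n) (δ : ℝ) (L : ℕ) : ℝ :=
  ∑ z ∈ twoHeaded (partner (n := n) (L := L)), weight H δ z

theorem mem_headFree_iff_card (c : Config n L) :
    c ∈ headFree partner ↔ (heads c).card = 0 := by
  rw [mem_headFree, card_heads_eq_zero_iff, Finset.card_eq_zero]

theorem mem_twoHeaded_iff_card (c : Config n L) :
    c ∈ twoHeaded partner ↔ (heads c).card = 2 := by
  rw [mem_twoHeaded, card_headSet_partner]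
  omega

theorem sum_unnormalized_mul (g : Config n L → ℝ) :
    ∑ x : State H δ L, unnormalized H δ x * g x.1 =
      ∑ z ∈ headFree partner, weight H δ z * g z +
        2 / numLines n L * ∑ z ∈ twoHeaded partner, weight H δ z * g z := by
  classical
  have h1 : ∀ x : State H δ L, unnormalized H δ x * g x.1 =
      (if x.1 ∈ headFree partner then weight H δ x.1 * g x.1 else 0) +
        if x.1 ∈ twoHeaded partner then 2 / numLines n L * (weight H δ x.1 * g x.1) else 0 := by
    intro x
    simp only [mem_headFree_iff_card, mem_twoHeaded_iff_card]
    rw [unnormalized, ← numLines]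
    rcases x.isState.1 with h | h
    · simp [h]
    · simp [h]; ring
  rw [Finset.sum_congr rfl fun x _ => h1 x, sum_state_eq (fun c : Config n L =>
    (if c ∈ headFree partner then weight H δ c * g c else 0) +
        if c ∈ twoHeaded partner then 2 / numLines n L * (weight H δ c * g c) else 0),
    Finset.sum_filter_of_ne, Finset.sum_add_distrib, Finset.sum_ite_mem, Finset.sum_ite_mem,
    Finset.univ_inter, Finset.univ_inter, Finset.mul_sum]
  intro c _ hc
  by_contra h
  apply hc
  by_cases hw : weight H δ c = 0
  · simp [hw]
  · have h2 : ¬ ((heads c).card = 0 ∨ (heads c).card = 2) := fun h' => h ⟨h', hw⟩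
    rw [not_or] at h2
    rw [if_neg (by rw [mem_headFree_iff_card]; exact h2.1),
      if_neg (by rw [mem_twoHeaded_iff_card]; exact h2.2), add_zero]

/-- The Dirichlet form of the chain, not normalized. -/
noncomputable def dirichlet (f : State H δ L → ℝ) : ℝ :=
  ∑ x, unnormalized H δ x * f x ^ 2 -
    ∑ x, unnormalized H δ x * f x * ((transition H δ L).mulVec f) x

theorem dirichlet_eq (hH : H.IsStoquastic) (h0 : 0 < δ) (h1 : δ ≤ 1 / 2) (hn : 1 ≤ n)
    (hL : L ≠ 0) (f : State H δ L → ℝ) : dirichlet f =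
    (∑ x, unnormalized H δ x * ∑ y, transition H δ L x y * (f x - f y) ^ 2) / 2 := by
  have h2 : ∑ x, ∑ y, unnormalized H δ x * transition H δ L x y * f x ^ 2
      = ∑ x, unnormalized H δ x * f x ^ 2 := by
    refine Finset.sum_congr rfl fun x _ => ?_
    rw [← Finset.sum_mul, ← Finset.mul_sum, transition_row_sum hH h0 h1 hn hL, mul_one]
  have h3 : ∑ x, ∑ y, unnormalized H δ x * transition H δ L x y * f y ^ 2
      = ∑ x, unnormalized H δ x * f x ^ 2 := by
    rw [Finset.sum_comm, ← h2]
    refine Finset.sum_congr rfl fun x _ => Finset.sum_congr rfl fun y _ => ?_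
    rw [detailed_balance hL]
  have h4 : ∑ x, ∑ y, unnormalized H δ x * transition H δ L x y * (f x * f y)
      = ∑ x, unnormalized H δ x * f x * ((transition H δ L).mulVec f) x := by
    refine Finset.sum_congr rfl fun x _ => ?_
    rw [Matrix.mulVec, dotProduct, Finset.mul_sum]
    refine Finset.sum_congr rfl fun y _ => ?_
    ring
  have h5 : ∑ x, unnormalized H δ x * ∑ y, transition H δ L x y * (f x - f y) ^ 2 =
      ∑ x, ∑ y, unnormalized H δ x * transition H δ L x y * f x ^ 2 +
      ∑ x, ∑ y, unnormalized H δ x * transition H δ L x y * f y ^ 2 -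
      2 * ∑ x, ∑ y, unnormalized H δ x * transition H δ L x y * (f x * f y) := by
    simp only [Finset.mul_sum, ← Finset.sum_add_distrib, ← Finset.sum_sub_distrib]
    refine Finset.sum_congr rfl fun x _ => Finset.sum_congr rfl fun y _ => ?_
    ring
  rw [h5, h2, h3, h4, dirichlet]
  ring

theorem unnormalized_pos (hH : H.IsStoquastic) (h0 : 0 < δ) (h1 : δ ≤ 1 / 2)
    (hN : 0 < numLines n L) (x : State H δ L) : 0 < unnormalized H δ x := by
  have h2 : 0 < weight H δ x.1 := lt_of_le_of_ne (weight_nonneg hH h0 h1 _) x.isState.2.symm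
  unfold unnormalized
  rw [← numLines]
  split_ifs
  · exact h2
  · positivity

/-- A start leg on 𝒞₂ is chosen with probability 1/4. A possible exit has weight at least δ c_min,
while the normalization of the heat bath is at most 8, being a sum of at most four weights bounded
by 2; this gives 4 · 8 = 32. -/
theorem moveEnergy_le (hH : H.IsStoquastic) (h0 : 0 < δ) (h1 : δ ≤ 1 / 2) (hL : L ≠ 0)
    (f : State H δ L → ℝ) (x : State H δ L) (hx : x.1 ∈ twoHeaded partner) :
    δ * H.cMin / 32 * moveEnergy (opWeight H δ L) partner (extendZero f) x.1 ≤
      ∑ y, transition H δ L x y * (f x - f y) ^ 2 := by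
  have h2 := mulVec_transition (fun y => (f x - f y) ^ 2) x
  rw [Matrix.mulVec, dotProduct] at h2
  rw [h2]
  have h3 : startLegs x.1 = headSet partner x.1 := by
    rw [startLegs, if_neg, headLegs_eq]
    rw [(mem_twoHeaded_iff_card _).1 hx]; norm_num
  have h4 : (headSet partner x.1).card = 4 := mem_twoHeaded.1 hx
  rw [moveEnergy, Finset.mul_sum, h3]
  refine Finset.sum_le_sum fun k hk => ?_
  rw [h4, Finset.mul_sum, Finset.mul_sum]
  refine Finset.sum_le_sum fun k' _ => ?_
  rw [move_eq, heatBath_eq]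
  have hfp := flipSum_pos hH h0 h1 x.isState.2 k
  have hfl := flipSum_le hH h0 h1 (flipAt k x.1) k.1
  have hbn := boxWeight_nonneg hH h0 h1 (flipAt ⟨k.1, k'⟩ (flipAt k x.1)) k.1
  have hext : 0 ≤ extendZero (fun y => (f x - f y) ^ 2) (flipAt ⟨k.1, k'⟩ (flipAt k x.1)) := by
    unfold extendZero; split_ifs
    · exact sq_nonneg _
    · exact le_rfl
  split_ifs with h5
  · rw [← weight_eq_prodWeight] at h5
    have h6 : boxWeight H δ (flipAt ⟨k.1, k'⟩ (flipAt k x.1)) k.1 ≠ 0 :=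
      Finset.prod_ne_zero_iff.1 h5 k.1 (Finset.mem_univ _)
    have h7 := (isState_move_iff hL x.isState (h3 ▸ hk) k').2 h6
    have h8 : δ * H.cMin ≤ boxWeight H δ (flipAt ⟨k.1, k'⟩ (flipAt k x.1)) k.1 :=
      (op_weight_bounds hH h0 h1 k.1).2.2.1 _ h6
    have h9 : extendZero (fun y => (f x - f y) ^ 2) (flipAt ⟨k.1, k'⟩ (flipAt k x.1))
        = (extendZero f x.1 - extendZero f (flipAt ⟨k.1, k'⟩ (flipAt k x.1))) ^ 2 := by
      rw [extendZero_val, extendZero, dif_pos h7, extendZero, dif_pos h7]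
    rw [h9, ← mul_assoc]
    refine mul_le_mul_of_nonneg_right ?_ (sq_nonneg _)
    have h10 : δ * H.cMin / 8 ≤ boxWeight H δ (flipAt ⟨k.1, k'⟩ (flipAt k x.1)) k.1 /
        flipSum H δ (flipAt k x.1) k.1 := by
      rw [div_le_div_iff₀ (by norm_num) hfp]
      nlinarith [mul_pos h0 (cMin_pos hH)]
    push_cast
    change _ ≤ (4 : ℝ)⁻¹ * (_ / flipSum H δ (flipAt k x.1) k.1)
    linarith
  · rw [mul_zero]
    exact mul_nonneg (by positivity) (mul_nonneg (div_nonneg hbn hfp.le) hext)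

/-- Only transitions out of 𝒞₂ are counted. Their stationary weight carries the factor 2/N, which
produces the N on the right. -/
theorem sum_moveEnergy_le (hH : H.IsStoquastic) (h0 : 0 < δ) (h1 : δ ≤ 1 / 2) (hn : 1 ≤ n)
    (hL : L ≠ 0) (hN : 0 < numLines n L) (f : State H δ L → ℝ) :
    δ * H.cMin / 32 * ∑ z ∈ twoHeaded partner, weight H δ z *
      moveEnergy (opWeight H δ L) partner (extendZero f) z ≤ numLines n L * dirichlet f := by
  classical
  have h2 := sum_unnormalized_mul (H := H) (δ := δ) (L := L) (fun z =>
    if z ∈ twoHeaded partner then moveEnergy (opWeight H δ L) partner (extendZero f) z else 0)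
  have hz0 : ∑ z ∈ headFree partner, weight H δ z * (if z ∈ twoHeaded partner then
      moveEnergy (opWeight H δ L) partner (extendZero f) z else 0) = 0 := by
    refine Finset.sum_eq_zero fun z hz => ?_
    rw [if_neg, mul_zero]
    rw [mem_headFree_iff_card] at hz
    rw [mem_twoHeaded_iff_card, hz]; norm_num
  have hz2 : ∑ z ∈ twoHeaded partner, weight H δ z * (if z ∈ twoHeaded partner then
      moveEnergy (opWeight H δ L) partner (extendZero f) z else 0) =
      ∑ z ∈ twoHeaded partner, weight H δ z *
        moveEnergy (opWeight H δ L) partner (extendZero f) z :=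
    Finset.sum_congr rfl fun z hz => by rw [if_pos hz]
  rw [hz0, zero_add, hz2] at h2
  have h3 : δ * H.cMin / 32 * ∑ x : State H δ L, unnormalized H δ x *
      (if x.1 ∈ twoHeaded partner then moveEnergy (opWeight H δ L) partner (extendZero f) x.1
        else 0) ≤ 2 * dirichlet f := by
    rw [dirichlet_eq hH h0 h1 hn hL, mul_div_cancel₀ _ (two_ne_zero), Finset.mul_sum]
    refine Finset.sum_le_sum fun x _ => ?_
    rw [mul_left_comm]
    refine mul_le_mul_of_nonneg_left ?_ (unnormalized_pos hH h0 h1 hN x).le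
    split_ifs with hx
    · exact moveEnergy_le hH h0 h1 hL f x hx
    · rw [mul_zero]
      have h4 := mulVec_transition (fun y => (f x - f y) ^ 2) x
      rw [Matrix.mulVec, dotProduct] at h4
      rw [h4]
      refine Finset.sum_nonneg fun k hk => mul_nonneg (by positivity) (Finset.sum_nonneg
        fun k' _ => mul_nonneg ?_ ?_)
      · rw [heatBath_eq]
        exact div_nonneg (boxWeight_nonneg hH h0 h1 _ _) (flipSum_nonneg hH h0 h1 _ _)
      · unfold extendZero; split_ifs
        · exact sq_nonneg _
        · exact le_rfl
  rw [h2] at h3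
  have h5 : numLines n L * (2 / numLines n L) = 2 := by field_simp
  have h6 := mul_le_mul_of_nonneg_left h3 hN.le
  have h7 : ∀ a b : ℝ, numLines n L * (a * (2 / numLines n L * b)) = 2 * (a * b) := by
    intro a b; linear_combination (a * b) * h5
  rw [h7] at h6
  linarith

/-- The heads form a two-element set of lines, so there are at most N² positions, each contributing
at most κ times the weight without heads. -/
theorem sum_weight_twoHeaded_le {κ : ℝ}
    (hκ : ∀ z ∈ twoHeaded (partner (n := n) (L := L)),
      ∑ z' ∈ Finset.univ.filter (fun z' => heads z' = heads z),
      weight H δ z' ≤ κ * weightZero H δ L) (hk0 : 0 ≤ κ * weightZero H δ L) :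
    weightTwo H δ L ≤ numLines n L ^ 2 * (κ * weightZero H δ L) := by
  classical
  set lower : Finset (Leg n L) := Finset.univ.filter fun k => k.2.2 = true
  have hlow : (lower.card : ℝ) = numLines n L := by
    have h1 : (Finset.univ.filter fun k : Leg n L => ¬ k.2.2 = true).card = lower.card := by
      refine Finset.card_bij (fun k _ => partner k) ?_ ?_ ?_
      · intro k hk
        simp only [lower, Finset.mem_filter, Finset.mem_univ, true_and] at hk ⊢
        rw [partner_snd]; simpa using hk
      · intro a _ b _ h; exact partner_involutive.injective h
      · intro b hb
        simp only [lower, Finset.mem_filter, Finset.mem_univ, true_and] at hb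
        refine ⟨partner b, ?_, partner_involutive b⟩
        simp only [Finset.mem_filter, Finset.mem_univ, true_and]
        rw [partner_snd, hb]; simp
    have h2 := Finset.card_filter_add_card_filter_not (s := (Finset.univ : Finset (Leg n L)))
      (fun k => k.2.2 = true)
    rw [h1, Finset.card_univ] at h2
    have h3 := card_leg_eq (n := n) (L := L)
    rw [← h2] at h3
    push_cast at h3
    linarith
  have hmaps : ∀ z ∈ twoHeaded (partner (n := n) (L := L)), heads z ∈ lower.powersetCard 2 := by
    intro z hz
    rw [Finset.mem_powersetCard]
    refine ⟨?_, (mem_twoHeaded_iff_card z).1 hz⟩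
    rw [heads_eq]
    intro k hk
    simp only [lower, Finset.mem_filter, Finset.mem_univ, true_and] at hk ⊢
    exact hk.2
  rw [weightTwo, ← Finset.sum_fiberwise_of_maps_to hmaps]
  have hterm : ∀ S ∈ lower.powersetCard 2, ∑ z ∈ (twoHeaded partner).filter (fun z => heads z = S),
      weight H δ z ≤ κ * weightZero H δ L := by
    intro S hS
    by_cases hne : ((twoHeaded (partner (n := n) (L := L))).filter fun z => heads z = S).Nonempty
    · obtain ⟨z, hz⟩ := hne
      rw [Finset.mem_filter] at hz
      refine le_trans (le_of_eq ?_) (hκ z hz.1)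
      refine Finset.sum_congr ?_ fun _ _ => rfl
      ext z'
      simp only [Finset.mem_filter, Finset.mem_univ, true_and, hz.2]
      constructor
      · exact fun h => h.2
      · intro h
        refine ⟨?_, h⟩
        rw [mem_twoHeaded_iff_card, h]
        exact (Finset.mem_powersetCard.1 hS).2
    · rw [Finset.not_nonempty_iff_eq_empty] at hne
      rw [hne, Finset.sum_empty]; exact hk0
  refine (Finset.sum_le_sum hterm).trans ?_
  rw [Finset.sum_const, nsmul_eq_mul, Finset.card_powersetCard]
  refine mul_le_mul_of_nonneg_right ?_ hk0
  rw [← hlow]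
  exact_mod_cast Nat.choose_le_pow lower.card 2

/-- Elimination of V0 from the second flow bound. The constant is 26 = 2 + 8 + 8 + 8, after each of
the four terms is estimated by a multiple of (N κ)². -/
theorem add_le_of_flow_bounds {Z0 Z2 V0 V2 G κ N : ℝ} (hZ : 0 < Z0) (hκ1 : 1 ≤ κ) (hN : 1 ≤ N)
    (hG0 : 0 ≤ G) (hV0n : 0 ≤ V0) (hZ2le : Z2 ≤ N ^ 2 * (κ * Z0))
    (hA : 2 * Z0 * V0 ≤ 2 * (2 * N) * (κ * Z0) * G)
    (hB : Z0 * V2 ≤ 2 * (2 * N) * (Z0 + Z2) * G + 2 * Z2 * V0) :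
    V0 + 2 / N * V2 ≤ 26 * κ ^ 2 * N ^ 2 * G := by
  have hN0 : 0 < N := by linarith
  have hV0le : V0 ≤ 2 * N * κ * G := by
    refine le_of_mul_le_mul_left ?_ hZ
    linarith
  have hV2le : V2 ≤ 4 * N * (1 + N ^ 2 * κ) * G + 2 * (N ^ 2 * κ) * (2 * N * κ * G) := by
    refine le_of_mul_le_mul_left ?_ hZ
    refine hB.trans ?_
    have e1 : 2 * (2 * N) * (Z0 + Z2) * G ≤ 2 * (2 * N) * (Z0 + N ^ 2 * (κ * Z0)) * G := by
      gcongr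
    have e2 : 2 * Z2 * V0 ≤ 2 * (N ^ 2 * (κ * Z0)) * (2 * N * κ * G) := by
      gcongr
    refine (add_le_add e1 e2).trans (le_of_eq (by ring))
  have e1 : 2 / N * V2 ≤ (8 * (1 + N ^ 2 * κ) + 8 * N ^ 2 * κ ^ 2) * G := by
    rw [div_mul_eq_mul_div, div_le_iff₀ hN0]
    linarith
  have e2 : 2 * N * κ + (8 * (1 + N ^ 2 * κ) + 8 * N ^ 2 * κ ^ 2) ≤ 26 * κ ^ 2 * N ^ 2 := by
    have a0 : 1 ≤ N * κ := by nlinarith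
    have a1 : N * κ ≤ (N * κ) ^ 2 := by nlinarith
    have a2 : 1 ≤ (N * κ) ^ 2 := one_le_pow₀ a0
    have a3 : N ^ 2 * κ ≤ (N * κ) ^ 2 := by
      rw [mul_pow]; exact mul_le_mul_of_nonneg_left (by nlinarith) (by positivity)
    rw [mul_pow] at *
    linarith
  have e3 := mul_le_mul_of_nonneg_right e2 hG0
  linarith

/-- The Poincaré inequality for the chain, not normalized. -/
theorem sum_sq_le_dirichlet (hH : H.IsStoquastic) (h0 : 0 < δ) (h1 : δ ≤ 1 / 2) (hn : 1 ≤ n)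
    (hL : L ≠ 0) (hN : 1 ≤ numLines n L) {κ : ℝ} (hκ1 : 1 ≤ κ) (hZ : 0 < weightZero H δ L)
    (hκ : ∀ z ∈ twoHeaded (partner (n := n) (L := L)),
      ∑ z' ∈ Finset.univ.filter (fun z' => heads z' = heads z),
      weight H δ z' ≤ κ * weightZero H δ L) (f : State H δ L → ℝ) :
    ∃ c : ℝ, ∑ x, unnormalized H δ x * (f x - c) ^ 2 ≤
      832 * κ ^ 2 * numLines n L ^ 3 / (δ * H.cMin) * dirichlet f := by
  classical
  set N := numLines n L with hNdef
  set F := extendZero f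
  set Z0 := weightZero H δ L with hZ0
  set Z2 := weightTwo H δ L with hZ2
  set G := ∑ z ∈ twoHeaded partner, weight H δ z *
      moveEnergy (opWeight H δ L) partner (extendZero f) z with hG
  have hw : ∀ m s, 0 ≤ opWeight H δ L m s := fun m => (op_weight_bounds hH h0 h1 m).1
  have hwind : ∀ m, IsWindable (opWeight H δ L m) := fun m =>
    (op_weight_bounds hH h0 h1 m).2.2.2
  have hA := sum_headFree_le (F := F) partner_involutive (partner_fst_ne hL) hw hwind
    (Q := κ * Z0) (fun z hz => by
      refine le_trans (le_of_eq ?_) (hκ z hz)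
      refine Finset.sum_congr ?_ fun _ _ => rfl
      ext z'
      simp only [Finset.mem_filter, Finset.mem_univ, true_and]
      exact headSet_eq_iff_heads_eq z' z)
  -- The mean over 𝒞₀ only; the variance on the whole space is at most the second moment about any
  -- constant, so this choice is free.
  set c := (∑ z ∈ headFree partner, weight H δ z * F z) / Z0 with hc
  have hB := sum_twoHeaded_le (F := F) (w := opWeight H δ L) partner_involutive
    (partner_fst_ne hL) hwind c
  simp only [← weight_eq_prodWeight, card_leg_eq] at hA hB
  set V0 := ∑ z ∈ headFree partner, weight H δ z * (F z - c) ^ 2 with hV0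
  set V2 := ∑ z ∈ twoHeaded partner, weight H δ z * (F z - c) ^ 2 with hV2
  have hcz : ∑ z ∈ headFree partner, weight H δ z * F z = c * Z0 := by
    rw [hc]; field_simp
  -- Since c is the mean on 𝒞₀, the cross terms cancel and the double sum is twice the total weight
  -- times the variance.
  have hA' : ∑ x ∈ headFree partner, ∑ y ∈ headFree partner, weight H δ x * weight H δ y *
      (F x - F y) ^ 2 = 2 * Z0 * V0 := by
    have e1 : ∀ x y : Config n L, weight H δ x * weight H δ y * (F x - F y) ^ 2 =
        weight H δ x * (F x - c) ^ 2 * weight H δ y + weight H δ x * (weight H δ y * (F y - c) ^ 2)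
        - 2 * ((weight H δ x * (F x - c)) * (weight H δ y * (F y - c))) := by
      intro x y; ring
    simp only [e1, Finset.sum_add_distrib, Finset.sum_sub_distrib, ← Finset.mul_sum,
      ← Finset.sum_mul]
    have e2 : ∑ z ∈ headFree (partner (n := n) (L := L)), weight H δ z * (F z - c) = 0 := by
      simp only [mul_sub, Finset.sum_sub_distrib, ← Finset.sum_mul]
      rw [hcz, ← weightZero, ← hZ0]; ring
    rw [e2, ← weightZero, ← hZ0, ← hV0]; ring
  have hB' : ∑ x ∈ twoHeaded (partner (n := n) (L := L)), ∑ y ∈ headFree (partner (n := n) (L := L)),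
      weight H δ x * weight H δ y * (F x - c) ^ 2 = Z0 * V2 := by
    have e1 : ∀ x y : Config n L, weight H δ x * weight H δ y * (F x - c) ^ 2 =
        weight H δ x * (F x - c) ^ 2 * weight H δ y := by intro x y; ring
    simp only [e1, ← Finset.mul_sum, ← Finset.sum_mul]
    rw [← weightZero, ← hZ0, ← hV2]; ring
  rw [hA'] at hA
  rw [hB'] at hB
  change Z0 * V2 ≤ 2 * (2 * N) * (Z0 + Z2) * G + 2 * Z2 * V0 at hB
  change 2 * Z0 * V0 ≤ 2 * (2 * N) * (κ * Z0) * G at hA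
  have hN0 : 0 < N := by linarith
  have hG0 : 0 ≤ G := Finset.sum_nonneg fun z _ =>
    mul_nonneg (weight_nonneg hH h0 h1 z) (moveEnergy_nonneg z)
  have hZ2le : Z2 ≤ N ^ 2 * (κ * Z0) := sum_weight_twoHeaded_le hκ (by positivity)
  have hV0n : 0 ≤ V0 := Finset.sum_nonneg fun z _ =>
    mul_nonneg (weight_nonneg hH h0 h1 z) (sq_nonneg _)
  refine ⟨c, ?_⟩
  have hsum := sum_unnormalized_mul (H := H) (δ := δ) (L := L) (fun z => (F z - c) ^ 2)
  have hsum' : ∑ x : State H δ L, unnormalized H δ x * (f x - c) ^ 2 = V0 + 2 / N * V2 := by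
    rw [← hsum]
    exact Finset.sum_congr rfl fun x _ => by rw [show F x.1 = f x from extendZero_val f x]
  rw [hsum']
  have hE : G ≤ 32 * N / (δ * H.cMin) * dirichlet f := by
    have := sum_moveEnergy_le hH h0 h1 hn hL hN0 f
    have hdc : 0 < δ * H.cMin := mul_pos h0 (cMin_pos hH)
    rw [div_mul_eq_mul_div, le_div_iff₀ hdc]
    linarith
  -- The constants combine to 832 = 26 · 32, and N² from the flow with N from the energy to N³.
  have hfin : V0 + 2 / N * V2 ≤ 26 * κ ^ 2 * N ^ 2 * G :=
    add_le_of_flow_bounds hZ hκ1 hN hG0 hV0n hZ2le hA hB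
  refine hfin.trans ((mul_le_mul_of_nonneg_left hE (by positivity)).trans (le_of_eq ?_))
  ring

theorem sum_unnormalized_eq : ∑ x : State H δ L, unnormalized H δ x =
    weightZero H δ L + 2 / numLines n L * weightTwo H δ L := by
  have := sum_unnormalized_mul (H := H) (δ := δ) (L := L) (fun _ => 1)
  simpa [weightZero, weightTwo] using this

theorem sum_unnormalized_le (hN : 0 < numLines n L) {κ : ℝ}
    (hk0 : 0 ≤ κ * weightZero H δ L)
    (hκ : ∀ z ∈ twoHeaded (partner (n := n) (L := L)),
      ∑ z' ∈ Finset.univ.filter (fun z' => heads z' = heads z),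
      weight H δ z' ≤ κ * weightZero H δ L) :
    ∑ x : State H δ L, unnormalized H δ x ≤ (1 + 2 * κ * numLines n L) * weightZero H δ L := by
  rw [sum_unnormalized_eq]
  have h1 := sum_weight_twoHeaded_le hκ hk0
  have h2 := mul_le_mul_of_nonneg_left h1 (div_nonneg zero_le_two hN.le)
  have h3 : 2 / numLines n L * (numLines n L ^ 2 * (κ * weightZero H δ L))
      = 2 * κ * numLines n L * weightZero H δ L := by field_simp
  linarith

/-- The mixing time of the chain in terms of the ratio `κ` of partition functions. -/
theorem exists_mixingTime_le (hH : H.IsStoquastic) (h0 : 0 < δ) (h1 : δ ≤ 1 / 2) (hn : 1 ≤ n)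
    (hL : L ≠ 0) (hN : 1 ≤ numLines n L) {κ : ℝ} (hκ1 : 1 ≤ κ) (hZ : 0 < weightZero H δ L)
    (hκ : ∀ z ∈ twoHeaded (partner (n := n) (L := L)),
      ∑ z' ∈ Finset.univ.filter (fun z' => heads z' = heads z),
      weight H δ z' ≤ κ * weightZero H δ L)
    (x : State H δ L) (hx : (heads x.1).card = 0) {η : ℝ} (hη : 0 < η) (hη1 : η < 1) :
    ∃ t : ℕ, IsMixingTime (transition H δ L) (stationary H δ) x η t ∧
      (t : ℝ) ≤ 832 * κ ^ 2 * numLines n L ^ 3 / (δ * H.cMin) *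
        (Real.log ((1 + 2 * κ * numLines n L) * weightZero H δ L / weight H δ x.1) +
          2 * Real.log (1 / η)) + 1 := by
  have hN0 : 0 < numLines n L := by linarith
  have hu := unnormalized_pos (L := L) hH h0 h1 hN0
  set U := ∑ y : State H δ L, unnormalized H δ y with hU
  have hU0 : 0 < U := Finset.sum_pos (fun y _ => hu y) ⟨x, Finset.mem_univ _⟩
  have hst : ∀ y : State H δ L, stationary H δ y = unnormalized H δ y / U := fun _ => rfl
  have hdc : 0 < δ * H.cMin := mul_pos h0 (cMin_pos hH)
  have hR : 1 ≤ 832 * κ ^ 2 * numLines n L ^ 3 / (δ * H.cMin) := by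
    rw [le_div_iff₀ hdc]
    have a1 : 1 ≤ κ ^ 2 := one_le_pow₀ hκ1
    have a2 : 1 ≤ numLines n L ^ 3 := one_le_pow₀ hN
    have a3 : δ * H.cMin ≤ 1 := by nlinarith [cMin_pos hH, cMin_le_one H]
    nlinarith
  have hform : ∀ f g : State H δ L → ℝ, ∑ y, stationary H δ y * f y * g y
      = (∑ y, unnormalized H δ y * f y * g y) / U := by
    intro f g
    rw [Finset.sum_div]
    exact Finset.sum_congr rfl fun y _ => by rw [hst]; ring
  have hsq : ∀ f : State H δ L → ℝ, ∑ y, stationary H δ y * f y ^ 2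
      = (∑ y, unnormalized H δ y * f y ^ 2) / U := by
    intro f
    rw [Finset.sum_div]
    exact Finset.sum_congr rfl fun y _ => by rw [hst]; ring
  obtain ⟨t, ht, hle⟩ := exists_isMixingTime_le (P := transition H δ L) (π := stationary H δ)
    (fun y => div_pos (hu y) hU0)
    (by simp only [hst]; rw [← Finset.sum_div]; exact div_self hU0.ne')
    (fun y z => by
      rw [hst, hst, div_mul_eq_mul_div, div_mul_eq_mul_div, detailed_balance hL])
    (transition_row_sum hH h0 h1 hn hL)
    (fun f => by rw [hform]; exact div_nonneg (form_nonneg hH h0 h1 hL f) hU0.le) hR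
    (fun f hf => by
      obtain ⟨c, hc⟩ := sum_sq_le_dirichlet hH h0 h1 hn hL hN hκ1 hZ hκ f
      rw [hform, hsq, ← sub_div, ← mul_div_assoc]
      refine div_le_div_of_nonneg_right (le_trans ?_ hc) hU0.le
      have hf' : ∑ y, unnormalized H δ y * f y = 0 := by
        have : ∑ y, stationary H δ y * f y = (∑ y, unnormalized H δ y * f y) / U := by
          rw [Finset.sum_div]
          exact Finset.sum_congr rfl fun y _ => by rw [hst]; ring
        rw [this] at hf
        exact (div_eq_zero_iff.1 hf).resolve_right hU0.ne'
      -- For f of mean zero the second moment about c exceeds the second moment about 0 by c² U.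
      have e1 : ∑ y, unnormalized H δ y * (f y - c) ^ 2 = ∑ y, unnormalized H δ y * f y ^ 2
          - 2 * c * ∑ y, unnormalized H δ y * f y + c ^ 2 * U := by
        rw [hU, Finset.mul_sum, Finset.mul_sum, ← Finset.sum_sub_distrib, ← Finset.sum_add_distrib]
        exact Finset.sum_congr rfl fun y _ => by ring
      rw [e1, hf']
      have := mul_nonneg (sq_nonneg c) hU0.le
      linarith) x hη hη1
  refine ⟨t, ht, hle.trans ?_⟩
  have hw : 0 < weight H δ x.1 := lt_of_le_of_ne (weight_nonneg hH h0 h1 _) x.isState.2.symm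
  have hpx : 1 / stationary H δ x ≤
      (1 + 2 * κ * numLines n L) * weightZero H δ L / weight H δ x.1 := by
    rw [hst, one_div_div, unnormalized, if_pos hx]
    exact div_le_div_of_nonneg_right (sum_unnormalized_le hN0 (by positivity) hκ) hw.le
  have hlog := Real.log_le_log (one_div_pos.2 (div_pos (hu x) hU0)) hpx
  rw [← hst] at hlog
  gcongr

end Poincare

/-! ### Traces of powers of a positive semidefinite matrix with insertions. -/

section TraceBounds

open scoped Matrix.Norms.L2Operator

variable {V : Type*} [Fintype V] [DecidableEq V]

/-- The entries of a product of matrices as a sum over paths. -/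
theorem listProd_ofFn_apply {M : ℕ} (F : Fin (M + 1) → Matrix V V ℝ) (a b : V) :
    (List.ofFn F).prod a b = ∑ τ : Fin M → V, ∏ i : Fin (M + 1),
      F i ((Fin.cons a τ : Fin (M + 1) → V) i) ((Fin.snoc τ b : Fin (M + 1) → V) i) := by
  induction M generalizing a with
  | zero => simp [List.ofFn_succ, Fin.snoc]
  | succ M ih =>
    rw [List.ofFn_succ, List.prod_cons, Matrix.mul_apply, ← (Fin.consEquiv fun _ => V).sum_comp,
      Fintype.sum_prod_type]
    refine Finset.sum_congr rfl fun c _ => ?_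
    rw [ih, Finset.mul_sum]
    refine Finset.sum_congr rfl fun τ _ => ?_
    rw [Fin.prod_univ_succ (n := M + 1)]
    have h : (Fin.snoc (Fin.consEquiv (fun _ => V) (c, τ)) b : Fin (M + 2) → V) =
        (Fin.cons c (Fin.snoc τ b : Fin (M + 1) → V) : Fin (M + 2) → V) := by
      rw [Fin.cons_snoc_eq_snoc_cons]; rfl
    rw [h]
    rfl

/-- The bridge between transfer matrices and sums over closed strings of basis states; `finRotate`
encodes the periodic boundary condition. -/
theorem trace_listProd_ofFn {M : ℕ} (hM : M ≠ 0) (F : Fin M → Matrix V V ℝ) :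
    (List.ofFn F).prod.trace =
      ∑ σ : Fin M → V, ∏ i, F i (σ i) (σ (finRotate _ i)) := by
  obtain ⟨M, rfl⟩ := Nat.exists_eq_succ_of_ne_zero hM
  rw [Matrix.trace, ← (Fin.consEquiv fun _ => V).sum_comp, Fintype.sum_prod_type]
  refine Finset.sum_congr rfl fun a _ => ?_
  rw [Matrix.diag_apply, listProd_ofFn_apply]
  refine Finset.sum_congr rfl fun τ _ => Finset.prod_congr rfl fun i _ => ?_
  rw [Fin.snoc_eq_cons_rotate]
  rfl

theorem norm_mulVec_le (A : Matrix V V ℝ) (v : V → ℝ) :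
    ‖WithLp.toLp 2 (A.mulVec v)‖ ≤ ‖A‖ * ‖WithLp.toLp 2 v‖ :=
  Matrix.l2_opNorm_mulVec A (WithLp.toLp 2 v)

theorem sum_sq_col_le (A : Matrix V V ℝ) (i : V) : ∑ j, A j i ^ 2 ≤ ‖A‖ ^ 2 := by
  have h := norm_mulVec_le A (Pi.single i 1)
  rw [Matrix.mulVec_single_one] at h
  have h1 : ‖WithLp.toLp 2 (Pi.single i (1 : ℝ) : V → ℝ)‖ = 1 := by
    simp
  rw [h1, mul_one] at h
  have h2 := pow_le_pow_left₀ (norm_nonneg _) h 2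
  rw [EuclideanSpace.real_norm_sq_eq] at h2
  simpa using h2

theorem sum_sq_row_le (A : Matrix V V ℝ) (i : V) : ∑ j, A i j ^ 2 ≤ ‖A‖ ^ 2 := by
  rw [← Matrix.l2_opNorm_conjTranspose]
  simpa using sum_sq_col_le A.conjTranspose i

theorem abs_diag_le (A : Matrix V V ℝ) (i : V) : |A i i| ≤ ‖A‖ := by
  refine abs_le_of_sq_le_sq ?_ (norm_nonneg _)
  exact (Finset.single_le_sum (f := fun j => A i j ^ 2) (fun _ _ => sq_nonneg _)
    (Finset.mem_univ i)).trans (sum_sq_row_le A i)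

/-- Data of a diagonalization of a positive semidefinite matrix. -/
theorem exists_diagonalization {A : Matrix V V ℝ} (hA : A.PosSemidef) :
    ∃ (U : Matrix V V ℝ) (lam : V → ℝ), U.conjTranspose * U = 1 ∧ U * U.conjTranspose = 1 ∧
      ‖U‖ ≤ 1 ∧ (∀ i, 0 ≤ lam i) ∧
      ∀ k, A ^ k = U * Matrix.diagonal (fun i => lam i ^ k) * U.conjTranspose := by
  set U : Matrix V V ℝ := (hA.1.eigenvectorUnitary : Matrix V V ℝ)
  have h1 : U.conjTranspose * U = 1 := Unitary.coe_star_mul_self hA.1.eigenvectorUnitary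
  have h2 : U * U.conjTranspose = 1 := Unitary.coe_mul_star_self hA.1.eigenvectorUnitary
  refine ⟨U, hA.1.eigenvalues, h1, h2, ?_, hA.eigenvalues_nonneg, fun k => ?_⟩
  · have h3 := Matrix.l2_opNorm_conjTranspose_mul_self U
    rw [h1] at h3
    have h4 : ‖(1 : Matrix V V ℝ)‖ ≤ 1 := by
      rw [← Matrix.diagonal_one, Matrix.l2_opNorm_diagonal]
      exact (pi_norm_le_iff_of_nonneg zero_le_one).2 fun _ => by simp
    nlinarith [norm_nonneg U]
  · have h3 : A = U * Matrix.diagonal hA.1.eigenvalues * U.conjTranspose := by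
      conv_lhs => rw [hA.1.spectral_theorem, Unitary.conjStarAlgAut_apply]
      rfl
    generalize hA.1.eigenvalues = lam at h3 ⊢
    clear_value U
    induction k with
    | zero => simpa using h2.symm
    | succ k ih =>
      rw [pow_succ, ih]
      nth_rewrite 1 [h3]
      have : U * Matrix.diagonal (fun i => lam i ^ k) * U.conjTranspose *
          (U * Matrix.diagonal lam * U.conjTranspose) =
          U * Matrix.diagonal (fun i => lam i ^ k) * (U.conjTranspose * U) *
          Matrix.diagonal lam * U.conjTranspose := by
        simp only [Matrix.mul_assoc]
      rw [this, h1, Matrix.mul_one, Matrix.mul_assoc U, Matrix.diagonal_mul_diagonal]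
      rfl

theorem norm_conj_le {U D : Matrix V V ℝ} (hU : ‖U‖ ≤ 1) : ‖U.conjTranspose * D * U‖ ≤ ‖D‖ := by
  refine (Matrix.l2_opNorm_mul _ _).trans ?_
  have h1 := Matrix.l2_opNorm_mul U.conjTranspose D
  rw [Matrix.l2_opNorm_conjTranspose] at h1
  have h2 : ‖U.conjTranspose * D‖ ≤ ‖D‖ :=
    h1.trans (mul_le_of_le_one_left (norm_nonneg _) hU)
  exact (mul_le_of_le_one_right (norm_nonneg _) hU).trans h2

theorem trace_pow_eq {A U : Matrix V V ℝ} {lam : V → ℝ} (h1 : U.conjTranspose * U = 1)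
    (hA : ∀ k, A ^ k = U * Matrix.diagonal (fun i => lam i ^ k) * U.conjTranspose) (k : ℕ) :
    (A ^ k).trace = ∑ i, lam i ^ k := by
  rw [hA, Matrix.trace_mul_comm, ← Matrix.mul_assoc, h1, Matrix.one_mul, Matrix.trace_diagonal]

theorem pow_le_add_pow {a b : ℝ} (ha : 0 ≤ a) (hb : 0 ≤ b) (k l : ℕ) :
    a ^ k * b ^ l ≤ a ^ (k + l) + b ^ (k + l) := by
  rcases le_total a b with h | h
  · calc a ^ k * b ^ l ≤ b ^ k * b ^ l := by gcongr
      _ = b ^ (k + l) := (pow_add _ _ _).symm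
      _ ≤ _ := le_add_of_nonneg_left (by positivity)
  · calc a ^ k * b ^ l ≤ a ^ k * a ^ l := by gcongr
      _ = a ^ (k + l) := (pow_add _ _ _).symm
      _ ≤ _ := le_add_of_nonneg_right (by positivity)

theorem trace_pow_mul_le {A D : Matrix V V ℝ} (hA : A.PosSemidef) (k : ℕ) :
    (A ^ k * D).trace ≤ ‖D‖ * (A ^ k).trace := by
  obtain ⟨U, lam, h1, h2, hU, hlam, hpow⟩ := exists_diagonalization hA
  rw [trace_pow_eq h1 hpow, hpow, Matrix.mul_assoc, Matrix.trace_mul_comm, ← Matrix.mul_assoc,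
    Matrix.trace_mul_comm, Matrix.trace, Finset.mul_sum]
  refine Finset.sum_le_sum fun i _ => ?_
  rw [Matrix.diag_apply, Matrix.diagonal_mul, mul_comm]
  exact mul_le_mul_of_nonneg_right ((le_abs_self _).trans ((abs_diag_le _ i).trans
    (norm_conj_le hU))) (pow_nonneg (hlam i) k)

/-- In an eigenbasis of A the trace is the sum of λᵢ^k λⱼ^l D'ᵢⱼ E'ⱼᵢ. The power product is at most
λᵢ^(k+l) + λⱼ^(k+l) and the entries are split by the arithmetic-geometric inequality. The rows and
columns of D' and E' have square sum at most d², so no dimension factor appears. -/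
theorem trace_pow_mul_pow_mul_le {A D E : Matrix V V ℝ} (hA : A.PosSemidef) {d : ℝ}
    (hD : ‖D‖ ≤ d) (hE : ‖E‖ ≤ d) (k l : ℕ) :
    (A ^ k * D * A ^ l * E).trace ≤ 2 * d ^ 2 * (A ^ (k + l)).trace := by
  obtain ⟨U, lam, h1, h2, hU, hlam, hpow⟩ := exists_diagonalization hA
  set D' := U.conjTranspose * D * U with hD'
  set E' := U.conjTranspose * E * U with hE'
  have hDn : ‖D'‖ ^ 2 ≤ d ^ 2 :=
    pow_le_pow_left₀ (norm_nonneg _) ((norm_conj_le hU).trans hD) 2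
  have hEn : ‖E'‖ ^ 2 ≤ d ^ 2 :=
    pow_le_pow_left₀ (norm_nonneg _) ((norm_conj_le hU).trans hE) 2
  have htr : (A ^ k * D * A ^ l * E).trace = ∑ i, ∑ j, lam i ^ k * lam j ^ l * (D' i j * E' j i) := by
    have h3 : A ^ k * D * A ^ l * E = U * (Matrix.diagonal (fun i => lam i ^ k) * D' *
        (Matrix.diagonal (fun i => lam i ^ l) * (U.conjTranspose * E))) := by
      rw [hpow, hpow]; simp only [hD', Matrix.mul_assoc]
    rw [h3, Matrix.trace_mul_comm]
    have h4 : Matrix.diagonal (fun i => lam i ^ k) * D' *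
        (Matrix.diagonal (fun i => lam i ^ l) * (U.conjTranspose * E)) * U =
        (Matrix.diagonal (fun i => lam i ^ k) * D') * (Matrix.diagonal (fun i => lam i ^ l) * E') := by
      simp only [hE', Matrix.mul_assoc]
    rw [h4, Matrix.trace]
    refine Finset.sum_congr rfl fun i _ => ?_
    rw [Matrix.diag_apply, Matrix.mul_apply]
    refine Finset.sum_congr rfl fun j _ => ?_
    rw [Matrix.diagonal_mul, Matrix.diagonal_mul]
    ring
  have hterm : ∀ i j, lam i ^ k * lam j ^ l * (D' i j * E' j i) ≤
      lam i ^ (k + l) * ((D' i j ^ 2 + E' j i ^ 2) / 2) +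
        lam j ^ (k + l) * ((D' i j ^ 2 + E' j i ^ 2) / 2) := by
    intro i j
    have h3 := pow_le_add_pow (hlam i) (hlam j) k l
    have h4 : 0 ≤ lam i ^ k * lam j ^ l := mul_nonneg (pow_nonneg (hlam i) _) (pow_nonneg (hlam j) _)
    have h5 : D' i j * E' j i ≤ (D' i j ^ 2 + E' j i ^ 2) / 2 := by
      nlinarith [sq_nonneg (D' i j - E' j i)]
    have h6 : 0 ≤ (D' i j ^ 2 + E' j i ^ 2) / 2 := by positivity
    rw [← add_mul]
    exact (mul_le_mul_of_nonneg_left h5 h4).trans (mul_le_mul_of_nonneg_right h3 h6)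
  have hrow : ∀ i, ∑ j, (D' i j ^ 2 + E' j i ^ 2) / 2 ≤ d ^ 2 := by
    intro i
    rw [← Finset.sum_div, Finset.sum_add_distrib]
    linarith [sum_sq_row_le D' i, sum_sq_col_le E' i]
  have hcol : ∀ j, ∑ i, (D' i j ^ 2 + E' j i ^ 2) / 2 ≤ d ^ 2 := by
    intro j
    rw [← Finset.sum_div, Finset.sum_add_distrib]
    linarith [sum_sq_col_le D' j, sum_sq_row_le E' j]
  rw [htr, trace_pow_eq h1 hpow]
  refine (Finset.sum_le_sum fun i _ => Finset.sum_le_sum fun j _ => hterm i j).trans ?_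
  simp only [Finset.sum_add_distrib, ← Finset.mul_sum]
  rw [Finset.sum_comm (f := fun i j => lam j ^ (k + l) * ((D' i j ^ 2 + E' j i ^ 2) / 2))]
  simp only [← Finset.mul_sum]
  have h3 : ∑ i, lam i ^ (k + l) * ∑ j, (D' i j ^ 2 + E' j i ^ 2) / 2 ≤
      ∑ i, lam i ^ (k + l) * d ^ 2 := Finset.sum_le_sum fun i _ =>
    mul_le_mul_of_nonneg_left (hrow i) (pow_nonneg (hlam i) _)
  have h4 : ∑ j, lam j ^ (k + l) * ∑ i, (D' i j ^ 2 + E' j i ^ 2) / 2 ≤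
      ∑ j, lam j ^ (k + l) * d ^ 2 := Finset.sum_le_sum fun i _ =>
    mul_le_mul_of_nonneg_left (hcol i) (pow_nonneg (hlam i) _)
  rw [← Finset.sum_mul] at h3 h4
  linarith

/-- Applied to an eigenvector, the lower bound `hc` says that every eigenvalue is at least c. It
serves to restore the powers of A lost to the insertions. -/
theorem mul_trace_pow_le {A : Matrix V V ℝ} (hA : A.PosSemidef) {c : ℝ}
    (hc : ∀ v, c * ‖WithLp.toLp 2 v‖ ≤ ‖WithLp.toLp 2 (A.mulVec v)‖) (k : ℕ) :
    c * (A ^ k).trace ≤ (A ^ (k + 1)).trace := by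
  obtain ⟨U, lam, h1, h2, hU, hlam, hpow⟩ := exists_diagonalization hA
  rw [trace_pow_eq h1 hpow, trace_pow_eq h1 hpow, Finset.mul_sum]
  refine Finset.sum_le_sum fun i _ => ?_
  rw [pow_succ, mul_comm]
  refine mul_le_mul_of_nonneg_left ?_ (pow_nonneg (hlam i) k)
  have h3 := hc (U.mulVec (Pi.single i 1))
  have h4 : A.mulVec (U.mulVec (Pi.single i 1)) = lam i • U.mulVec (Pi.single i 1) := by
    have h5 := hpow 1
    simp only [pow_one] at h5
    rw [Matrix.mulVec_mulVec]
    nth_rewrite 1 [h5]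
    rw [Matrix.mul_assoc, h1, Matrix.mul_one, ← Matrix.mulVec_mulVec, Matrix.diagonal_mulVec_single,
      ← Matrix.mulVec_smul]
    congr 1
    ext j
    by_cases h : j = i
    · subst h; simp
    · simp [Pi.single_eq_of_ne h]
  rw [h4, WithLp.toLp_smul, norm_smul, Real.norm_of_nonneg (hlam i)] at h3
  refine le_of_mul_le_mul_right h3 ?_
  rw [norm_pos_iff]
  intro h5
  have h6 : U.mulVec (Pi.single i 1) = 0 := by
    have := congrArg WithLp.ofLp h5
    simpa using this
  have h7 : U.conjTranspose.mulVec (U.mulVec (Pi.single i 1)) = Pi.single i 1 := by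
    rw [Matrix.mulVec_mulVec, h1, Matrix.one_mulVec]
  rw [h6, Matrix.mulVec_zero] at h7
  have := congrFun h7 i
  simp at this

theorem trace_pow_le_card_mul {A : Matrix V V ℝ} (k : ℕ) {c : ℝ} (hc : ‖A ^ k‖ ≤ c) :
    (A ^ k).trace ≤ Fintype.card V * c := by
  rw [Matrix.trace, ← Finset.card_univ, ← nsmul_eq_mul, ← Finset.sum_const]
  exact Finset.sum_le_sum fun i _ => ((le_abs_self _).trans (abs_diag_le _ i)).trans hc

end TraceBounds

/-! ### Operators as small perturbations of the identity. -/

section GateMatrices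

open scoped Matrix.Norms.L2Operator

variable {n : ℕ}

/-- The matrix of an operator on `n` qubits. -/
def gateMatrix (H : Coeffs n) (δ : ℝ) (g : Gate n) : Matrix (Fin n → Fin 2) (Fin n → Fin 2) ℝ :=
  fun σ τ => if ∀ q ∉ g.support, σ q = τ q then
    g.weight H δ (fun k => if k.2 then τ k.1 else σ k.1) else 0

theorem diagonal_mul_permMatrix_apply {V : Type*} [Fintype V] [DecidableEq V] (c : V → ℝ)
    (φ : Equiv.Perm V) (σ τ : V) :
    (Matrix.diagonal c * φ.permMatrix ℝ) σ τ = if τ = φ σ then c σ else 0 := by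
  rw [Matrix.diagonal_mul, Equiv.Perm.permMatrix, PEquiv.toMatrix_toPEquiv_apply]
  simp [Pi.single_apply]

theorem gateMatrix_one_eq (H : Coeffs n) (δ : ℝ) (i : Fin n) : gateMatrix H δ (.one i) =
    1 + Matrix.diagonal (fun σ : Fin n → Fin 2 => if σ i = 0 then -(δ * H.d i) else δ * H.d i) *
      (1 : Equiv.Perm (Fin n → Fin 2)).permMatrix ℝ := by
  ext σ τ
  rw [Matrix.add_apply, diagonal_mul_permMatrix_apply, gateMatrix, Matrix.one_apply, weight_one_eq]
  simp only [Gate.support, Finset.mem_singleton, Equiv.Perm.coe_one, id_eq, Bool.false_eq_true,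
    if_false, if_true]
  by_cases h : σ = τ
  · subst h
    simp only [implies_true, if_true]
    split_ifs <;> ring
  · simp only [h, Ne.symm h, if_false, add_zero]
    split_ifs with h1 h2 h3 <;> try rfl
    all_goals
      exfalso
      apply h
      funext q
      by_cases hq : q = i
      · subst hq; exact h2
      · exact h1 q hq

/-- The off-diagonal part flips both qubits, which permutes the basis, with an amplitude read off
from the row. As a diagonal matrix times a permutation its norm is at most its largest entry in
modulus; the one-qubit case is put in the same form. -/
theorem gateMatrix_two_eq (H : Coeffs n) (δ : ℝ) (i j : Fin n) :
    gateMatrix H δ (.two i j) = 1 + Matrix.diagonal (fun σ : Fin n → Fin 2 =>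
      if σ i = σ j then δ * (H.a i j + H.b i j) else δ * (H.a i j - H.b i j)) *
      (Equiv.addRight (fun q : Fin n => if q = i ∨ q = j then (1 : Fin 2) else 0)).permMatrix ℝ := by
  ext σ τ
  rw [Matrix.add_apply, diagonal_mul_permMatrix_apply, gateMatrix, Matrix.one_apply, weight_two_eq]
  simp only [Gate.support, Finset.mem_singleton, Finset.mem_insert, not_or, Bool.false_eq_true,
    if_false, if_true, Equiv.coe_addRight]
  by_cases h : ∀ q : Fin n, ¬ q = i ∧ ¬ q = j → σ q = τ q
  · rw [if_pos h]
    have e1 : σ = τ ↔ σ i = τ i ∧ σ j = τ j := by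
      refine ⟨fun h' => by simp [h'], fun h' => funext fun q => ?_⟩
      by_cases hi : q = i
      · rw [hi]; exact h'.1
      · by_cases hj : q = j
        · rw [hj]; exact h'.2
        · exact h q ⟨hi, hj⟩
    have e2 : τ = σ + (fun q : Fin n => if q = i ∨ q = j then (1 : Fin 2) else 0) ↔
        τ i = σ i + 1 ∧ τ j = σ j + 1 := by
      refine ⟨fun h' => by simp [h'], fun h' => funext fun q => ?_⟩
      by_cases hi : q = i
      · rw [hi]; simp [h'.1]
      · by_cases hj : q = j
        · rw [hj]; simp [h'.2]
        · simp [hi, hj, h q ⟨hi, hj⟩]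
    simp only [e1, e2, twoWeight]
    generalize σ i = a, σ j = b, τ i = c, τ j = d
    fin_cases a <;> fin_cases b <;> fin_cases c <;> fin_cases d <;> simp
  · have h1 : σ ≠ τ := by
      rintro rfl
      exact h fun q _ => rfl
    have h2 : τ ≠ σ + (fun q : Fin n => if q = i ∨ q = j then (1 : Fin 2) else 0) := by
      rintro rfl
      exact h fun q hq => by simp [hq.1, hq.2]
    simp only [h, h1, h2, if_false, add_zero]

theorem norm_diagonal_mul_permMatrix_le {V : Type*} [Fintype V] [DecidableEq V] {c : V → ℝ} {δ : ℝ}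
    (h0 : 0 ≤ δ) (hc : ∀ σ, |c σ| ≤ δ) (φ : Equiv.Perm V) :
    ‖Matrix.diagonal c * φ.permMatrix ℝ‖ ≤ δ := by
  refine (Matrix.l2_opNorm_mul _ _).trans ?_
  have h1 : ‖Matrix.diagonal c‖ ≤ δ := by
    rw [Matrix.l2_opNorm_diagonal]
    exact (pi_norm_le_iff_of_nonneg h0).2 hc
  exact (mul_le_of_le_one_right (norm_nonneg _) (Matrix.permMatrix_l2_opNorm_le _)).trans h1

theorem norm_gateMatrix_sub_one_le {H : Coeffs n} (hH : H.IsStoquastic) {δ : ℝ} (h0 : 0 ≤ δ)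
    {g : Gate n} (hg : g ∈ stepGates n) : ‖gateMatrix H δ g - 1‖ ≤ δ := by
  cases g with
  | one i =>
    rw [gateMatrix_one_eq, add_sub_cancel_left]
    refine norm_diagonal_mul_permMatrix_le h0 (fun σ => ?_) _
    have h1 : |δ * H.d i| ≤ δ := by
      rw [abs_mul, abs_of_nonneg h0]
      exact mul_le_of_le_one_right h0 (hH.2 i)
    split_ifs
    · rwa [abs_neg]
    · exact h1
  | two i j =>
    have hij := two_mem_stepGates.1 hg
    rw [gateMatrix_two_eq, add_sub_cancel_left]
    refine norm_diagonal_mul_permMatrix_le h0 (fun σ => ?_) _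
    obtain ⟨h1, h2⟩ := hH.1 i j hij
    have h3 := abs_le.1 h1
    split_ifs
    all_goals
      rw [abs_mul, abs_of_nonneg h0]
      exact mul_le_of_le_one_right h0 (abs_le.2 ⟨by linarith, by linarith⟩)

theorem norm_gateMatrix_le {H : Coeffs n} (hH : H.IsStoquastic) {δ : ℝ} (h0 : 0 ≤ δ)
    {g : Gate n} (hg : g ∈ stepGates n) : ‖gateMatrix H δ g‖ ≤ 1 + δ := by
  have h1 := norm_add_le (1 : Matrix (Fin n → Fin 2) (Fin n → Fin 2) ℝ) (gateMatrix H δ g - 1)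
  rw [add_sub_cancel] at h1
  linarith [norm_one (α := Matrix (Fin n → Fin 2) (Fin n → Fin 2) ℝ), norm_gateMatrix_sub_one_le hH h0 hg]

theorem le_norm_gateMatrix_mulVec {H : Coeffs n} (hH : H.IsStoquastic) {δ : ℝ} (h0 : 0 ≤ δ)
    {g : Gate n} (hg : g ∈ stepGates n) (v : (Fin n → Fin 2) → ℝ) :
    (1 - δ) * ‖WithLp.toLp 2 v‖ ≤ ‖WithLp.toLp 2 ((gateMatrix H δ g).mulVec v)‖ := by
  have h1 := norm_mulVec_le (gateMatrix H δ g - 1) v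
  have h2 : (gateMatrix H δ g).mulVec v - (gateMatrix H δ g - 1).mulVec v = v := by
    rw [Matrix.sub_mulVec, Matrix.one_mulVec, sub_sub_cancel]
  have h3 := norm_sub_le (WithLp.toLp 2 ((gateMatrix H δ g).mulVec v))
    (WithLp.toLp 2 ((gateMatrix H δ g - 1).mulVec v))
  rw [← WithLp.toLp_sub, h2] at h3
  have h4 := mul_le_mul_of_nonneg_right (norm_gateMatrix_sub_one_le hH h0 hg)
    (norm_nonneg (WithLp.toLp 2 v))
  linarith

theorem gateMatrix_transpose (H : Coeffs n) (δ : ℝ) {g : Gate n} (hg : g ∈ stepGates n) :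
    (gateMatrix H δ g).transpose = gateMatrix H δ g := by
  cases g with
  | one i =>
    rw [gateMatrix_one_eq]
    ext σ τ
    rw [Matrix.transpose_apply, Matrix.add_apply, Matrix.add_apply, diagonal_mul_permMatrix_apply,
      diagonal_mul_permMatrix_apply, Matrix.one_apply, Matrix.one_apply]
    simp only [Equiv.Perm.coe_one, id_eq]
    by_cases h : σ = τ
    · subst h; rfl
    · simp only [h, Ne.symm h, if_false]
  | two i j =>
    rw [gateMatrix_two_eq]
    ext σ τ
    rw [Matrix.transpose_apply, Matrix.add_apply, Matrix.add_apply, diagonal_mul_permMatrix_apply,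
      diagonal_mul_permMatrix_apply, Matrix.one_apply, Matrix.one_apply]
    simp only [Equiv.coe_addRight]
    set e : Fin n → Fin 2 := fun q => if q = i ∨ q = j then 1 else 0 with he
    have hee : ∀ ρ : Fin n → Fin 2, ρ + e + e = ρ := by
      intro ρ
      funext q
      simp only [Pi.add_apply, he]
      split_ifs
      · exact fin2_add_one_add_one _
      · simp
    have hiff : σ = τ + e ↔ τ = σ + e := ⟨fun h => by rw [h, hee], fun h => by rw [h, hee]⟩
    simp only [hiff, eq_comm (a := τ) (b := σ)]
    by_cases h : τ = σ + e
    · simp only [h, if_true]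
      congr 1
      simp [he]
    · simp only [h, if_false]

/-- The matrix of `C C†`. -/
def blockMatrix (H : Coeffs n) (δ : ℝ) : Matrix (Fin n → Fin 2) (Fin n → Fin 2) ℝ :=
  ((blockGates n).map (gateMatrix H δ)).prod

/-- The list of a block is a palindrome of symmetric factors, so its product is a matrix times its
own adjoint. -/
theorem posSemidef_blockMatrix (H : Coeffs n) (δ : ℝ) : (blockMatrix H δ).PosSemidef := by
  have h1 : ∀ l : List (Gate n), (∀ g ∈ l, g ∈ stepGates n) →
      (l.reverse.map (gateMatrix H δ)).prod = ((l.map (gateMatrix H δ)).prod).conjTranspose := by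
    intro l
    induction l with
    | nil => simp
    | cons g l ih =>
      intro hl
      rw [List.reverse_cons, List.map_append, List.prod_append, List.map_cons, List.map_cons, List.prod_cons, List.prod_cons,
        Matrix.conjTranspose_mul, ih fun g' hg' => hl g' (List.mem_cons_of_mem _ hg')]
      congr 1
      rw [Matrix.conjTranspose_eq_transpose_of_trivial,
        gateMatrix_transpose H δ (hl g List.mem_cons_self)]
      simp
  rw [blockMatrix, blockGates, List.map_append, List.prod_append, h1 _ fun _ h => h]
  exact Matrix.posSemidef_self_mul_conjTranspose _

theorem mem_blockGates {g : Gate n} : g ∈ blockGates n ↔ g ∈ stepGates n := by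
  simp [blockGates]

/-- Each factor shrinks a vector at most by 1 - δ, as it differs from the identity by at most δ in
norm. -/
theorem pow_mul_norm_le_blockMatrix_mulVec {H : Coeffs n} (hH : H.IsStoquastic) {δ : ℝ}
    (h0 : 0 ≤ δ) (h1 : δ ≤ 1) (v : (Fin n → Fin 2) → ℝ) :
    (1 - δ) ^ (blockGates n).length * ‖WithLp.toLp 2 v‖ ≤
      ‖WithLp.toLp 2 ((blockMatrix H δ).mulVec v)‖ := by
  have key : ∀ l : List (Gate n), (∀ g ∈ l, g ∈ stepGates n) →
      (1 - δ) ^ l.length * ‖WithLp.toLp 2 v‖ ≤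
        ‖WithLp.toLp 2 (((l.map (gateMatrix H δ)).prod).mulVec v)‖ := by
    intro l
    induction l with
    | nil => simp
    | cons g l ih =>
      intro hl
      rw [List.map_cons, List.prod_cons, ← Matrix.mulVec_mulVec, List.length_cons, pow_succ', mul_assoc]
      refine le_trans ?_ (le_norm_gateMatrix_mulVec hH h0 (hl g List.mem_cons_self) _)
      exact mul_le_mul_of_nonneg_left (ih fun g' hg' => hl g' (List.mem_cons_of_mem _ hg'))
        (by linarith)
  exact key _ fun g hg => mem_blockGates.1 hg

end GateMatrices

/-! ### Configurations as strings of basis states with heads inserted. -/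

section WorldLines

variable {n L : ℕ}

theorem val_finRotate {M : ℕ} (m : Fin M) : (finRotate M m : ℕ) = ((m : ℕ) + 1) % M := by
  cases M with
  | zero => exact m.elim0
  | succ M => rw [finRotate_apply, Fin.val_add, Fin.val_one', Nat.add_mod_mod]

/-- `l` is the first upper leg on the qubit `q` at or after the position `i`. -/
def IsNext (i : ℕ) (q : Fin n) (l : Leg n L) : Prop :=
  l.2.2 = false ∧ (l.2.1 : Fin n) = q ∧ ∃ r : ℕ, (l.1 : ℕ) = (i + r) % numOps n L ∧
    ∀ s < r, ∀ m : Fin (numOps n L), (m : ℕ) = (i + s) % numOps n L → q ∉ (op m).support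

theorem exists_isNext (hL : L ≠ 0) (i : ℕ) (q : Fin n) : ∃ l : Leg n L, IsNext i q l := by
  classical
  obtain ⟨m, -, -, hm, -⟩ := exists_two_boxes hL q
  have hM : 0 < numOps n L := lt_of_le_of_lt (Nat.zero_le _) m.2
  have hex : ∃ r : ℕ, q ∈
      (op (⟨(i + r) % numOps n L, Nat.mod_lt _ hM⟩ : Fin (numOps n L))).support := by
    -- The box m is reached from i after m - i steps modulo M; adding M · i keeps the truncated
    -- subtraction exact.
    refine ⟨m + numOps n L * i - i, ?_⟩
    have h1 : i ≤ numOps n L * i := Nat.le_mul_of_pos_left i hM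
    have : (⟨(i + (m + numOps n L * i - i)) % numOps n L, Nat.mod_lt _ hM⟩ : Fin (numOps n L))
        = m := by
      ext
      rw [show i + ((m : ℕ) + numOps n L * i - i) = m + numOps n L * i by omega]
      simp [Nat.mod_eq_of_lt m.2]
    rwa [this]
  refine ⟨⟨_, ⟨⟨q, Nat.find_spec hex⟩, false⟩⟩, rfl, rfl, Nat.find hex, rfl,
    fun s hs m' hm' hmem => Nat.find_min hex hs ?_⟩
  have : m' = (⟨(i + s) % numOps n L, Nat.mod_lt _ hM⟩ : Fin (numOps n L)) := Fin.ext hm'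
  rwa [← this]

theorem IsNext.unique {i : ℕ} {q : Fin n} {l l' : Leg n L} (h : IsNext i q l)
    (h' : IsNext i q l') : l = l' := by
  obtain ⟨hl, hq, r, hlr, hmin⟩ := h
  obtain ⟨hl', hq', r', hlr', hmin'⟩ := h'
  have hrr : r = r' := by
    rcases lt_trichotomy r r' with h | h | h
    · exact absurd (hq ▸ l.2.1.2) (hmin' r h l.1 hlr)
    · exact h
    · exact absurd (hq' ▸ l'.2.1.2) (hmin r' h l'.1 hlr')
  subst hrr
  exact Leg.ext_iff'.2 ⟨Fin.ext (hlr.trans hlr'.symm), hq.trans hq'.symm, hl.trans hl'.symm⟩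

theorem isNext_mod {i : ℕ} {q : Fin n} {l : Leg n L} :
    IsNext (i % numOps n L) q l ↔ IsNext i q l := by
  simp only [IsNext, Nat.mod_add_mod]

theorem isNext_self (m : Fin (numOps n L)) {k : Leg n L} (hm : k.1 = m) (hk : k.2.2 = false) :
    IsNext (m : ℕ) (k.2.1 : Fin n) k :=
  ⟨hk, rfl, 0, by rw [hm, add_zero, Nat.mod_eq_of_lt m.2], fun s hs => absurd hs (Nat.not_lt_zero s)⟩

theorem IsNext.of_succ {m : Fin (numOps n L)} {q : Fin n} {l : Leg n L}
    (h : IsNext ((m : ℕ) + 1) q l) (hq : q ∉ (op m).support) : IsNext (m : ℕ) q l := by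
  obtain ⟨hl, hlq, r, hlr, hmin⟩ := h
  refine ⟨hl, hlq, r + 1, by rw [hlr]; congr 1; ring, fun s hs m' hm' => ?_⟩
  cases s with
  | zero =>
    have : m' = m := Fin.ext (by rw [hm', add_zero, Nat.mod_eq_of_lt m.2])
    rwa [this]
  | succ s => exact hmin s (by omega) m' (by rw [hm']; congr 1; ring)

theorem joined_iff_isNext {k l : Leg n L} :
    Joined k l ↔ k.2.2 = true ∧ IsNext ((k.1 : ℕ) + 1) (k.2.1 : Fin n) l := by
  constructor
  · rintro ⟨hk, hl, hq, r, hr, hlr, hmin⟩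
    refine ⟨hk, hl, hq.symm, r - 1, by rw [hlr]; congr 1; omega, fun s hs m hm => ?_⟩
    exact hmin (s + 1) (by omega) (by omega) m (by rw [hm]; congr 1; ring)
  · rintro ⟨hk, hl, hq, r, hlr, hmin⟩
    refine ⟨hk, hl, hq.symm, r + 1, by omega, by rw [hlr]; congr 1; ring, fun s hs hsr m hm => ?_⟩
    exact hmin (s - 1) (by omega) m (by rw [hm]; congr 1; omega)

/-- The strings of basis states that change only where an operator acts. -/
def IsWorldLine (σ : Fin (numOps n L) → Fin n → Fin 2) : Prop :=
  ∀ m, ∀ q ∉ (op m).support, σ m q = σ (finRotate _ m) q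

theorem IsWorldLine.eq_of_isNext {σ : Fin (numOps n L) → Fin n → Fin 2} (hσ : IsWorldLine σ)
    {i : ℕ} {q : Fin n} {l : Leg n L} (h : IsNext i q l) {m : Fin (numOps n L)}
    (hm : (m : ℕ) = i % numOps n L) : σ m q = σ l.1 q := by
  obtain ⟨-, -, r, hlr, hmin⟩ := h
  induction r generalizing i m with
  | zero => rw [Fin.ext (hm.trans hlr.symm)]
  | succ r ih =>
    rw [hσ m q (hmin 0 (by omega) m hm)]
    refine ih (i := i + 1) ?_ ?_ fun s hs m' hm' => ?_
    · rw [val_finRotate, hm, Nat.mod_add_mod]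
    · rw [hlr]; congr 1; ring
    · exact hmin (s + 1) (by omega) m' (by rw [hm']; congr 1; ring)

theorem IsWorldLine.heads_ofStates {σ : Fin (numOps n L) → Fin n → Fin 2} (hσ : IsWorldLine σ) :
    heads (ofStates σ) = ∅ := by
  refine Finset.eq_empty_of_forall_notMem fun k hk => ?_
  simp only [heads, Finset.mem_filter, Finset.mem_univ, true_and] at hk
  obtain ⟨l, hj, hne⟩ := hk
  obtain ⟨hk, hnext⟩ := joined_iff_isNext.1 hj
  apply hne
  have hlf : l.2.2 = false := hnext.1
  have hlq : (l.2.1 : Fin n) = k.2.1 := hnext.2.1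
  simp only [ofStates, hk, hlf, if_true, Bool.false_eq_true, if_false, hlq]
  exact hσ.eq_of_isNext hnext (val_finRotate _)

theorem IsWorldLine.ofStates_injective (hL : L ≠ 0) {σ τ : Fin (numOps n L) → Fin n → Fin 2}
    (hσ : IsWorldLine σ) (hτ : IsWorldLine τ) (h : ofStates σ = ofStates τ) : σ = τ := by
  funext m q
  obtain ⟨l, hl⟩ := exists_isNext hL (m : ℕ) q
  have hm : (m : ℕ) = m % numOps n L := (Nat.mod_eq_of_lt m.2).symm
  rw [hσ.eq_of_isNext hl hm, hτ.eq_of_isNext hl hm]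
  have h1 := congrFun h l
  have hlf : l.2.2 = false := hl.1
  have hlq : (l.2.1 : Fin n) = q := hl.2.1
  simpa only [ofStates, hlf, Bool.false_eq_true, if_false, hlq] using h1

open Classical in
/-- The configuration given by a string of basis states and the positions of the worm heads. -/
noncomputable def ofStatesHeads (S : Finset (Leg n L)) (σ : Fin (numOps n L) → Fin n → Fin 2) :
    Config n L :=
  fun k => if k.2.2 then σ (finRotate _ k.1) k.2.1 + (if k ∈ S then 1 else 0) else σ k.1 k.2.1

theorem ofStatesHeads_empty (σ : Fin (numOps n L) → Fin n → Fin 2) :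
    ofStatesHeads ∅ σ = ofStates σ := by
  funext k
  simp [ofStatesHeads, ofStates]

/-- The state before the m-th box is read off, on each qubit, from the next upper leg at or after m.
Between two boxes on a qubit this reading does not change, and a lower leg differs from it exactly
if its line carries a head. -/
theorem exists_worldLine (hL : L ≠ 0) (z : Config n L) :
    ∃ σ : Fin (numOps n L) → Fin n → Fin 2, IsWorldLine σ ∧ z = ofStatesHeads (heads z) σ := by
  classical
  choose nx hnx using fun (i : ℕ) (q : Fin n) => exists_isNext hL i q
  refine ⟨fun m q => z (nx m q), fun m q hq => ?_, funext fun k => ?_⟩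
  · change z (nx m q) = z (nx (finRotate _ m : ℕ) q)
    refine congrArg z ((hnx m q).unique (IsNext.of_succ ?_ hq))
    have := hnx (finRotate _ m : ℕ) q
    rwa [val_finRotate, isNext_mod, ← val_finRotate] at this
  · unfold ofStatesHeads
    split_ifs with hk hS
    · have h1 := hnx (finRotate _ k.1 : ℕ) k.2.1
      rw [val_finRotate, isNext_mod, ← val_finRotate] at h1
      have h2 := joined_iff_isNext.2 ⟨hk, h1⟩
      simp only [heads, Finset.mem_filter, Finset.mem_univ, true_and] at hS
      obtain ⟨l, hl, hne⟩ := hS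
      rw [hl.right_unique h2] at hne
      exact (fin2_ne_iff_eq_add_one _ _).1 hne
    · have h1 := hnx (finRotate _ k.1 : ℕ) k.2.1
      rw [val_finRotate, isNext_mod, ← val_finRotate] at h1
      have h2 := joined_iff_isNext.2 ⟨hk, h1⟩
      simp only [heads, Finset.mem_filter, Finset.mem_univ, true_and, not_exists, not_and,
        not_not] at hS
      rw [add_zero]
      exact hS _ h2
    · have hk' : k.2.2 = false := by simpa using hk
      exact congrArg z ((hnx k.1 k.2.1).unique (isNext_self k.1 rfl hk')).symm

open Classical in
/-- The qubits on which a worm head sits below the box at the position `i`. -/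
noncomputable def headBits (S : Finset (Leg n L)) (i : ℕ) (q : Fin n) : Fin 2 :=
  if ∃ k ∈ S, (k.1 : ℕ) = i ∧ (k.2.1 : Fin n) = q ∧ k.2.2 = true then 1 else 0

theorem headBits_of_notMem {S : Finset (Leg n L)} {m : Fin (numOps n L)} {q : Fin n}
    (hq : q ∉ (op m).support) : headBits S m q = 0 := by
  rw [headBits, if_neg]
  rintro ⟨k, -, hk, hkq, -⟩
  have : k.1 = m := Fin.ext hk
  subst this
  exact hq (hkq ▸ k.2.1.2)

theorem headBits_leg {S : Finset (Leg n L)} {m : Fin (numOps n L)} (k : (op m).support) :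
    headBits S m (k : Fin n) = 1 ↔ (⟨m, (k, true)⟩ : Leg n L) ∈ S := by
  rw [headBits]
  constructor
  · intro h
    split_ifs at h with h1
    · obtain ⟨l, hl, hlm, hlq, hl2⟩ := h1
      have : l = (⟨m, (k, true)⟩ : Leg n L) := Leg.ext_iff'.2 ⟨Fin.ext hlm, hlq, hl2⟩
      rwa [← this]
    · exact absurd h (by norm_num)
  · intro h
    rw [if_pos ⟨_, h, rfl, rfl, rfl⟩]

variable {H : Coeffs n} {δ : ℝ}

/-- The matrix of an operator, followed by the flips `h`. -/
def flippedGateMatrix (H : Coeffs n) (δ : ℝ) (g : Gate n) (h : Fin n → Fin 2) :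
    Matrix (Fin n → Fin 2) (Fin n → Fin 2) ℝ := fun σ τ => gateMatrix H δ g σ (τ + h)

theorem flippedGateMatrix_zero (g : Gate n) : flippedGateMatrix H δ g 0 = gateMatrix H δ g := by
  funext σ τ
  rw [flippedGateMatrix, add_zero]

/-- Placing every head directly below the box of its lower leg turns it into flips of the column
index of that box's matrix. -/
theorem boxWeight_ofStatesHeads (S : Finset (Leg n L)) {σ : Fin (numOps n L) → Fin n → Fin 2}
    (hσ : IsWorldLine σ) (m : Fin (numOps n L)) : boxWeight H δ (ofStatesHeads S σ) m =
      flippedGateMatrix H δ (op m) (headBits S m) (σ m) (σ (finRotate _ m)) := by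
  rw [flippedGateMatrix, gateMatrix, if_pos, boxWeight_eq]
  · congr 1
    funext k
    obtain ⟨q, b⟩ := k
    cases b with
    | false => rfl
    | true =>
      simp only [ofStatesHeads, if_true, Pi.add_apply]
      congr 1
      by_cases h : (⟨m, (q, true)⟩ : Leg n L) ∈ S
      · rw [if_pos h, (headBits_leg q).2 h]
      · rw [if_neg h]
        have := mt (headBits_leg (S := S) q).1 h
        revert this
        generalize headBits S m q = b
        fin_cases b <;> simp
  · intro q hq
    rw [Pi.add_apply, headBits_of_notMem hq, add_zero]
    exact hσ m q hq

/-- An entry vanishes when the string changes on a qubit on which the box does not act, since the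
heads below a box lie on its own qubits. -/
theorem isWorldLine_of_prod_ne_zero {S : Finset (Leg n L)} {σ : Fin (numOps n L) → Fin n → Fin 2}
    (h : ∏ m, flippedGateMatrix H δ (op m) (headBits S m) (σ m) (σ (finRotate _ m)) ≠ 0) :
    IsWorldLine σ := by
  intro m q hq
  have h1 := Finset.prod_ne_zero_iff.1 h m (Finset.mem_univ m)
  rw [flippedGateMatrix, gateMatrix] at h1
  by_contra h2
  refine h1 (if_neg fun h3 => h2 ?_)
  have := h3 q hq
  rwa [Pi.add_apply, headBits_of_notMem hq, add_zero] at this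

/-- The transfer matrices of the diagram with worm heads at `S`. -/
noncomputable def transferMatrix (H : Coeffs n) (δ : ℝ) (S : Finset (Leg n L))
    (m : Fin (numOps n L)) : Matrix (Fin n → Fin 2) (Fin n → Fin 2) ℝ :=
  flippedGateMatrix H δ (op m) (headBits S m)

theorem gateMatrix_nonneg (hH : H.IsStoquastic) (h0 : 0 < δ) (h1 : δ ≤ 1 / 2)
    (m : Fin (numOps n L)) (σ τ : Fin n → Fin 2) : 0 ≤ gateMatrix H δ (op m) σ τ := by
  unfold gateMatrix
  split_ifs
  · exact (op_weight_bounds hH h0 h1 m).1 _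
  · exact le_rfl

theorem numOps_ne_zero (hn : 1 ≤ n) (hL : L ≠ 0) : numOps n L ≠ 0 := by
  obtain ⟨m, -⟩ := exists_two_boxes hL (⟨0, hn⟩ : Fin n)
  exact (lt_of_le_of_lt (Nat.zero_le _) m.2).ne'

/-- Configurations with given heads inject into strings with equal weight, and the remaining strings
contribute nonnegatively. -/
theorem sum_weight_heads_le_trace (hH : H.IsStoquastic) (h0 : 0 < δ) (h1 : δ ≤ 1 / 2) (hn : 1 ≤ n)
    (hL : L ≠ 0) (S : Finset (Leg n L)) :
    ∑ z ∈ Finset.univ.filter (fun z : Config n L => heads z = S), weight H δ z ≤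
      (List.ofFn (transferMatrix H δ S)).prod.trace := by
  classical
  rw [trace_listProd_ofFn (numOps_ne_zero hn hL)]
  choose σ hσ hz using fun z : Config n L => exists_worldLine hL z
  have h2 : ∀ z ∈ Finset.univ.filter (fun z : Config n L => heads z = S), weight H δ z =
      ∏ m, transferMatrix H δ S m (σ z m) (σ z (finRotate _ m)) := by
    intro z hzS
    rw [Finset.mem_filter] at hzS
    conv_lhs => rw [hz z, hzS.2]
    exact Finset.prod_congr rfl fun m _ => boxWeight_ofStatesHeads S (hσ z) m
  have hinj : Set.InjOn σ
      (Finset.univ.filter (fun z : Config n L => heads z = S) : Finset (Config n L)) := by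
    intro z hzS z' hzS' h
    simp only [Finset.coe_filter, Finset.mem_univ, true_and, Set.mem_ofPred_eq] at hzS hzS'
    rw [hz z, hz z', hzS, hzS', h]
  rw [Finset.sum_congr rfl h2, ← Finset.sum_image (f := fun τ : Fin (numOps n L) → Fin n → Fin 2 =>
    ∏ m, transferMatrix H δ S m (τ m) (τ (finRotate _ m))) hinj]
  refine Finset.sum_le_sum_of_subset_of_nonneg (Finset.subset_univ _) fun τ _ _ => ?_
  exact Finset.prod_nonneg fun m _ => gateMatrix_nonneg hH h0 h1 m _ _

/-- The reverse comparison without heads: strings with nonzero product are world lines, and these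
inject into the configurations without heads. -/
theorem trace_le_weightZero (hH : H.IsStoquastic) (h0 : 0 < δ) (h1 : δ ≤ 1 / 2) (hn : 1 ≤ n)
    (hL : L ≠ 0) :
    (List.ofFn (transferMatrix H δ (∅ : Finset (Leg n L)))).prod.trace ≤ weightZero H δ L := by
  classical
  rw [trace_listProd_ofFn (numOps_ne_zero hn hL)]
  set φ : (Fin (numOps n L) → Fin n → Fin 2) → ℝ := fun σ =>
    ∏ m, transferMatrix H δ (∅ : Finset (Leg n L)) m (σ m) (σ (finRotate _ m))
  change ∑ σ, φ σ ≤ _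
  have hs : ∑ σ ∈ Finset.univ.filter (IsWorldLine (n := n) (L := L)), φ σ = ∑ σ, φ σ :=
    Finset.sum_filter_of_ne fun σ _ h => isWorldLine_of_prod_ne_zero h
  rw [← hs]
  have h2 : ∀ σ ∈ Finset.univ.filter (IsWorldLine (n := n) (L := L)), φ σ =
      weight H δ (ofStates σ) := by
    intro σ hσ
    rw [← ofStatesHeads_empty]
    exact (Finset.prod_congr rfl fun m _ =>
      boxWeight_ofStatesHeads ∅ (Finset.mem_filter.1 hσ).2 m).symm
  have hinj : Set.InjOn (ofStates (n := n) (L := L))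
      (Finset.univ.filter (IsWorldLine (n := n) (L := L)) : Finset _) := by
    intro σ hσ τ hτ h
    simp only [Finset.coe_filter, Finset.mem_univ, true_and, Set.mem_ofPred_eq] at hσ hτ
    exact hσ.ofStates_injective hL hτ h
  rw [Finset.sum_congr rfl h2, ← Finset.sum_image (f := fun z => weight H δ z) hinj]
  refine Finset.sum_le_sum_of_subset_of_nonneg ?_ fun z _ _ => weight_nonneg hH h0 h1 z
  intro z hz
  obtain ⟨σ, hσ, rfl⟩ := Finset.mem_image.1 hz
  rw [mem_headFree_iff_card, (Finset.mem_filter.1 hσ).2.heads_ofStates, Finset.card_empty]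

end WorldLines

/-! ### The ratio of partition functions with two given heads and with none. -/

section Transfer

open scoped Matrix.Norms.L2Operator

theorem prod_map_range'_eq_pow {R : Type*} [Monoid R] {B : ℕ → R} {A : R} {s k : ℕ}
    (h : ∀ i, s ≤ i → i < s + k → B i = A) : ((List.range' s k).map B).prod = A ^ k := by
  have h1 : (List.range' s k).map B = List.replicate k A := by
    rw [List.eq_replicate_iff]
    refine ⟨by simp, fun b hb => ?_⟩
    obtain ⟨i, hi, rfl⟩ := List.mem_map.1 hb
    rw [List.mem_range'_1] at hi
    exact h i hi.1 hi.2
  rw [h1, List.prod_replicate]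

theorem prod_map_range'_eq_pow_mul {R : Type*} [Monoid R] {B : ℕ → R} {A : R} {s k b : ℕ}
    (hb : s ≤ b) (hb' : b < s + k) (h : ∀ i, s ≤ i → i < b → B i = A) :
    ((List.range' s k).map B).prod =
      A ^ (b - s) * B b * ((List.range' (b + 1) (s + k - b - 1)).map B).prod := by
  have h1 : List.range' s k = List.range' s (b - s) ++ b :: List.range' (b + 1) (s + k - b - 1) := by
    have h2 := List.range'_append (s := s) (m := b - s) (n := k - (b - s)) (step := 1)
    rw [show b - s + (k - (b - s)) = k by omega, show s + 1 * (b - s) = b by omega] at h2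
    rw [← h2, show k - (b - s) = (s + k - b - 1) + 1 by omega, List.range'_succ]
  rw [h1, List.map_append, List.prod_append, List.map_cons, List.prod_cons,
    prod_map_range'_eq_pow (fun i hi hi' => h i hi (by omega)), mul_assoc]

/-- The trace of a product of matrices of which all but at most two are equal. -/
theorem trace_prod_range_le {V : Type*} [Fintype V] [DecidableEq V] {A : Matrix V V ℝ}
    (hA : A.PosSemidef) {B : ℕ → Matrix V V ℝ} {L b₁ b₂ : ℕ} (h12 : b₁ ≤ b₂) (h2 : b₂ < L)
    (hB : ∀ i, i ≠ b₁ → i ≠ b₂ → B i = A) {d c : ℝ} (hd : ∀ i, ‖B i‖ ≤ d) (hd1 : 1 ≤ d)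
    (hc0 : 0 < c) (hc1 : c ≤ 1) (hc : ∀ k, c * (A ^ k).trace ≤ (A ^ (k + 1)).trace) :
    ((List.range L).map B).prod.trace ≤ 2 * d ^ 2 / c ^ 2 * (A ^ L).trace := by
  have hpos : ∀ k, 0 ≤ (A ^ k).trace := fun k => (hA.pow k).trace_nonneg
  rw [List.range_eq_range', prod_map_range'_eq_pow_mul (A := A) (b := b₁) (Nat.zero_le _)
    (by omega) fun i _ hi => hB i hi.ne (by omega), Nat.zero_add, Nat.sub_zero]
  rw [div_mul_eq_mul_div, le_div_iff₀ (by positivity)]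
  -- If the exceptional positions coincide, one power of A is replaced and the surplus factors are
  -- given away by c ≤ 1 ≤ d. Otherwise two powers are missing, and each is restored at the price of
  -- 1/c.
  rcases h12.eq_or_lt with rfl | hlt
  · rw [prod_map_range'_eq_pow (A := A) fun i hi _ => hB i (by omega) (by omega),
      Matrix.trace_mul_comm, ← mul_assoc, ← pow_add]
    obtain ⟨L', rfl⟩ : ∃ L', L = L' + 1 := ⟨L - 1, by omega⟩
    rw [show L' + 1 - b₁ - 1 + b₁ = L' by omega]
    have h3 := (trace_pow_mul_le (D := B b₁) hA L').trans
      (mul_le_mul_of_nonneg_right (hd b₁) (hpos L'))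
    have h4 : (A ^ L' * B b₁).trace * c ≤ d * (A ^ (L' + 1)).trace := by
      nlinarith [hc L']
    have h5 := hpos (L' + 1)
    calc (A ^ L' * B b₁).trace * c ^ 2 = (A ^ L' * B b₁).trace * c * c := by ring
      _ ≤ d * (A ^ (L' + 1)).trace * c := mul_le_mul_of_nonneg_right h4 hc0.le
      _ ≤ d * (A ^ (L' + 1)).trace * 1 := mul_le_mul_of_nonneg_left hc1 (by positivity)
      _ ≤ 2 * d ^ 2 * (A ^ (L' + 1)).trace := by
        rw [mul_one]; exact mul_le_mul_of_nonneg_right (by nlinarith) h5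
  · rw [prod_map_range'_eq_pow_mul (A := A) (b := b₂) (by omega) (by omega)
      fun i hi hi' => hB i (by omega) (by omega),
      prod_map_range'_eq_pow (A := A) fun i hi _ => hB i (by omega) (by omega)]
    obtain ⟨L', rfl⟩ : ∃ L', L = L' + 2 := ⟨L - 2, by omega⟩
    have h3 : A ^ b₁ * B b₁ * (A ^ (b₂ - (b₁ + 1)) * B b₂ *
        A ^ (b₁ + 1 + (L' + 2 - b₁ - 1) - b₂ - 1)) =
        (A ^ b₁ * B b₁ * A ^ (b₂ - (b₁ + 1)) * B b₂) *
        A ^ (b₁ + 1 + (L' + 2 - b₁ - 1) - b₂ - 1) := by simp only [mul_assoc]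
    -- By cyclicity the last power of A joins the first, which gives the form with two powers and
    -- two insertions.
    rw [h3, Matrix.trace_mul_comm, ← mul_assoc, ← mul_assoc, ← mul_assoc, ← pow_add]
    have h4 := trace_pow_mul_pow_mul_le hA (hd b₁) (hd b₂)
      (b₁ + 1 + (L' + 2 - b₁ - 1) - b₂ - 1 + b₁) (b₂ - (b₁ + 1))
    rw [show b₁ + 1 + (L' + 2 - b₁ - 1) - b₂ - 1 + b₁ + (b₂ - (b₁ + 1)) = L' by omega] at h4
    have h5 : (A ^ L').trace * c ^ 2 ≤ (A ^ (L' + 2)).trace := by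
      have h6 := mul_le_mul_of_nonneg_left (hc L') hc0.le
      have h7 := hc (L' + 1)
      calc (A ^ L').trace * c ^ 2 = c * (c * (A ^ L').trace) := by ring
        _ ≤ _ := h6.trans h7
    refine (mul_le_mul_of_nonneg_right h4 (by positivity)).trans ?_
    rw [mul_assoc]
    exact mul_le_mul_of_nonneg_left h5 (by positivity)

variable {n L : ℕ} {H : Coeffs n} {δ : ℝ}

/-- The product of the transfer matrices of one factor `C C†`. -/
noncomputable def blockTransfer (H : Coeffs n) (δ : ℝ) (S : Finset (Leg n L)) (i : ℕ) :
    Matrix (Fin n → Fin 2) (Fin n → Fin 2) ℝ :=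
  (List.ofFn fun j : Fin (blockGates n).length => flippedGateMatrix H δ (blockGates n)[j]
    (headBits S (i * (blockGates n).length + j))).prod

/-- The operators repeat with the period of one block, so the transfer matrices can be grouped into
L blocks. -/
theorem prod_ofFn_transferMatrix (S : Finset (Leg n L)) :
    (List.ofFn (transferMatrix H δ S)).prod =
      ((List.range L).map (blockTransfer H δ S)).prod := by
  have h1 : (List.range L).map (blockTransfer H δ S) =
      List.ofFn fun i : Fin L => blockTransfer H δ S i := by
    refine List.ext_getElem (by simp) fun i _ _ => by simp
  rw [h1, List.ofFn_congr length_gates, List.ofFn_mul, List.prod_flatten, List.map_ofFn]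
  congr 2
  funext i
  rw [Function.comp_apply, blockTransfer]
  congr 2
  funext j
  have hj : ((i : ℕ) * (blockGates n).length + j) % (blockGates n).length = j := by
    rw [mul_comm, Nat.mul_add_mod, Nat.mod_eq_of_lt j.2]
  rw [transferMatrix]
  congr 1
  obtain ⟨h, he⟩ := op_eq_getElem (n := n) (L := L)
    (Fin.cast length_gates.symm ⟨(i : ℕ) * (blockGates n).length + j, by
      calc (i : ℕ) * (blockGates n).length + j < (i + 1) * (blockGates n).length := by
            rw [add_mul, one_mul]; exact Nat.add_lt_add_left j.2 _
        _ ≤ _ := Nat.mul_le_mul_right _ i.2⟩)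
  rw [he]
  simp only [Fin.val_cast, hj]
  rfl

theorem blockTransfer_eq {S : Finset (Leg n L)} {i : ℕ}
    (h : ∀ k ∈ S, i ≠ (k.1 : ℕ) / (blockGates n).length) :
    blockTransfer H δ S i = blockMatrix H δ := by
  rw [blockTransfer, blockMatrix]
  congr 1
  refine List.ext_getElem (by simp) fun j hj _ => ?_
  rw [List.getElem_ofFn, List.getElem_map]
  have hj' : j < (blockGates n).length := by simpa using hj
  have h0 : headBits S (i * (blockGates n).length + j) = 0 := by
    funext q
    rw [headBits, if_neg]
    · rfl
    rintro ⟨k, hk, hki, -⟩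
    apply h k hk
    rw [hki, mul_comm, Nat.mul_add_div (by omega), Nat.div_eq_of_lt hj', add_zero]
  simp only [h0, flippedGateMatrix_zero]
  rfl

/-- The flips amount to multiplication by a permutation matrix on the right. -/
theorem norm_flippedGateMatrix_le (g : Gate n) (h : Fin n → Fin 2) :
    ‖flippedGateMatrix H δ g h‖ ≤ ‖gateMatrix H δ g‖ := by
  have h1 : flippedGateMatrix H δ g h =
      gateMatrix H δ g * Equiv.Perm.permMatrix ℝ (Equiv.addRight h).symm := by
    rw [Equiv.Perm.permMatrix, PEquiv.mul_toMatrix_toPEquiv]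
    rfl
  rw [h1]
  exact (Matrix.l2_opNorm_mul _ _).trans
    (mul_le_of_le_one_right (norm_nonneg _) (Matrix.permMatrix_l2_opNorm_le _))

theorem norm_blockTransfer_le (hH : H.IsStoquastic) (h0 : 0 ≤ δ) (S : Finset (Leg n L)) (i : ℕ) :
    ‖blockTransfer H δ S i‖ ≤ (1 + δ) ^ (blockGates n).length := by
  have key : ∀ l : List (Matrix (Fin n → Fin 2) (Fin n → Fin 2) ℝ), (∀ A ∈ l, ‖A‖ ≤ 1 + δ) →
      ‖l.prod‖ ≤ (1 + δ) ^ l.length := by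
    intro l
    induction l with
    | nil => intro _; simp
    | cons A l ih =>
      intro hl
      rw [List.prod_cons, List.length_cons, pow_succ']
      exact (Matrix.l2_opNorm_mul _ _).trans (mul_le_mul (hl A List.mem_cons_self)
        (ih fun B hB => hl B (List.mem_cons_of_mem _ hB)) (norm_nonneg _) (by linarith))
  have h1 := key (List.ofFn fun j : Fin (blockGates n).length => flippedGateMatrix H δ
    (blockGates n)[j] (headBits S (i * (blockGates n).length + j))) fun A hA => by
      obtain ⟨j, rfl⟩ := (List.mem_ofFn' _ _).1 hA
      exact (norm_flippedGateMatrix_le _ _).trans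
        (norm_gateMatrix_le hH h0 (mem_blockGates.1 (List.getElem_mem _)))
  rwa [List.length_ofFn] at h1

theorem prod_ofFn_transferMatrix_empty :
    (List.ofFn (transferMatrix H δ (∅ : Finset (Leg n L)))).prod = blockMatrix H δ ^ L := by
  rw [prod_ofFn_transferMatrix, List.range_eq_range']
  exact prod_map_range'_eq_pow fun i _ _ => blockTransfer_eq fun k hk => by simp at hk

/-- The weight of the configurations with two given worm heads, compared with the weight of the
configurations without worm heads. -/
theorem sum_weight_heads_le (hH : H.IsStoquastic) (h0 : 0 < δ) (h1 : δ ≤ 1 / 2) (hn : 1 ≤ n)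
    (hL : L ≠ 0) {S : Finset (Leg n L)} (hS : S.card = 2) :
    ∑ z ∈ Finset.univ.filter (fun z : Config n L => heads z = S), weight H δ z ≤
      2 * ((1 + δ) ^ (blockGates n).length) ^ 2 / ((1 - δ) ^ (blockGates n).length) ^ 2 *
        weightZero H δ L := by
  classical
  refine (sum_weight_heads_le_trace hH h0 h1 hn hL S).trans ?_
  have h2 := trace_le_weightZero hH h0 h1 hn hL
  rw [prod_ofFn_transferMatrix_empty] at h2
  refine le_trans ?_ (mul_le_mul_of_nonneg_left h2 (by
    have : 0 ≤ 1 - δ := by linarith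
    positivity))
  rw [prod_ofFn_transferMatrix]
  have hlen : ∀ k : Leg n L, (k.1 : ℕ) / (blockGates n).length < L := fun k =>
    Nat.div_lt_of_lt_mul (by
      rw [mul_comm]
      exact k.1.2.trans_eq length_gates)
  -- Two heads lie in at most two blocks; all other blocks equal CC†.
  obtain ⟨b₁, b₂, h12, hb2, hB⟩ : ∃ b₁ b₂ : ℕ, b₁ ≤ b₂ ∧ b₂ < L ∧ ∀ i, i ≠ b₁ → i ≠ b₂ →
      blockTransfer H δ S i = blockMatrix H δ := by
    obtain ⟨k, l, -, rfl⟩ := Finset.card_eq_two.1 hS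
    rcases le_total ((k.1 : ℕ) / (blockGates n).length) ((l.1 : ℕ) / (blockGates n).length)
      with h | h
    · refine ⟨_, _, h, hlen l, fun i hi hi' => blockTransfer_eq fun k' hk' => ?_⟩
      rcases Finset.mem_insert.1 hk' with rfl | hk'
      · exact hi
      · rw [Finset.mem_singleton.1 hk']; exact hi'
    · refine ⟨_, _, h, hlen k, fun i hi hi' => blockTransfer_eq fun k' hk' => ?_⟩
      rcases Finset.mem_insert.1 hk' with rfl | hk'
      · exact hi'
      · rw [Finset.mem_singleton.1 hk']; exact hi
  have hp : 0 < 1 - δ := by linarith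
  exact trace_prod_range_le (posSemidef_blockMatrix H δ) h12 hb2 hB
    (norm_blockTransfer_le hH h0.le S) (one_le_pow₀ (by linarith)) (pow_pos hp _)
    (pow_le_one₀ hp.le (by linarith))
    (mul_trace_pow_le (posSemidef_blockMatrix H δ)
      (pow_mul_norm_le_blockMatrix_mulVec hH h0.le (by linarith)))

/-- The trace is at most the dimension 2^n times the norm of the L-th power. -/
theorem weightZero_le (hH : H.IsStoquastic) (h0 : 0 < δ) (h1 : δ ≤ 1 / 2) (hn : 1 ≤ n)
    (hL : L ≠ 0) :
    weightZero H δ L ≤ 2 ^ n * ((1 + δ) ^ (blockGates n).length) ^ L := by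
  classical
  have h2 := sum_weight_heads_le_trace hH h0 h1 hn hL (∅ : Finset (Leg n L))
  rw [prod_ofFn_transferMatrix_empty] at h2
  have h3 : weightZero H δ L =
      ∑ z ∈ Finset.univ.filter (fun z : Config n L => heads z = ∅), weight H δ z := by
    refine Finset.sum_congr ?_ fun _ _ => rfl
    ext z
    rw [mem_headFree_iff_card]
    simp
  rw [h3]
  refine h2.trans ?_
  have h4 : ‖blockMatrix H δ‖ ≤ (1 + δ) ^ (blockGates n).length := by
    have := norm_blockTransfer_le hH h0.le (∅ : Finset (Leg n L)) 0
    rwa [blockTransfer_eq fun k hk => by simp at hk] at this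
  have h5 : ‖blockMatrix H δ ^ L‖ ≤ ((1 + δ) ^ (blockGates n).length) ^ L :=
    (norm_pow_le' _ (Nat.pos_of_ne_zero hL)).trans (pow_le_pow_left₀ (norm_nonneg _) h4 L)
  have h6 := trace_pow_le_card_mul L h5
  simpa using h6

end Transfer

/-! ### Counting operators and the final numerical estimates. -/

section Estimates

variable {n L : ℕ} {H : Coeffs n} {δ : ℝ}

theorem length_blockGates_le (hn : 1 ≤ n) : (blockGates n).length ≤ 4 * n ^ 2 := by
  have h1 : (stepGates n).length ≤ n * n + n := by
    rw [stepGates, List.length_append, List.length_flatMap, List.length_map, List.length_finRange]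
    refine Nat.add_le_add_right ?_ n
    have h2 := List.sum_le_card_nsmul ((List.finRange n).map fun i =>
      (((List.finRange n).filter fun j => i < j).map fun j => Gate.two i j).length) n (by
        intro x hx
        obtain ⟨i, -, rfl⟩ := List.mem_map.1 hx
        rw [List.length_map]
        exact (List.length_filter_le _ _).trans (by simp))
    simpa using h2
  rw [blockGates, List.length_append, List.length_reverse]
  nlinarith

theorem numOne_add_numTwo : numOne n L + numTwo n L = numOps n L := by
  have h := List.length_eq_countP_add_countP (fun g : Gate n => g.isTwoQubit) (l := gates n L)
  rw [numOps, h, add_comm, numOne, numTwo]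
  congr 2
  funext g
  cases g.isTwoQubit <;> rfl

theorem numLines_le (hn : 1 ≤ n) : numLines n L ≤ 8 * (n : ℝ) ^ 2 * L := by
  have h1 : (numOne n L : ℝ) + numTwo n L = numOps n L := by exact_mod_cast numOne_add_numTwo
  have h2 : (numOps n L : ℝ) ≤ L * (4 * (n : ℝ) ^ 2) := by
    rw [length_gates]
    push_cast
    exact mul_le_mul_of_nonneg_left (by exact_mod_cast length_blockGates_le hn) (Nat.cast_nonneg L)
  have h3 : (0 : ℝ) ≤ numOne n L := Nat.cast_nonneg _
  rw [numLines]
  linarith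

theorem one_le_numLines (hn : 1 ≤ n) (hL : L ≠ 0) : 1 ≤ numLines n L := by
  have h1 : (numOne n L : ℝ) + numTwo n L = numOps n L := by exact_mod_cast numOne_add_numTwo
  have h2 : (1 : ℝ) ≤ numOps n L := by
    exact_mod_cast Nat.one_le_iff_ne_zero.2 (numOps_ne_zero hn hL)
  have h3 : (0 : ℝ) ≤ numTwo n L := Nat.cast_nonneg _
  rw [numLines]
  linarith

/-- For the all-zero configuration every box contributes a diagonal entry, which is 1 or 1 - δ dᵢ.
-/
theorem le_weight_zero (hH : H.IsStoquastic) (h0 : 0 < δ) (h1 : δ ≤ 1 / 2) :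
    (1 - δ) ^ numOps n L ≤ weight H δ (ofStates fun _ _ => 0 : Config n L) := by
  have h2 : ∀ m : Fin (numOps n L), 1 - δ ≤ boxWeight H δ (ofStates fun _ _ => 0) m := by
    intro m
    have h3 : boxWeight H δ (ofStates fun _ _ => 0) m = (op m).weight H δ fun _ => 0 := by
      rw [boxWeight_eq]; congr 1; funext k; simp [ofStates]
    rw [h3]
    cases op m with
    | one i =>
      rw [weight_one_eq]
      simp only [if_true]
      have := (abs_le.1 (hH.2 i)).2
      nlinarith
    | two i j =>
      rw [weight_two_eq]
      simp only [twoWeight, and_self, if_true]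
      linarith
  have h3 := Finset.prod_le_prod (s := Finset.univ) (f := fun _ : Fin (numOps n L) => 1 - δ)
    (fun _ _ => by linarith) fun m _ => h2 m
  rwa [Finset.prod_const, Finset.card_univ, Fintype.card_fin] at h3

theorem exp_neg_le_one_sub (h0 : 0 ≤ δ) (h1 : δ ≤ 1 / 2) : Real.exp (-(2 * δ)) ≤ 1 - δ := by
  have h2 : Real.exp (-(2 * δ)) ≤ 1 / (1 + 2 * δ) := by
    rw [Real.exp_neg, one_div]
    exact inv_anti₀ (by linarith) (by linarith [Real.add_one_le_exp (2 * δ)])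
  refine h2.trans ?_
  -- The remaining inequality is 1 ≤ (1 - δ)(1 + 2δ), which is where δ ≤ 1/2 is used.
  rw [div_le_iff₀ (by linarith)]
  nlinarith

/-- The numerator costs exp(2δk) and the denominator exp(4δk), since 1 - δ ≥ exp(-2δ); together they
give the exponent 6. -/
theorem transfer_ratio_le (h0 : 0 ≤ δ) (h1 : δ ≤ 1 / 2) {k : ℕ} {c : ℝ} (hk : δ * k ≤ c) :
    2 * ((1 + δ) ^ k) ^ 2 / ((1 - δ) ^ k) ^ 2 ≤ 2 * Real.exp (6 * c) := by
  have hp : 0 < 1 - δ := by linarith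
  rw [div_le_iff₀ (by positivity)]
  have h2 : (1 + δ) ^ k ≤ Real.exp (δ * k) := by
    rw [mul_comm, Real.exp_nat_mul]
    exact pow_le_pow_left₀ (by linarith) (by linarith [Real.add_one_le_exp δ]) k
  have h3 : Real.exp (-(2 * (δ * k))) ≤ (1 - δ) ^ k := by
    rw [show -(2 * (δ * k)) = k * (-(2 * δ)) by ring, Real.exp_nat_mul]
    exact pow_le_pow_left₀ (Real.exp_pos _).le (exp_neg_le_one_sub h0 h1) k
  have h4 : (Real.exp (δ * k)) ^ 2 ≤ Real.exp (6 * c) * (Real.exp (-(2 * (δ * k)))) ^ 2 := by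
    rw [← Real.exp_nat_mul, ← Real.exp_nat_mul, ← Real.exp_add]
    refine Real.exp_le_exp.2 ?_
    push_cast
    linarith
  have h5 : ((1 + δ) ^ k) ^ 2 ≤ (Real.exp (δ * k)) ^ 2 := by gcongr
  have h6 : (Real.exp (-(2 * (δ * k)))) ^ 2 ≤ ((1 - δ) ^ k) ^ 2 := by gcongr
  have h7 := mul_le_mul_of_nonneg_left h6 (Real.exp_pos (6 * c)).le
  linarith

/-- The bound on log(1/π) at the all-zero configuration: the partition function is at most exp(n +
c) and the weight of the starting configuration is at least exp(-2c). -/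
theorem log_weight_ratio_le (hH : H.IsStoquastic) (h0 : 0 < δ) (h1 : δ ≤ 1 / 2) (hn : 1 ≤ n)
    (hL : L ≠ 0) {κ c : ℝ} (hκ : 1 ≤ κ) (hc : δ * numOps n L ≤ c)
    (hZ : 0 < weightZero H δ L) :
    Real.log ((1 + 2 * κ * numLines n L) * weightZero H δ L /
      weight H δ (ofStates fun _ _ => 0 : Config n L)) ≤
      Real.log (3 * κ * numLines n L) + n + 3 * c := by
  have hN := one_le_numLines hn hL
  have hp : 0 < 1 - δ := by linarith
  have hW := le_weight_zero (L := L) hH h0 h1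
  have hW0 : 0 < weight H δ (ofStates fun _ _ => 0 : Config n L) :=
    lt_of_lt_of_le (pow_pos hp _) hW
  have hκN : 1 ≤ κ * numLines n L := by nlinarith
  have h2 : Real.log (weightZero H δ L) ≤ n + c := by
    have h3 := weightZero_le hH h0 h1 hn hL
    rw [← pow_mul, mul_comm (blockGates n).length, ← length_gates] at h3
    have h4 : (1 + δ) ^ numOps n L ≤ Real.exp c := by
      refine le_trans ?_ (Real.exp_le_exp.2 hc)
      rw [mul_comm, Real.exp_nat_mul]
      exact pow_le_pow_left₀ (by linarith) (by linarith [Real.add_one_le_exp δ]) _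
    have h5 : (2 : ℝ) ^ n ≤ Real.exp n := by
      rw [← mul_one (n : ℝ), Real.exp_nat_mul]
      exact pow_le_pow_left₀ (by norm_num) (by linarith [Real.add_one_le_exp 1]) _
    rw [Real.log_le_iff_le_exp hZ, Real.exp_add]
    exact h3.trans (mul_le_mul h5 h4 (by positivity) (Real.exp_pos _).le)
  have h3 : -(2 * c) ≤ Real.log (weight H δ (ofStates fun _ _ => 0 : Config n L)) := by
    rw [Real.le_log_iff_exp_le hW0]
    refine le_trans ?_ hW
    refine le_trans ?_ (pow_le_pow_left₀ (Real.exp_pos _).le (exp_neg_le_one_sub h0.le h1) _)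
    rw [← Real.exp_nat_mul]
    exact Real.exp_le_exp.2 (by linarith)
  rw [Real.log_div (by positivity) hW0.ne', Real.log_mul (by positivity) hZ.ne']
  have h4 : Real.log (1 + 2 * κ * numLines n L) ≤ Real.log (3 * κ * numLines n L) :=
    Real.log_le_log (by positivity) (by linarith)
  linarith

/-- The elementary estimate that combines the Poincaré constant and the size of the state space. -/
theorem mixing_bound_arith {K κ n β ε L N δ c l e T : ℝ} (hK : 0 < K) (hκ : 1 ≤ κ) (hn : 1 ≤ n)
    (hβ : 1 ≤ β) (hε : 0 < ε) (hε1 : ε ≤ 1) (hL : 0 < L) (hδ : δ = β / (2 * L))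
    (hLK : L ≤ K * (n ^ 2 * β ^ 2 / ε)) (hN1 : 1 ≤ N) (hN : N ≤ 8 * n ^ 2 * L) (hc0 : 0 < c)
    (hc1 : c ≤ 1) (hl : l = Real.log (n * β / ε)) (he : 0 ≤ e)
    (hT : T ≤ Real.log (3 * κ * N) + n + 6 * (n ^ 2 * β)) :
    832 * κ ^ 2 * N ^ 3 / (δ * c) * (T + 2 * e) + 1 ≤
      (832 * 1024 * κ ^ 2 * K ^ 4 * (|Real.log (24 * κ * K)| + 13) + 1) * c⁻¹ *
        (n ^ 16 * β ^ 8 / ε ^ 4) * (1 + l) ^ 1 * (1 + e) := by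
  have hn0 : 0 < n := by linarith
  have hβ0 : 0 < β := by linarith
  have hN0 : 0 < N := by linarith
  have hκ0 : 0 < κ := by linarith
  set a := |Real.log (24 * κ * K)| with ha
  have ha0 : 0 ≤ a := abs_nonneg _
  have hr : 1 ≤ n * β / ε := by
    rw [le_div_iff₀ hε]; nlinarith
  have hl0 : 0 ≤ l := hl ▸ Real.log_nonneg hr
  have hX : 1 ≤ n ^ 2 * β := by nlinarith [one_le_pow₀ hn (n := 2)]
  have hnX : n ≤ n ^ 2 * β := by nlinarith [mul_le_mul_of_nonneg_left hn hn0.le]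
  have hlogN : Real.log (3 * κ * N) ≤ a + 4 * l := by
    -- The exact power n⁴β²/ε is rounded up to (nβ/ε)⁴; only the constant in front of the logarithm
    -- is affected.
    have h1 : 3 * κ * N ≤ (24 * κ * K) * (n * β / ε) ^ 4 := by
      calc 3 * κ * N ≤ 3 * κ * (8 * n ^ 2 * (K * (n ^ 2 * β ^ 2 / ε))) := by gcongr; exact hN.trans (by gcongr)
        _ = 24 * κ * K * (n ^ 4 * β ^ 2 / ε) := by ring
        _ ≤ 24 * κ * K * (n * β / ε) ^ 4 := by
          refine mul_le_mul_of_nonneg_left ?_ (by positivity)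
          rw [div_pow, mul_pow]
          gcongr
          · norm_num
          · exact pow_le_of_le_one hε.le hε1 (by norm_num)
    refine (Real.log_le_log (by positivity) h1).trans ?_
    rw [Real.log_mul (by positivity) (by positivity), Real.log_pow, ← hl]
    push_cast
    linarith [le_abs_self (Real.log (24 * κ * K))]
  have hTle : T + 2 * e ≤ (a + 13) * (n ^ 2 * β) * (1 + l) * (1 + e) := by
    have h1 : T + 2 * e ≤ (a + 7) * (n ^ 2 * β) + 4 * l + 2 * e := by nlinarith
    have h2 : l ≤ n ^ 2 * β * l := by nlinarith
    have h3 : e ≤ n ^ 2 * β * e := by nlinarith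
    have h4 : 0 ≤ n ^ 2 * β * (l * e) := by positivity
    have h5 : (a + 7) * (n ^ 2 * β) + 4 * l + 2 * e ≤
        (a + 7) * (n ^ 2 * β) + 4 * (n ^ 2 * β * l) + 2 * (n ^ 2 * β * e) := by linarith
    refine (h1.trans h5).trans ?_
    have h6 : 0 ≤ n ^ 2 * β * l := by positivity
    have h7 : 0 ≤ n ^ 2 * β * e := by positivity
    have h8 : (a + 13) * (n ^ 2 * β) * (1 + l) * (1 + e) = (a + 13) * (n ^ 2 * β) +
      (a + 13) * (n ^ 2 * β * l) + (a + 13) * (n ^ 2 * β * e) +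
      (a + 13) * (n ^ 2 * β * (l * e)) := by ring
    rw [h8]
    have h9 := mul_nonneg ha0 h6
    have h10 := mul_nonneg ha0 h7
    have h11 := mul_nonneg ha0 h4
    linarith
  -- N³/δ becomes (8n²L)³ · 2L/β, whence 1024 = 8³ · 2 and the fourth power of L; the remaining n²β
  -- comes from the logarithm of the stationary weight.
  have hR : 832 * κ ^ 2 * N ^ 3 / (δ * c) ≤
      832 * 1024 * κ ^ 2 * K ^ 4 * c⁻¹ * (n ^ 14 * β ^ 7 / ε ^ 4) := by
    calc 832 * κ ^ 2 * N ^ 3 / (δ * c) ≤ 832 * κ ^ 2 * (8 * n ^ 2 * L) ^ 3 / (δ * c) := by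
          have : 0 < δ := by rw [hδ]; positivity
          gcongr
      _ = 832 * 1024 * κ ^ 2 * c⁻¹ * (n ^ 6 * L ^ 4 / β) := by
          rw [hδ]; field_simp; ring
      _ ≤ 832 * 1024 * κ ^ 2 * c⁻¹ * (n ^ 6 * (K * (n ^ 2 * β ^ 2 / ε)) ^ 4 / β) := by gcongr
      _ = 832 * 1024 * κ ^ 2 * K ^ 4 * c⁻¹ * (n ^ 14 * β ^ 7 / ε ^ 4) := by
          field_simp
  -- This absorbs the additive 1 that comes from rounding the mixing time up to an integer.
  have hone : 1 ≤ c⁻¹ * (n ^ 16 * β ^ 8 / ε ^ 4) * (1 + l) * (1 + e) := by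
    have h1 : 1 ≤ c⁻¹ := (one_le_inv₀ hc0).2 hc1
    have h2 : 1 ≤ n ^ 16 * β ^ 8 / ε ^ 4 := by
      rw [one_le_div (by positivity)]
      calc ε ^ 4 ≤ 1 := pow_le_one₀ hε.le hε1
        _ ≤ n ^ 16 * β ^ 8 := one_le_mul_of_one_le_of_one_le (one_le_pow₀ hn) (one_le_pow₀ hβ)
    exact one_le_mul_of_one_le_of_one_le (one_le_mul_of_one_le_of_one_le
      (one_le_mul_of_one_le_of_one_le h1 h2) (by linarith)) (by linarith)
  have hR0 : 0 ≤ 832 * κ ^ 2 * N ^ 3 / (δ * c) := by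
    have : 0 < δ := by rw [hδ]; positivity
    positivity
  have hmain := (mul_le_mul_of_nonneg_left hTle hR0).trans
    (mul_le_mul_of_nonneg_right hR (by positivity))
  have hfin : 832 * 1024 * κ ^ 2 * K ^ 4 * c⁻¹ * (n ^ 14 * β ^ 7 / ε ^ 4) *
      ((a + 13) * (n ^ 2 * β) * (1 + l) * (1 + e)) = 832 * 1024 * κ ^ 2 * K ^ 4 * (a + 13) *
      (c⁻¹ * (n ^ 16 * β ^ 8 / ε ^ 4) * (1 + l) * (1 + e)) := by ring
  rw [hfin] at hmain
  have hexp : (832 * 1024 * κ ^ 2 * K ^ 4 * (a + 13) + 1) * c⁻¹ *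
        (n ^ 16 * β ^ 8 / ε ^ 4) * (1 + l) ^ 1 * (1 + e) = 832 * 1024 * κ ^ 2 * K ^ 4 * (a + 13) *
      (c⁻¹ * (n ^ 16 * β ^ 8 / ε ^ 4) * (1 + l) * (1 + e)) +
      c⁻¹ * (n ^ 16 * β ^ 8 / ε ^ 4) * (1 + l) * (1 + e) := by ring
  rw [hexp]
  linarith

end Estimates

end XYWorm

/-! ### Choice of the constants and conclusion. -/

theorem mainTheorem1 :
    ∀ K : ℝ, 0 < K → ∃ C : ℝ, 0 < C ∧ ∃ p : ℕ,
      ∀ (n : ℕ) (H : XYWorm.Coeffs n) (β ε : ℝ) (L : ℕ),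
        1 ≤ n → H.IsStoquastic → 1 ≤ β → 0 < ε → ε ≤ 1 →
        β ≤ (L : ℝ) → (n : ℝ) ^ 2 * β ^ 2 ≤ K * (L : ℝ) →
        (L : ℝ) ≤ K * ((n : ℝ) ^ 2 * β ^ 2 / ε) →
        ∃ x : XYWorm.State H (β / (2 * (L : ℝ))) L,
          x.1 = XYWorm.ofStates (fun _ _ => 0) ∧
          ∀ η : ℝ, 0 < η → η < 1 →
            ∃ t : ℕ,
              XYWorm.IsMixingTime (XYWorm.transition H (β / (2 * (L : ℝ))) L)
                (XYWorm.stationary H (β / (2 * (L : ℝ)))) x η t ∧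
              (t : ℝ) ≤ C * H.cMin⁻¹ * ((n : ℝ) ^ 16 * β ^ 8 / ε ^ 4) *
                (1 + Real.log ((n : ℝ) * β / ε)) ^ p * (1 + Real.log (1 / η)) := by
  intro K hK
  -- The bound of `transfer_ratio_le` for a block, with δ times the length of a block at most 2K.
  set κ : ℝ := 2 * Real.exp (6 * (2 * K)) with hκdef
  have hκ1 : 1 ≤ κ := by
    have := Real.one_le_exp (by positivity : 0 ≤ 6 * (2 * K))
    linarith
  refine ⟨832 * 1024 * κ ^ 2 * K ^ 4 * (|Real.log (24 * κ * K)| + 13) + 1, by positivity, 1, ?_⟩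
  intro n H β ε L hn hH hβ hε hε1 hβL hKL hLK
  have hL0 : (0 : ℝ) < L := by linarith
  have hL : L ≠ 0 := by rintro rfl; simp at hL0
  have hn1 : (1 : ℝ) ≤ n := by exact_mod_cast hn
  set δ : ℝ := β / (2 * (L : ℝ)) with hδ
  have h0 : 0 < δ := by positivity
  have h1 : δ ≤ 1 / 2 := by
    rw [hδ, div_le_div_iff₀ (by positivity) (by norm_num)]; linarith
  have hp : 0 < 1 - δ := by linarith
  have hδL : δ * L = β / 2 := by rw [hδ]; field_simp
  have hlen : ((XYWorm.blockGates n).length : ℝ) ≤ 4 * (n : ℝ) ^ 2 := by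
    exact_mod_cast XYWorm.length_blockGates_le hn
  -- A block has at most 4n² operators, so the product is at most 2n²β/L. Since β ≥ 1, the
  -- assumption n²β² ≤ KL bounds it by 2K.
  have hδlen : δ * (XYWorm.blockGates n).length ≤ 2 * K := by
    refine (mul_le_mul_of_nonneg_left hlen h0.le).trans ?_
    rw [hδ, div_mul_eq_mul_div, div_le_iff₀ (by positivity)]
    nlinarith [mul_le_mul_of_nonneg_left hβ (by positivity : 0 ≤ (n : ℝ) ^ 2 * β)]
  have hδops : δ * XYWorm.numOps n L ≤ 2 * ((n : ℝ) ^ 2 * β) := by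
    rw [XYWorm.length_gates]
    push_cast
    rw [← mul_assoc, hδL]
    nlinarith
  have hW := XYWorm.le_weight_zero (L := L) hH h0 h1
  have hW0 := lt_of_lt_of_le (pow_pos hp _) hW
  have hheads : (XYWorm.heads (XYWorm.ofStates fun _ _ => 0 : XYWorm.Config n L)).card = 0 := by
    -- A constant string is trivially a world line.
    rw [XYWorm.IsWorldLine.heads_ofStates fun _ _ _ => rfl, Finset.card_empty]
  have hZ : 0 < XYWorm.weightZero H δ L :=
    lt_of_lt_of_le hW0 (Finset.single_le_sum (f := fun z => XYWorm.weight H δ z)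
      (fun z _ => XYWorm.weight_nonneg hH h0 h1 z) ((XYWorm.mem_headFree_iff_card _).2 hheads))
  refine ⟨⟨XYWorm.ofStates fun _ _ => 0, Or.inl hheads, hW0.ne'⟩, rfl, fun η hη hη1 => ?_⟩
  obtain ⟨t, ht, hle⟩ := XYWorm.exists_mixingTime_le hH h0 h1 hn hL
    (XYWorm.one_le_numLines hn hL) hκ1 hZ
    (fun z hz => (XYWorm.sum_weight_heads_le hH h0 h1 hn hL
      ((XYWorm.mem_twoHeaded_iff_card z).1 hz)).trans
      (mul_le_mul_of_nonneg_right (XYWorm.transfer_ratio_le h0.le h1 hδlen) hZ.le))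
    ⟨XYWorm.ofStates fun _ _ => 0, Or.inl hheads, hW0.ne'⟩ hheads hη hη1
  refine ⟨t, ht, hle.trans ?_⟩
  have hlog := XYWorm.log_weight_ratio_le hH h0 h1 hn hL hκ1 hδops hZ
  exact XYWorm.mixing_bound_arith hK hκ1 hn1 hβ hε hε1 hL0 hδ hLK
    (XYWorm.one_le_numLines hn hL) (XYWorm.numLines_le hn) (XYWorm.cMin_pos hH)
    (XYWorm.cMin_le_one H) rfl
    (Real.log_nonneg (by rw [le_div_iff₀ hη]; linarith)) (hlog.trans (by linarith))
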